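/- Let $R$ be a commutative ring (for instance $R=\mathbb{C}$). **Signed permutations and algebras.** A signed permutation of size $n$ is a permutation $\tau\in\mathfrak{S}_n$ together with a sign $\pm$ on each of its dots $(i,\tau(i))$; its v-signature lists the signs by increasing values. Let $\mathfrak{S}^{(n,n')}$ be the set of permutations of $[n+n']$ that are increasing on $\{1,\dots,n\}$ and on $\{n+1,\dots,n+n'\}$. For signed permutations $\tau,\tau'$ of sizes $n,n'$, let $\tau\bar\tau'=[\tau(1),\dots,\tau(n),\tau'(1)+n,\dots,\tau'(n')+n]$ and let $\tau\star\tau'=\{\pi\circ(\tau\bar\tau') : \pi\in\mathfrak{S}^{(n,n')}\}$, where the signs stay at their positions. $\mathrm{FQSym}_\pm^*$ is the free $R$-module on the basis $(\mathbb{G}_\tau)$, $\tau$ ranging over all signed permutations, with product $\mathbb{G}_\tau\cdot\mathbb{G}_{\tau'}=\sum_{\sigma\in\tau\star\tau'}\mathbb{G}_\sigma$. The Cambrian congruence is the equivalence relation on signed permutations generated by $UacVbW\equiv UcaVbW$ if $a<b<c$ and $b$ is negative, and $UbVacW\equiv UbVcaW$ if $a<b<c$ and $b$ is positive (signs travel with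 the values). The dual Cambrian algebra $\mathrm{Camb}^*$ is the quotient of $\mathrm{FQSym}_\pm^*$ by the span of all $\mathbb{G}_\tau-\mathbb{G}_{\tau'}$ with $\tau\equiv\tau'$ (which is a two-sided ideal); let $\pi$ be the projection. **Cambrian trees.** A Cambrian tree of size $n\ge 0$ is a directed tree with vertices labeled bijectively by $[n]$, with edges oriented upwards and with leaves (half-edges) at the bottom and at the top, such that each vertex has either one parent and two children (a negative vertex) or one child and two parents (a positive vertex), parents and children possibly being leaves; the two children (resp. parents) are a left and a right one, and all labels in the corresponding left (resp. right) subtree are smaller (resp. larger) than the label of the vertex. For $n=0$ the tree is a single edge from a down leaf to an up leaf. The signature of the tree is its sequence of signs by increasing labels. From left to right, there is one down leaf in each interval between consecutive negative labels, and one up leaf in each interval between consecutive positive labels (unbounded intervals included). A linear extension of $T$ is a signed permutation $\tau$ whose v-signature is the signature of $T$ and such that $\tau^{-1}(v)<\tau^{-1}(w)$ for each edge $v\to w$ of $T$. Set $\mathbb{Q}_T=\pi(\mathbb{G}_\tau)$ for any linear extension $\tau$ of $T$. **Cutting and gluing.** A gap of $[n]$ is one of the $n+1$ positions before, between and after the integers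 of $[n]$. A gap $\gamma$ defines a vertical path in $T$: the directed path from the down leaf in the same interval of consecutive negative labels as $\gamma$ to the up leaf in the same interval of consecutive positive labels as $\gamma$. A multiset of gaps thus defines a multiset of pairwise non-crossing vertical paths (a lamination), and cutting $T$ along these paths gives a forest: an edge contained in $m$ of the paths is split into $m+1$ parallel strands, a vertex stays attached to the strands lying between the paths passing on its left and those passing on its right, and strands continue along the vertices to which they are no longer attached. The down leaves and the up leaves of this forest are ordered from left to right. Let $T,T'$ be Cambrian trees with signatures $\varepsilon\in\pm^n$ and $\varepsilon'\in\pm^{n'}$, and let $s$ be a shuffle of $\varepsilon$ and $\varepsilon'$ (the origin of each letter is remembered, so there are $\binom{n+n'}{n}$ shuffles). Let $\Gamma$ be the multiset of gaps of $[n]$ given by the positions in $s$ of the negative signs of $\varepsilon'$, and let $\Gamma'$ be the multiset of gaps of $[n']$ given by the positions in $s$ of the positive signs of $\varepsilon$. Then $T\,{}_s\!\backslash\,T'$ is obtained by connecting the up leaves of the forest obtained from $T$ by cutting along $\Gamma$ to the down leaves of the forest obtained from $T'$ by cutting along $\Gamma'$, in order from left to right, each vertex being relabeled by the position of its sign in $s$.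 **Proposition.** For all Cambrian trees $T,T'$, the element $\mathbb{Q}_T$ does not depend on the choice of the linear extension of $T$, $T\,{}_s\!\backslash\,T'$ is a Cambrian tree for every shuffle $s$ of the signatures of $T$ and $T'$, and in $\mathrm{Camb}^*$ $$\mathbb{Q}_T\cdot\mathbb{Q}_{T'}=\sum_s\mathbb{Q}_{T\,{}_s\!\backslash\,T'},$$ where $s$ runs over all shuffles of the signatures of $T$ and $T'$. -/

import Mathlib

open scoped Classical

/-! ### Signed permutations and the algebra on the basis `G` -/

namespace Cambrian

/-- The two signs `-` and `+`. -/
inductive Sgn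
  | minus
  | plus

/-- A signed permutation of size `n`: `perm` maps positions to values, and `sign` is the
v-signature, that is, `sign v` is the sign carried by the value `v`. -/
@[ext]
structure SignedPerm (n : ℕ) where
  perm : Equiv.Perm (Fin n)
  sign : Fin n → Sgn

/-- Permutations of `n + n'` letters that are increasing on the first `n` and on the last `n'`
letters. Such a permutation is also a shuffle of two words of lengths `n` and `n'`: the `i`-th
letter of the first word is put in position `s i`, the `j`-th letter of the second word in
position `s (n + j)`. -/
def Shuffle (n n' : ℕ) : Type :=
  {s : Equiv.Perm (Fin (n + n')) //
    StrictMono (fun i : Fin n => s (Fin.castAdd n' i)) ∧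
    StrictMono (fun j : Fin n' => s (Fin.natAdd n j))}

noncomputable instance (n n' : ℕ) : Fintype (Shuffle n n') :=
  inferInstanceAs (Fintype {_s : Equiv.Perm (Fin (n + n')) // _})

namespace Shuffle

variable {n n' : ℕ}

/-- The position in the shuffle of the `i`-th letter of the first word. -/
def fst (s : Shuffle n n') (i : Fin n) : Fin (n + n') := s.1 (Fin.castAdd n' i)

/-- The position in the shuffle of the `j`-th letter of the second word. -/
def snd (s : Shuffle n n') (j : Fin n') : Fin (n + n') := s.1 (Fin.natAdd n j)

/-- The word obtained by shuffling the words `ε` and `ε'` according to `s`. -/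
def word (s : Shuffle n n') (ε : Fin n → Sgn) (ε' : Fin n' → Sgn) : Fin (n + n') → Sgn :=
  fun w => Fin.append ε ε' (s.1.symm w)

end Shuffle

/-- The permutation `[τ(1), …, τ(n), τ'(1) + n, …, τ'(n') + n]`. -/
def shiftedConcat {n n' : ℕ} (τ : Equiv.Perm (Fin n)) (τ' : Equiv.Perm (Fin n')) :
    Equiv.Perm (Fin (n + n')) :=
  (finSumFinEquiv.symm.trans (Equiv.sumCongr τ τ')).trans finSumFinEquiv

/-- The element of the signed convolution of `τ` and `τ'` indexed by `s`: its permutation is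
`s ∘ (shifted concatenation of τ and τ')`, and the signs stay at their positions. -/
def conv {n n' : ℕ} (s : Shuffle n n') (τ : SignedPerm n) (τ' : SignedPerm n') :
    SignedPerm (n + n') where
  perm := (shiftedConcat τ.perm τ'.perm).trans s.1
  sign := s.word τ.sign τ'.sign

/-- One rewriting step `UacVbW → UcaVbW` (with `b` negative) or `UbVacW → UbVcaW` (with `b`
positive), where `a < b < c`; the signs travel with the values. -/
def CambrianStep {n : ℕ} (τ τ' : SignedPerm n) : Prop :=
  τ'.sign = τ.sign ∧ ∃ i i' j : Fin n, (i' : ℕ) = i + 1 ∧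
    τ.perm i < τ.perm j ∧ τ.perm j < τ.perm i' ∧
    ((i' < j ∧ τ.sign (τ.perm j) = Sgn.minus) ∨ (j < i ∧ τ.sign (τ.perm j) = Sgn.plus)) ∧
    τ'.perm = (Equiv.swap i i').trans τ.perm

/-- The Cambrian congruence: the equivalence relation generated by the rewriting steps. -/
def CambrianCongruent {n : ℕ} : SignedPerm n → SignedPerm n → Prop :=
  Relation.EqvGen CambrianStep

/-- The underlying space of the dual algebra on signed permutations: the free module with basis
`G τ`, for `τ` a signed permutation of any size. -/
def FQSymDual (R : Type*) [CommRing R] : Type _ := (Σ n, SignedPerm n) →₀ R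

noncomputable instance (R : Type*) [CommRing R] : AddCommGroup (FQSymDual R) :=
  inferInstanceAs (AddCommGroup ((Σ n, SignedPerm n) →₀ R))

noncomputable instance (R : Type*) [CommRing R] : Module R (FQSymDual R) :=
  inferInstanceAs (Module R ((Σ n, SignedPerm n) →₀ R))

variable (R : Type*) [CommRing R]

/-- The basis of `FQSymDual R`. -/
noncomputable def FQSymDual.basis : Module.Basis (Σ n, SignedPerm n) R (FQSymDual R) :=
  Module.Basis.ofRepr (LinearEquiv.refl R ((Σ n, SignedPerm n) →₀ R))

/-- The basis element `G τ`. -/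
noncomputable def G {n : ℕ} (τ : SignedPerm n) : FQSymDual R := FQSymDual.basis R ⟨n, τ⟩

/-- The bilinear product with `G τ * G τ' = ∑ G σ`, for `σ` in the signed convolution of `τ`
and `τ'`. -/
noncomputable def FQSymDual.mul : FQSymDual R →ₗ[R] FQSymDual R →ₗ[R] FQSymDual R :=
  (FQSymDual.basis R).constr R fun a =>
    (FQSymDual.basis R).constr R fun b => ∑ s : Shuffle a.1 b.1, G R (conv s a.2 b.2)

noncomputable instance : Mul (FQSymDual R) := ⟨fun x y => FQSymDual.mul R x y⟩

theorem G_mul_G {n n' : ℕ} (τ : SignedPerm n) (τ' : SignedPerm n') :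
    G R τ * G R τ' = ∑ s : Shuffle n n', G R (conv s τ τ') := by
  change FQSymDual.mul R (FQSymDual.basis R ⟨n, τ⟩) (FQSymDual.basis R ⟨n', τ'⟩) = _
  simp only [FQSymDual.mul, Module.Basis.constr_basis]

/-- The subspace of relations `G τ = G τ'` for `τ`, `τ'` Cambrian congruent. -/
noncomputable def cambrianRelations : Submodule R (FQSymDual R) :=
  Submodule.span R {x | ∃ (n : ℕ) (τ τ' : SignedPerm n),
    CambrianCongruent τ τ' ∧ x = G R τ - G R τ'}

/-! The relations form a two-sided ideal, because convolution with a fixed signed permutation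
preserves the rewriting steps. -/

theorem conv_perm_castAdd {n n' : ℕ} (s : Shuffle n n') (τ : SignedPerm n) (τ' : SignedPerm n')
    (i : Fin n) : (conv s τ τ').perm (Fin.castAdd n' i) = s.fst (τ.perm i) := by
  simp [conv, shiftedConcat, Shuffle.fst]

theorem conv_perm_natAdd {n n' : ℕ} (s : Shuffle n n') (τ : SignedPerm n) (τ' : SignedPerm n')
    (j : Fin n') : (conv s τ τ').perm (Fin.natAdd n j) = s.snd (τ'.perm j) := by
  simp [conv, shiftedConcat, Shuffle.snd]

theorem conv_step_left {n n' : ℕ} (s : Shuffle n n') {τ τ₁ : SignedPerm n} (τ' : SignedPerm n')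
    (h : CambrianStep τ τ₁) : CambrianStep (conv s τ τ') (conv s τ₁ τ') := by
  obtain ⟨hs, i, i', j, hi, h1, h2, h3, h4⟩ := h
  refine ⟨by simp [conv, hs], Fin.castAdd n' i, Fin.castAdd n' i', Fin.castAdd n' j,
    by simpa using hi, ?_, ?_, ?_, ?_⟩
  · rw [conv_perm_castAdd, conv_perm_castAdd]; exact s.2.1 h1
  · rw [conv_perm_castAdd, conv_perm_castAdd]; exact s.2.1 h2
  · rw [conv_perm_castAdd]
    have hl : ∀ a b : Fin n, Fin.castAdd n' a < Fin.castAdd n' b ↔ a < b := fun _ _ => Iff.rfl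
    simpa [conv, Shuffle.word, Shuffle.fst, hl] using h3
  · ext x : 1
    induction x using Fin.addCases with
    | left x =>
      rw [conv_perm_castAdd, h4]
      have : Equiv.swap (Fin.castAdd n' i) (Fin.castAdd n' i') (Fin.castAdd n' x) =
          Fin.castAdd n' (Equiv.swap i i' x) :=
        ((Fin.castAdd_injective n n').swap_apply i i' x)
      rw [Equiv.trans_apply, Equiv.trans_apply, this, conv_perm_castAdd]
    | right x =>
      rw [Equiv.trans_apply, Equiv.swap_apply_of_ne_of_ne, conv_perm_natAdd, conv_perm_natAdd] <;>
      · intro h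
        have := congrArg Fin.val h
        simp at this
        omega

theorem conv_step_right {n n' : ℕ} (s : Shuffle n n') (τ : SignedPerm n) {τ' τ₁ : SignedPerm n'}
    (h : CambrianStep τ' τ₁) : CambrianStep (conv s τ τ') (conv s τ τ₁) := by
  obtain ⟨hs, i, i', j, hi, h1, h2, h3, h4⟩ := h
  refine ⟨by simp [conv, hs], Fin.natAdd n i, Fin.natAdd n i', Fin.natAdd n j,
    by simp [hi, add_assoc], ?_, ?_, ?_, ?_⟩
  · rw [conv_perm_natAdd, conv_perm_natAdd]; exact s.2.2 h1
  · rw [conv_perm_natAdd, conv_perm_natAdd]; exact s.2.2 h2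
  · rw [conv_perm_natAdd]
    simpa [conv, Shuffle.word, Shuffle.snd] using h3
  · ext x : 1
    induction x using Fin.addCases with
    | right x =>
      rw [conv_perm_natAdd, h4]
      have : Equiv.swap (Fin.natAdd n i) (Fin.natAdd n i') (Fin.natAdd n x) =
          Fin.natAdd n (Equiv.swap i i' x) :=
        ((Fin.natAdd_injective n' n).swap_apply i i' x)
      rw [Equiv.trans_apply, Equiv.trans_apply, this, conv_perm_natAdd]
    | left x =>
      rw [Equiv.trans_apply, Equiv.swap_apply_of_ne_of_ne, conv_perm_castAdd,
        conv_perm_castAdd] <;>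
      · intro h
        have := congrArg Fin.val h
        simp at this
        omega

theorem congruent_map {n m : ℕ} (f : SignedPerm n → SignedPerm m)
    (hf : ∀ {τ τ'}, CambrianStep τ τ' → CambrianStep (f τ) (f τ')) {τ τ' : SignedPerm n}
    (h : CambrianCongruent τ τ') : CambrianCongruent (f τ) (f τ') := by
  induction h with
  | rel _ _ h => exact .rel _ _ (hf h)
  | refl _ => exact .refl _
  | symm _ _ _ ih => exact .symm _ _ ih
  | trans _ _ _ _ _ ih1 ih2 => exact .trans _ _ _ ih1 ih2

theorem mul_mem_relations_left {x : FQSymDual R} (hx : x ∈ cambrianRelations R)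
    (y : FQSymDual R) : FQSymDual.mul R x y ∈ cambrianRelations R := by
  have hy : y ∈ Submodule.span R (Set.range (FQSymDual.basis R)) := by
    rw [(FQSymDual.basis R).span_eq]; trivial
  induction hy using Submodule.span_induction with
  | zero => simp
  | add a b _ _ ha hb => rw [map_add]; exact add_mem ha hb
  | smul c a _ ha => rw [map_smul]; exact Submodule.smul_mem _ _ ha
  | mem b hb =>
    obtain ⟨⟨n', τ'⟩, rfl⟩ := hb
    induction hx using Submodule.span_induction with
    | zero => simp
    | add a b _ _ ha hb => rw [map_add, LinearMap.add_apply]; exact add_mem ha hb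
    | smul c a _ ha => rw [map_smul, LinearMap.smul_apply]; exact Submodule.smul_mem _ _ ha
    | mem a ha =>
      obtain ⟨n, τ, τ₁, h, rfl⟩ := ha
      rw [map_sub, LinearMap.sub_apply]
      change G R τ * G R τ' - G R τ₁ * G R τ' ∈ _
      rw [G_mul_G, G_mul_G, ← Finset.sum_sub_distrib]
      exact sum_mem fun s _ => Submodule.subset_span
        ⟨_, _, _, congruent_map (fun τ => conv s τ τ') (conv_step_left s τ') h, rfl⟩

theorem mul_mem_relations_right (x : FQSymDual R) {y : FQSymDual R}
    (hy : y ∈ cambrianRelations R) : FQSymDual.mul R x y ∈ cambrianRelations R := by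
  have hx : x ∈ Submodule.span R (Set.range (FQSymDual.basis R)) := by
    rw [(FQSymDual.basis R).span_eq]; trivial
  induction hx using Submodule.span_induction with
  | zero => simp
  | add a b _ _ ha hb => rw [map_add, LinearMap.add_apply]; exact add_mem ha hb
  | smul c a _ ha => rw [map_smul, LinearMap.smul_apply]; exact Submodule.smul_mem _ _ ha
  | mem b hb =>
    obtain ⟨⟨n', τ'⟩, rfl⟩ := hb
    induction hy using Submodule.span_induction with
    | zero => simp
    | add a b _ _ ha hb => rw [map_add]; exact add_mem ha hb
    | smul c a _ ha => rw [map_smul]; exact Submodule.smul_mem _ _ ha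
    | mem a ha =>
      obtain ⟨n, τ, τ₁, h, rfl⟩ := ha
      rw [map_sub]
      change G R τ' * G R τ - G R τ' * G R τ₁ ∈ _
      rw [G_mul_G, G_mul_G, ← Finset.sum_sub_distrib]
      exact sum_mem fun s _ => Submodule.subset_span
        ⟨_, _, _, congruent_map (fun τ => conv s τ' τ) (conv_step_right s τ') h, rfl⟩

/-- The dual Cambrian algebra: the quotient of `FQSymDual R` by the relations `G τ = G τ'` for
`τ`, `τ'` Cambrian congruent. -/
def CambDual : Type _ := FQSymDual R ⧸ cambrianRelations R

noncomputable instance : AddCommGroup (CambDual R) :=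
  inferInstanceAs (AddCommGroup (FQSymDual R ⧸ cambrianRelations R))

noncomputable instance : Module R (CambDual R) :=
  inferInstanceAs (Module R (FQSymDual R ⧸ cambrianRelations R))

/-- The canonical projection. -/
noncomputable def proj : FQSymDual R →ₗ[R] CambDual R := (cambrianRelations R).mkQ

theorem proj_eq_zero {x : FQSymDual R} (hx : x ∈ cambrianRelations R) : proj R x = 0 :=
  (Submodule.Quotient.mk_eq_zero _).2 hx

/-- The product of the quotient, induced by that of `FQSymDual R`. -/
noncomputable def CambDual.mul : CambDual R →ₗ[R] CambDual R →ₗ[R] CambDual R :=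
  ((cambrianRelations R).liftQ
    ((cambrianRelations R).liftQ ((FQSymDual.mul R).compr₂ (proj R))
      (fun _ hx => LinearMap.ext fun y =>
        proj_eq_zero R (mul_mem_relations_left R hx y)) :
      CambDual R →ₗ[R] FQSymDual R →ₗ[R] CambDual R).flip
    (fun y hy => LinearMap.ext fun x => by
      obtain ⟨x, rfl⟩ := Submodule.mkQ_surjective (cambrianRelations R) x
      exact proj_eq_zero R (mul_mem_relations_right R x hy)) :
    CambDual R →ₗ[R] CambDual R →ₗ[R] CambDual R).flip

noncomputable instance : Mul (CambDual R) := ⟨fun x y => CambDual.mul R x y⟩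

theorem proj_mul (x y : FQSymDual R) : proj R (x * y) = proj R x * proj R y := rfl

/-! ### Cambrian trees

Edges are oriented bottom-up and include the leaves (the half-edges at the bottom and at the
top). An arc goes from an out-port (the place where it leaves its source upwards) to an in-port
(the place where it enters its target from below). Vertices are identified with their labels. -/

/-- Places where an arc can start: the down leaf number `i` (numbered from left to right), the
unique upper side of a negative vertex, the upper left and the upper right side of a positive
vertex. -/
inductive OutPort (n : ℕ)
  | leaf (i : ℕ)
  | mid (v : Fin n)
  | left (v : Fin n)
  | right (v : Fin n)

/-- Places where an arc can end: the up leaf number `i` (numbered from left to right), the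
unique lower side of a positive vertex, the lower left and the lower right side of a negative
vertex. -/
inductive InPort (n : ℕ)
  | leaf (i : ℕ)
  | mid (v : Fin n)
  | left (v : Fin n)
  | right (v : Fin n)

/-- Nodes: vertices, down leaves and up leaves. -/
inductive Node (n : ℕ)
  | vertex (v : Fin n)
  | downLeaf (i : ℕ)
  | upLeaf (i : ℕ)

/-- The node of an out-port. -/
def OutPort.node {n : ℕ} : OutPort n → Node n
  | .leaf i => .downLeaf i
  | .mid v | .left v | .right v => .vertex v

/-- The node of an in-port. -/
def InPort.node {n : ℕ} : InPort n → Node n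
  | .leaf i => .upLeaf i
  | .mid v | .left v | .right v => .vertex v

/-- Relabelling of the vertices. -/
def OutPort.map {n m : ℕ} (f : Fin n → Fin m) : OutPort n → OutPort m
  | .leaf i => .leaf i
  | .mid v => .mid (f v)
  | .left v => .left (f v)
  | .right v => .right (f v)

/-- Relabelling of the vertices. -/
def InPort.map {n m : ℕ} (f : Fin n → Fin m) : InPort n → InPort m
  | .leaf i => .leaf i
  | .mid v => .mid (f v)
  | .left v => .left (f v)
  | .right v => .right (f v)

/-- The data of a signature and of arcs between ports; no condition is imposed yet. -/
structure PreTree (n : ℕ) where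
  sign : Fin n → Sgn
  arc : OutPort n → InPort n → Prop

namespace PreTree

variable {n : ℕ} (T : PreTree n)

/-- The number of labels of sign `ε` to the left of the gap `g`. The gap `g` (for `0 ≤ g ≤ n`)
has exactly `g` labels on its left, and the labels are `0, …, n - 1`. -/
noncomputable def countBefore (ε : Sgn) (g : ℕ) : ℕ :=
  (Finset.univ.filter fun w : Fin n => (w : ℕ) < g ∧ T.sign w = ε).card

/-- The out-ports that exist for the given signature: there is one down leaf in each of the
intervals between consecutive negative labels. -/
def IsOutPort : OutPort n → Prop
  | .leaf i => i ≤ T.countBefore Sgn.minus n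
  | .mid v => T.sign v = Sgn.minus
  | .left v | .right v => T.sign v = Sgn.plus

/-- The in-ports that exist for the given signature: there is one up leaf in each of the
intervals between consecutive positive labels. -/
def IsInPort : InPort n → Prop
  | .leaf i => i ≤ T.countBefore Sgn.plus n
  | .mid v => T.sign v = Sgn.plus
  | .left v | .right v => T.sign v = Sgn.minus

/-- `T.Arc x y`: there is an arc from the node `x` to the node `y`. -/
def Arc (x y : Node n) : Prop := ∃ o t, T.arc o t ∧ o.node = x ∧ t.node = y

/-- The underlying undirected graph, leaves included. -/
def graph : SimpleGraph (Node n) := SimpleGraph.fromRel T.Arc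

/-- `x` and `y` are connected after deletion of the vertex `v`. -/
def ConnectedAvoiding (v : Fin n) (x y : Node n) : Prop :=
  ∃ p : T.graph.Walk x y, Node.vertex v ∉ p.support

/-- `x` is in the left subtree of `v`: its left descendant subtree if `v` is negative, its left
ancestor subtree if `v` is positive. -/
def InLeftSubtree (v : Fin n) (x : Node n) : Prop :=
  (T.sign v = Sgn.minus ∧ ∃ o, T.arc o (.left v) ∧ T.ConnectedAvoiding v o.node x) ∨
  (T.sign v = Sgn.plus ∧ ∃ t, T.arc (.left v) t ∧ T.ConnectedAvoiding v t.node x)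

/-- `x` is in the right subtree of `v`. -/
def InRightSubtree (v : Fin n) (x : Node n) : Prop :=
  (T.sign v = Sgn.minus ∧ ∃ o, T.arc o (.right v) ∧ T.ConnectedAvoiding v o.node x) ∨
  (T.sign v = Sgn.plus ∧ ∃ t, T.arc (.right v) t ∧ T.ConnectedAvoiding v t.node x)

/-- The label of a vertex is smaller than `v`; a leaf lies in an interval (between consecutive
negative labels for down leaves, positive labels for up leaves) that starts left of `v`. -/
def IsLeftOf (v : Fin n) : Node n → Prop
  | .vertex w => w < v
  | .downLeaf i => i ≤ T.countBefore Sgn.minus v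
  | .upLeaf i => i ≤ T.countBefore Sgn.plus v

/-- The label of a vertex is larger than `v`; a leaf lies in an interval (between consecutive
negative labels for down leaves, positive labels for up leaves) that ends right of `v`. -/
def IsRightOf (v : Fin n) : Node n → Prop
  | .vertex w => v < w
  | .downLeaf i => T.countBefore Sgn.minus (v + 1) ≤ i
  | .upLeaf i => T.countBefore Sgn.plus (v + 1) ≤ i

/-- The data form a Cambrian tree. -/
structure IsCambrian : Prop where
  /-- Each negative vertex has one parent and two children, each positive vertex one child and
  two parents (leaves included): arcs join existing ports, and each port is used exactly once. -/
  isOutPort : ∀ o t, T.arc o t → T.IsOutPort o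
  isInPort : ∀ o t, T.arc o t → T.IsInPort t
  out_unique : ∀ o, T.IsOutPort o → ∃! t, T.arc o t
  in_unique : ∀ t, T.IsInPort t → ∃! o, T.arc o t
  /-- The arcs form a directed tree. -/
  oriented : ∀ x y, T.Arc x y → ¬ T.Arc y x
  acyclic : T.graph.IsAcyclic
  connected : ∀ o t o' t', T.arc o t → T.arc o' t' → T.graph.Reachable o.node o'.node
  /-- Labels are smaller in left subtrees and larger in right subtrees. -/
  left_lt : ∀ v x, T.InLeftSubtree v x → T.IsLeftOf v x
  right_gt : ∀ v x, T.InRightSubtree v x → T.IsRightOf v x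

/-- `τ` is a linear extension of the tree: it has the same signature (by values), and the source
of each arc between vertices appears before its target. -/
def IsLinearExtension (τ : SignedPerm n) : Prop :=
  τ.sign = T.sign ∧
    ∀ v w, T.Arc (.vertex v) (.vertex w) → τ.perm.symm v < τ.perm.symm w

end PreTree

/-- A Cambrian tree with `n` vertices, labelled by `Fin n`. -/
structure CambrianTree (n : ℕ) extends PreTree n where
  isCambrian : toPreTree.IsCambrian

theorem PreTree.IsCambrian.arc_acyclic {n : ℕ} {T : PreTree n} (hT : T.IsCambrian)
    {x y : Node n} (hxy : T.Arc x y) : ¬ Relation.ReflTransGen T.Arc y x := by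
  intro h
  have hne : ∀ {a b}, T.Arc a b → a ≠ b := fun {a b} hab e => by
    subst e; exact hT.oriented _ _ hab hab
  have hadj : T.graph.Adj x y := (SimpleGraph.fromRel_adj ..).2 ⟨hne hxy, Or.inl hxy⟩
  have hb := SimpleGraph.isAcyclic_iff_forall_adj_isBridge.1 hT.acyclic hadj
  rw [SimpleGraph.isBridge_iff] at hb
  refine hb ?_
  suffices ∀ z, Relation.ReflTransGen T.Arc y z →
      (T.graph \ SimpleGraph.fromEdgeSet {s(x, y)}).Reachable y z from (this x h).symm
  intro z hz
  induction hz with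
  | refl => exact .refl _
  | @tail a b _ hab ih =>
    by_cases hby : b = y
    · subst hby; exact .refl _
    · refine ih.trans (SimpleGraph.Adj.reachable ?_)
      rw [SimpleGraph.sdiff_adj, SimpleGraph.fromEdgeSet_adj]
      refine ⟨(SimpleGraph.fromRel_adj ..).2 ⟨hne hab, Or.inl hab⟩, ?_⟩
      rintro ⟨he, -⟩
      rcases Sym2.eq_iff.1 he with ⟨-, h2⟩ | ⟨h1, h2⟩
      · exact hby h2
      · subst h1; subst h2; exact hT.oriented _ _ hxy hab

theorem exists_equiv_fin {α : Type} [Fintype α] (n : ℕ) (hn : Fintype.card α = n)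
    (r : α → α → Prop) (hr : ∀ a b, r a b → ¬ Relation.ReflTransGen r b a) :
    ∃ e : α ≃ Fin n, ∀ a b, r a b → e a < e b := by
  let P : PartialOrder α :=
    { le := Relation.ReflTransGen r
      le_refl := fun _ => .refl
      le_trans := fun _ _ _ => .trans
      le_antisymm := fun a b hab hba => by
        rcases Relation.ReflTransGen.cases_head hab with h | ⟨c, hac, hcb⟩
        · exact h
        · exact absurd (hcb.trans hba) (hr _ _ hac) }
  let _ : Fintype (LinearExtension α) := inferInstanceAs (Fintype α)
  let e : Fin n ≃o LinearExtension α := Fintype.orderIsoFinOfCardEq (LinearExtension α) hn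
  refine ⟨(e.symm.toEquiv : α ≃ Fin n), fun a b hab => ?_⟩
  have h1 : toLinearExtension a ≤ toLinearExtension b :=
    toLinearExtension.monotone (show Relation.ReflTransGen r a b from .single hab)
  have h2 : a ≠ b := fun h => by subst h; exact hr _ _ hab .refl
  exact e.symm.strictMono (lt_of_le_of_ne h1 h2)

theorem CambrianTree.exists_isLinearExtension {n : ℕ} (T : CambrianTree n) :
    ∃ τ : SignedPerm n, T.IsLinearExtension τ := by
  obtain ⟨e, he⟩ := exists_equiv_fin n (Fintype.card_fin n)
    (fun v w : Fin n => T.Arc (.vertex v) (.vertex w)) (fun a b hab h =>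
      T.isCambrian.arc_acyclic hab (h.lift Node.vertex (fun _ _ h => h)))
  exact ⟨⟨e.symm, T.sign⟩, rfl, fun v w h => he v w h⟩

/-- The element `Q_T` of the dual Cambrian algebra: the class of `G τ`, where `τ` is a linear
extension of `T`. -/
noncomputable def Q {n : ℕ} (T : CambrianTree n) : CambDual R :=
  proj R (G R T.exists_isLinearExtension.choose)

/-! ### Cutting a Cambrian tree along a lamination -/

namespace PreTree

variable {n : ℕ} (T : PreTree n)

/-- The arc starting at `o` ends at the vertex at which `o'` is located. -/
def Next (o o' : OutPort n) : Prop := ∃ t v, T.arc o t ∧ t.node = .vertex v ∧ o'.node = .vertex v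

/-- The arc starting at `o` belongs to the path of the gap `g`: the directed path from the down
leaf in the same interval of consecutive negative labels as `g` to the up leaf in the same
interval of consecutive positive labels as `g`. -/
def OnPath (g : ℕ) (o : OutPort n) : Prop :=
  Relation.ReflTransGen T.Next (.leaf (T.countBefore Sgn.minus g)) o ∧
  ∃ o', Relation.ReflTransGen T.Next o o' ∧ T.arc o' (.leaf (T.countBefore Sgn.plus g))

/-- The number of paths of the lamination defined by the multiset `Γ` of gaps that contain the
arc starting at `o`. -/
noncomputable def multOut (Γ : Multiset ℕ) (o : OutPort n) : ℕ := Γ.countP fun g => T.OnPath g o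

/-- The number of paths of the lamination that contain the arc ending at `t`. -/
noncomputable def multIn (Γ : Multiset ℕ) (t : InPort n) : ℕ :=
  Γ.countP fun g => ∃ o, T.arc o t ∧ T.OnPath g o

/-! Cutting along the lamination splits an arc contained in `m` paths into `m + 1` parallel
strands, numbered from left to right by `0, …, m`. The strand `k` of the arc starting at `o` is
encoded by the pair `(o, k)`. -/

/-- `T.Pass Γ a b`: moving upwards, the strand `a` passes along a vertex, to which it is not
attached after the cut, and continues as the strand `b`. At a negative vertex `v`, the paths
coming from the left (resp. right) child pass to the left (resp. right) of `v`, so that only the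
rightmost strand on the left, the leftmost strand on the right, and the strand between these
groups on the upper side remain attached to `v`. Positive vertices are treated symmetrically. -/
inductive Pass (Γ : Multiset ℕ) : OutPort n × ℕ → OutPort n × ℕ → Prop
  | fromLeft {o : OutPort n} {v : Fin n} {k : ℕ} : T.arc o (.left v) →
      k < T.multIn Γ (.left v) → Pass Γ (o, k) (.mid v, k)
  | fromRight {o : OutPort n} {v : Fin n} {k : ℕ} : T.arc o (.right v) →
      0 < k → k ≤ T.multIn Γ (.right v) →
      Pass Γ (o, k) (.mid v, T.multIn Γ (.left v) + k)
  | toLeft {o : OutPort n} {v : Fin n} {k : ℕ} : T.arc o (.mid v) →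
      k < T.multOut Γ (.left v) → Pass Γ (o, k) (.left v, k)
  | toRight {o : OutPort n} {v : Fin n} {k : ℕ} : T.arc o (.mid v) →
      0 < k → k ≤ T.multOut Γ (.right v) →
      Pass Γ (o, T.multOut Γ (.left v) + k) (.right v, k)

/-- The strand leaving a vertex upwards after the cut, and the strands starting at the down
leaves of the cut forest, which are numbered from left to right. -/
inductive Starts (Γ : Multiset ℕ) : OutPort n → OutPort n × ℕ → Prop
  | leaf {i k : ℕ} : k ≤ T.multOut Γ (.leaf i) →
      Starts Γ (.leaf ((∑ i' ∈ Finset.range i, (T.multOut Γ (.leaf i') + 1)) + k)) (.leaf i, k)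
  | mid {v : Fin n} : Starts Γ (.mid v) (.mid v, T.multIn Γ (.left v))
  | left {v : Fin n} : Starts Γ (.left v) (.left v, T.multOut Γ (.left v))
  | right {v : Fin n} : Starts Γ (.right v) (.right v, 0)

/-- The strand arriving at a vertex from below after the cut, and the strands ending at the up
leaves of the cut forest, which are numbered from left to right. -/
inductive Ends (Γ : Multiset ℕ) : OutPort n × ℕ → InPort n → Prop
  | leaf {o : OutPort n} {i k : ℕ} : T.arc o (.leaf i) → k ≤ T.multIn Γ (.leaf i) →
      Ends Γ (o, k) (.leaf ((∑ i' ∈ Finset.range i, (T.multIn Γ (.leaf i') + 1)) + k))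
  | mid {o : OutPort n} {v : Fin n} : T.arc o (.mid v) →
      Ends Γ (o, T.multOut Γ (.left v)) (.mid v)
  | left {o : OutPort n} {v : Fin n} : T.arc o (.left v) →
      Ends Γ (o, T.multIn Γ (.left v)) (.left v)
  | right {o : OutPort n} {v : Fin n} : T.arc o (.right v) → Ends Γ (o, 0) (.right v)

/-- The forest obtained from `T` by cutting along the lamination defined by `Γ`: its arcs are
the maximal upward sequences of strands. -/
def cut (Γ : Multiset ℕ) : PreTree n where
  sign := T.sign
  arc o t := ∃ a b, T.Starts Γ o a ∧ Relation.ReflTransGen (T.Pass Γ) a b ∧ T.Ends Γ b t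

end PreTree

/-- The gaps of the first word given by the positions in `s` of the letters of the second word
that are equal to `-`. -/
noncomputable def lowerGaps {n n' : ℕ} (s : Shuffle n n') (ε' : Fin n' → Sgn) : Multiset ℕ :=
  (Finset.univ.filter fun j : Fin n' => ε' j = Sgn.minus).val.map fun j =>
    (Finset.univ.filter fun i : Fin n => s.fst i < s.snd j).card

/-- The gaps of the second word given by the positions in `s` of the letters of the first word
that are equal to `+`. -/
noncomputable def upperGaps {n n' : ℕ} (s : Shuffle n n') (ε : Fin n → Sgn) : Multiset ℕ :=
  (Finset.univ.filter fun i : Fin n => ε i = Sgn.plus).val.map fun i =>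
    (Finset.univ.filter fun j : Fin n' => s.snd j < s.fst i).card

/-- The arcs obtained from a lower forest `F` and an upper forest `F'` by connecting the `j`-th
up leaf of `F` with the `j`-th down leaf of `F'`, the labels being shuffled by `s`. -/
inductive ConnectArc {n n' : ℕ} (s : Shuffle n n') (F : PreTree n) (F' : PreTree n') :
    OutPort (n + n') → InPort (n + n') → Prop
  | lower {o : OutPort n} {t : InPort n} : F.arc o t → (∀ j, t ≠ .leaf j) →
      ConnectArc s F F' (o.map s.fst) (t.map s.fst)
  | across {o : OutPort n} {j : ℕ} {t : InPort n'} : F.arc o (.leaf j) → F'.arc (.leaf j) t →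
      ConnectArc s F F' (o.map s.fst) (t.map s.snd)
  | upper {o : OutPort n'} {t : InPort n'} : F'.arc o t → (∀ j, o ≠ .leaf j) →
      ConnectArc s F F' (o.map s.snd) (t.map s.snd)

/-- The tree `T ₛ\ T'`. -/
noncomputable def glue {n n' : ℕ} (s : Shuffle n n') (T : PreTree n) (T' : PreTree n') :
    PreTree (n + n') where
  sign := s.word T.sign T'.sign
  arc := ConnectArc s (T.cut (lowerGaps s T'.sign)) (T'.cut (upperGaps s T.sign))

end Cambrian

open Cambrian

/-! Insert the letters of a signed permutation `τ` one by one, by increasing position. At every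
level the gaps of `[n]` are separated by walls: one below each negative letter still to come, one
above each positive letter already inserted. The classes of gaps with no wall between them are the
strands crossing this level. Inserting a negative letter removes its wall and merges two strands;
inserting a positive letter erects its wall and splits a strand in two. The diagram traced in this
way is `τ.tree`.

The diagram is a Cambrian tree (`tree_isCambrian`): cutting one strand divides the nodes into two
explicit sets joined by no other arc, which yields both acyclicity and the order of labels.
Conversely, a Cambrian tree with linear extension `τ` is equal to `τ.tree` (`eq_tree`), by induction
on levels: a wrong arc would cross a wall, while following `T` along a wall never leaves one subtree
of the letter of that wall. Any two linear extensions of a tree are congruent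
(`PreTree.IsCambrian.congruent`): sorting one into the other exchanges consecutive letters not
joined by an arc, and such letters are separated by a wall, whose letter is exactly the `b` of a
Cambrian rewriting. Hence `Q` does not depend on the linear extension.

Finally, gluing trees is convolving permutations (`glue_tree`). While the letters of `τ` are
inserted in `conv s τ τ'`, the walls are those of `τ` and those of all the negative letters of `τ'`;
afterwards they are those of `τ'` and those of all the positive letters of `τ`. The additional walls
sit at the gaps of the two laminations. Since the vertical path of a gap consists of the strands
containing this gap (`onPath_iff`), cutting along the lamination has the same effect as the
additional walls (`exists_starts`). The product formula is then the projection of `G_mul_G`, both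
sums being indexed by the same shuffles. -/

namespace Cambrian

/-! ### Counting letters of a given sign -/

/-- The number of letters of sign `ε` to the left of the gap `g`. -/
noncomputable def letterCount {n : ℕ} (sign : Fin n → Sgn) (ε : Sgn) (g : ℕ) : ℕ :=
  (Finset.univ.filter fun w : Fin n => (w : ℕ) < g ∧ sign w = ε).card

section letterCount

variable {n : ℕ} {sign : Fin n → Sgn} {ε : Sgn}

theorem letterCount_mono {a b : ℕ} (h : a ≤ b) :
    letterCount sign ε a ≤ letterCount sign ε b :=
  Finset.card_le_card fun w hw => by
    simp only [Finset.mem_filter, Finset.mem_univ, true_and] at hw ⊢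
    exact ⟨hw.1.trans_le h, hw.2⟩

theorem letterCount_lt {a b : ℕ} {w : Fin n} (hw : sign w = ε) (ha : a ≤ w) (hb : (w : ℕ) < b) :
    letterCount sign ε a < letterCount sign ε b := by
  refine Finset.card_lt_card ⟨fun u hu => ?_, fun h => ?_⟩
  · simp only [Finset.mem_filter, Finset.mem_univ, true_and] at hu ⊢
    exact ⟨by omega, hu.2⟩
  · have := @h w (by simp [hw, hb])
    simp only [Finset.mem_filter, Finset.mem_univ, true_and] at this
    omega

theorem letterCount_congr {a b : ℕ}
    (h : ∀ w : Fin n, sign w = ε → ((w : ℕ) < a ↔ (w : ℕ) < b)) :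
    letterCount sign ε a = letterCount sign ε b := by
  unfold letterCount
  congr 1
  ext w
  simp only [Finset.mem_filter, Finset.mem_univ, true_and]
  constructor
  · rintro ⟨h1, h2⟩; exact ⟨(h w h2).1 h1, h2⟩
  · rintro ⟨h1, h2⟩; exact ⟨(h w h2).2 h1, h2⟩

/-- A letter of sign `ε` is counted as soon as the gap has passed it, so leaf numbers, which are
such counts, determine the position of the gap relative to these letters. -/
theorem lt_iff_letterCount_lt {w : Fin n} (hw : sign w = ε) (g : ℕ) :
    (w : ℕ) < g ↔ letterCount sign ε w < letterCount sign ε g := by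
  constructor
  · intro h; exact letterCount_lt hw le_rfl h
  · intro h
    by_contra hc
    exact absurd (letterCount_mono (sign := sign) (ε := ε) (not_lt.1 hc)) (not_le.2 h)

theorem letterCount_eq_iff {a b : ℕ} :
    letterCount sign ε a = letterCount sign ε b ↔
      ∀ w : Fin n, sign w = ε → ((w : ℕ) < a ↔ (w : ℕ) < b) := by
  refine ⟨fun h w hw => ?_, letterCount_congr⟩
  rw [lt_iff_letterCount_lt hw, lt_iff_letterCount_lt hw, h]

theorem letterCount_succ_of_sign {v : Fin n} (hv : sign v = ε) :
    letterCount sign ε (v + 1) = letterCount sign ε v + 1 := by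
  unfold letterCount
  rw [← Finset.card_insert_of_notMem (a := v) (by simp)]
  congr 1
  ext w
  simp only [Finset.mem_filter, Finset.mem_univ, true_and, Finset.mem_insert, Fin.ext_iff]
  constructor
  · rintro ⟨h1, h2⟩
    by_cases h : (w : ℕ) = v
    · exact Or.inl h
    · exact Or.inr ⟨by omega, h2⟩
  · rintro (h | ⟨h1, h2⟩)
    · exact ⟨by omega, by rw [Fin.ext h]; exact hv⟩
    · exact ⟨by omega, h2⟩

theorem letterCount_succ_of_ne {v : Fin n} (hv : sign v ≠ ε) :
    letterCount sign ε (v + 1) = letterCount sign ε v := by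
  refine letterCount_congr fun w hw => ?_
  have : (w : ℕ) ≠ v := fun h => hv (by rw [← hw, Fin.ext h])
  omega

theorem letterCount_zero : letterCount sign ε 0 = 0 := by
  simp [letterCount]

theorem letterCount_le_total (g : ℕ) : letterCount sign ε g ≤ letterCount sign ε n := by
  rcases le_total g n with h | h
  · exact letterCount_mono h
  · refine (letterCount_congr fun w _ => ?_).le
    have := w.2
    omega

/-- Discrete intermediate values: the count grows by at most one from a gap to the next. Hence every
leaf number comes from some gap. -/
theorem exists_letterCount_eq {i : ℕ} (hi : i ≤ letterCount sign ε n) :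
    ∃ g ≤ n, letterCount sign ε g = i := by
  suffices ∀ m ≤ n, i ≤ letterCount sign ε m → ∃ g ≤ n, letterCount sign ε g = i from
    this n le_rfl hi
  intro m
  induction m with
  | zero => intro _ h; exact ⟨0, Nat.zero_le _, by rw [letterCount_zero] at h ⊢; omega⟩
  | succ m ih =>
    intro hm h
    by_cases hs : sign ⟨m, hm⟩ = ε
    · have := letterCount_succ_of_sign hs
      simp only at this
      rcases h.lt_or_eq with h | h
      · exact ih (by omega) (by omega)
      · exact ⟨m + 1, hm, h.symm⟩
    · have := letterCount_succ_of_ne hs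
      simp only at this
      exact ih (by omega) (by omega)

end letterCount

/-! ### The sweep of a signed permutation -/

theorem Sgn.eq_minus_or_plus (ε : Sgn) : ε = .minus ∨ ε = .plus := by cases ε <;> simp

/-- The upper side, for the gap `g`, of a vertex `v` of sign `ε`. -/
def upperSide {n : ℕ} (ε : Sgn) (v : Fin n) (g : ℕ) : OutPort n :=
  match ε with
  | .minus => .mid v
  | .plus => if g ≤ v then .left v else .right v

/-- The lower side, for the gap `g`, of a vertex `v` of sign `ε`. -/
def lowerSide {n : ℕ} (ε : Sgn) (v : Fin n) (g : ℕ) : InPort n :=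
  match ε with
  | .minus => if g ≤ v then .left v else .right v
  | .plus => .mid v

theorem upperSide_node {n : ℕ} (ε : Sgn) (v : Fin n) (g : ℕ) :
    (upperSide ε v g).node = .vertex v := by
  unfold upperSide
  cases ε <;> simp only <;> (try split_ifs) <;> rfl

theorem lowerSide_node {n : ℕ} (ε : Sgn) (v : Fin n) (g : ℕ) :
    (lowerSide ε v g).node = .vertex v := by
  unfold lowerSide
  cases ε <;> simp only <;> (try split_ifs) <;> rfl

namespace SignedPerm

variable {n : ℕ} (τ : SignedPerm n)

/-- The position of the value `v`. -/
def pos (v : Fin n) : ℕ := τ.perm.symm v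

theorem pos_lt (v : Fin n) : τ.pos v < n := (τ.perm.symm v).2

theorem pos_perm (i : Fin n) : τ.pos (τ.perm i) = i := by simp [pos]

variable {τ} in
theorem pos_inj {v w : Fin n} : τ.pos v = τ.pos w ↔ v = w := by
  rw [pos, pos, ← Fin.ext_iff, τ.perm.symm.injective.eq_iff]

theorem exists_pos_eq {k : ℕ} (hk : k < n) : ∃ v, τ.pos v = k :=
  ⟨τ.perm ⟨k, hk⟩, τ.pos_perm _⟩

/-- Between the insertions of the letters at positions less than `k` and the others, there is a
wall above each positive letter already inserted and below each negative letter still to be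
inserted. -/
def Wall (k : ℕ) (w : Fin n) : Prop :=
  (τ.sign w = .minus ∧ k ≤ τ.pos w) ∨ (τ.sign w = .plus ∧ τ.pos w < k)

/-- At level `k`, no wall separates the gaps `a` and `b`. -/
def Same (k a b : ℕ) : Prop := ∀ w, τ.Wall k w → ((w : ℕ) < a ↔ (w : ℕ) < b)

/-- When `v` is inserted, no wall separates `v` and the gap `g`. -/
def Touch (v : Fin n) (g : ℕ) : Prop :=
  ∀ w, w ≠ v → τ.Wall (τ.pos v) w → ((w : ℕ) < g ↔ w < v)

/-- The port where the strand containing the gap `g` starts, when a gap is attached to the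
vertices satisfying the predicate `P`. -/
noncomputable def sweep (P : Fin n → Prop) (start : OutPort n) (g : ℕ) : ℕ → OutPort n
  | 0 => start
  | k + 1 =>
    if h : k < n then
      if P (τ.perm ⟨k, h⟩) then upperSide (τ.sign (τ.perm ⟨k, h⟩)) (τ.perm ⟨k, h⟩) g
      else sweep P start g k
    else sweep P start g k

theorem sweep_pos_succ (P : Fin n → Prop) (start : OutPort n) (g : ℕ) (v : Fin n) :
    τ.sweep P start g (τ.pos v + 1) =
      if P v then upperSide (τ.sign v) v g else τ.sweep P start g (τ.pos v) := by
  have : (⟨τ.pos v, τ.pos_lt v⟩ : Fin n) = τ.perm.symm v := rfl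
  rw [sweep, dif_pos (τ.pos_lt v)]
  simp [this]

/-- The port where the strand containing the gap `g` at level `k` starts. -/
noncomputable def strand (k g : ℕ) : OutPort n :=
  τ.sweep (fun v => τ.Touch v g) (.leaf (letterCount τ.sign .minus g)) g k

theorem strand_zero (g : ℕ) : τ.strand 0 g = .leaf (letterCount τ.sign .minus g) := rfl

variable {τ}

theorem strand_succ_of_touch {v : Fin n} {g : ℕ} (h : τ.Touch v g) :
    τ.strand (τ.pos v + 1) g = upperSide (τ.sign v) v g := by
  rw [strand, sweep_pos_succ, if_pos h]

theorem strand_succ_of_not_touch {v : Fin n} {g : ℕ} (h : ¬ τ.Touch v g) :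
    τ.strand (τ.pos v + 1) g = τ.strand (τ.pos v) g := by
  rw [strand, sweep_pos_succ, if_neg h]; rfl

theorem Same.symm {k a b : ℕ} (h : τ.Same k a b) : τ.Same k b a := fun w hw => (h w hw).symm

theorem Same.refl (τ : SignedPerm n) (k a : ℕ) : τ.Same k a a := fun _ _ => Iff.rfl

/-- Two consecutive levels differ only by the letter inserted between them. -/
theorem wall_succ {v w : Fin n} (h : w ≠ v) : τ.Wall (τ.pos v + 1) w ↔ τ.Wall (τ.pos v) w := by
  have : τ.pos w ≠ τ.pos v := fun e => h (pos_inj.1 e)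
  unfold Wall
  constructor
  · rintro (⟨h1, h2⟩ | ⟨h1, h2⟩)
    · exact Or.inl ⟨h1, by omega⟩
    · exact Or.inr ⟨h1, by omega⟩
  · rintro (⟨h1, h2⟩ | ⟨h1, h2⟩)
    · exact Or.inl ⟨h1, by omega⟩
    · exact Or.inr ⟨h1, by omega⟩

theorem wall_self_iff {v : Fin n} : τ.Wall (τ.pos v) v ↔ τ.sign v = .minus := by
  simp [Wall]

theorem wall_succ_self_iff {v : Fin n} : τ.Wall (τ.pos v + 1) v ↔ τ.sign v = .plus := by
  simp [Wall]

theorem touch_self (v : Fin n) : τ.Touch v v := fun _ _ _ => Iff.rfl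

theorem touch_self_succ (v : Fin n) : τ.Touch v (v + 1) := fun w hw _ => by
  have : (w : ℕ) ≠ v := fun h => hw (Fin.ext h)
  rw [Fin.lt_def]; omega

theorem Touch.congr_of_same {v : Fin n} {a b : ℕ} (h : τ.Same (τ.pos v) a b)
    (ha : τ.Touch v a) : τ.Touch v b := fun w hw hw' => (h w hw').symm.trans (ha w hw hw')

theorem Touch.congr_of_same_succ {v : Fin n} {a b : ℕ} (h : τ.Same (τ.pos v + 1) a b)
    (ha : τ.Touch v a) : τ.Touch v b :=
  fun w hw hw' => (h w ((wall_succ hw).2 hw')).symm.trans (ha w hw hw')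

/-- Gaps separated by `v` and by no other wall touch `v`. -/
theorem touch_of_separated {v : Fin n} {a b : ℕ}
    (h : ∀ w, w ≠ v → τ.Wall (τ.pos v) w → ((w : ℕ) < a ↔ (w : ℕ) < b))
    (hv : ¬ ((v : ℕ) < a ↔ (v : ℕ) < b)) : τ.Touch v a := by
  intro w hw hw'
  have h1 := h w hw hw'
  have h2 : (w : ℕ) ≠ v := fun h => hw (Fin.ext h)
  rw [Fin.lt_def]
  omega

/-- Just before a negative letter is inserted, its own wall is the only one that can separate the
gaps touching it: they form its two children. The next lemma removes this wall and merges them into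
the parent; positive letters behave in the opposite order. -/
theorem same_of_touch_minus {v : Fin n} {a b : ℕ} (hv : τ.sign v = .minus)
    (ha : τ.Touch v a) (hb : τ.Touch v b) : τ.Same (τ.pos v) a b ↔ (a ≤ v ↔ b ≤ v) := by
  constructor
  · intro h
    have := h v (wall_self_iff.2 hv)
    omega
  · intro h w hw
    by_cases e : w = v
    · subst e; omega
    · rw [ha w e hw, hb w e hw]

theorem same_succ_of_touch_minus {v : Fin n} {a b : ℕ} (hv : τ.sign v = .minus)
    (ha : τ.Touch v a) (hb : τ.Touch v b) : τ.Same (τ.pos v + 1) a b := by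
  intro w hw
  have e : w ≠ v := by
    rintro rfl
    rw [wall_succ_self_iff, hv] at hw
    cases hw
  rw [wall_succ e] at hw
  rw [ha w e hw, hb w e hw]

theorem same_of_touch_plus {v : Fin n} {a b : ℕ} (hv : τ.sign v = .plus)
    (ha : τ.Touch v a) (hb : τ.Touch v b) : τ.Same (τ.pos v) a b := by
  intro w hw
  have e : w ≠ v := by
    rintro rfl
    rw [wall_self_iff, hv] at hw
    cases hw
  rw [ha w e hw, hb w e hw]

theorem same_succ_of_touch_plus {v : Fin n} {a b : ℕ} (hv : τ.sign v = .plus)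
    (ha : τ.Touch v a) (hb : τ.Touch v b) : τ.Same (τ.pos v + 1) a b ↔ (a ≤ v ↔ b ≤ v) := by
  constructor
  · intro h
    have := h v (wall_succ_self_iff.2 hv)
    omega
  · intro h w hw
    by_cases e : w = v
    · subst e; omega
    · rw [wall_succ e] at hw
      rw [ha w e hw, hb w e hw]

/-- Away from the vertex inserted at level `k`, the strands at levels `k` and `k + 1` agree. -/
theorem same_succ_iff_of_not_touch {v : Fin n} {a b : ℕ} (ha : ¬ τ.Touch v a)
    (hb : ¬ τ.Touch v b) : τ.Same (τ.pos v + 1) a b ↔ τ.Same (τ.pos v) a b := by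
  constructor
  · intro h w hw
    by_cases e : w = v
    · subst e
      by_contra hc
      -- If `v` alone separated the two gaps, both would be next to it and would touch it.
      exact ha (touch_of_separated (fun u hu hu' => h u ((wall_succ hu).2 hu')) hc)
    · exact h w ((wall_succ e).2 hw)
  · intro h w hw
    by_cases e : w = v
    · subst e
      by_contra hc
      exact ha (touch_of_separated (fun u hu hu' => h u hu') hc)
    · exact h w ((wall_succ e).1 hw)

theorem upperSide_eq_iff {v : Fin n} {ε : Sgn} {a b : ℕ} :
    upperSide ε v a = upperSide ε v b ↔ (ε = .plus → (a ≤ v ↔ b ≤ v)) := by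
  unfold upperSide
  cases ε
  · simp
  · simp only
    split_ifs <;> simp_all; omega

/-! ### Birth of ports and identification of strands -/

variable (τ) in
/-- The level at which an out-port appears. -/
def born : OutPort n → ℕ
  | .leaf _ => 0
  | .mid v | .left v | .right v => τ.pos v + 1

theorem born_upperSide (ε : Sgn) (v : Fin n) (g : ℕ) :
    τ.born (upperSide ε v g) = τ.pos v + 1 := by
  unfold upperSide
  cases ε <;> simp only <;> (try split_ifs) <;> rfl

theorem born_of_node {o : OutPort n} {v : Fin n} (h : o.node = .vertex v) :
    τ.born o = τ.pos v + 1 := by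
  cases o <;> simp_all [OutPort.node, born]

theorem born_strand_le {k : ℕ} (hk : k ≤ n) (g : ℕ) : τ.born (τ.strand k g) ≤ k := by
  induction k with
  | zero => rfl
  | succ k ih =>
    obtain ⟨v, rfl⟩ := τ.exists_pos_eq hk
    by_cases h : τ.Touch v g
    · rw [strand_succ_of_touch h, born_upperSide]
    · rw [strand_succ_of_not_touch h]
      exact (ih (by omega)).trans (Nat.le_succ _)

/-- Attaching a vertex always produces a port born just then, so a port already born at level `k`
witnesses that the gap met no vertex between `k` and `l`. -/
theorem strand_eq_of_born_le {k l g : ℕ} (hkl : k ≤ l) (hl : l ≤ n)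
    (h : τ.born (τ.strand l g) ≤ k) : τ.strand l g = τ.strand k g := by
  induction l, hkl using Nat.le_induction with
  | base => rfl
  | succ l hkl ih =>
    obtain ⟨v, rfl⟩ := τ.exists_pos_eq hl
    by_cases ht : τ.Touch v g
    · rw [strand_succ_of_touch ht, born_upperSide] at h
      omega
    · rw [strand_succ_of_not_touch ht] at h ⊢
      exact ih (by omega) h

theorem born_strand_mono {k l : ℕ} (hkl : k ≤ l) (hl : l ≤ n) (g : ℕ) :
    τ.born (τ.strand k g) ≤ τ.born (τ.strand l g) := by
  by_contra hc
  have h1 := born_strand_le (τ := τ) (hkl.trans hl) g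
  rw [strand_eq_of_born_le hkl hl (by omega)] at hc
  exact hc le_rfl

theorem same_zero_iff {a b : ℕ} : τ.Same 0 a b ↔
    letterCount τ.sign .minus a = letterCount τ.sign .minus b := by
  rw [letterCount_eq_iff]
  simp [Same, Wall]

theorem same_top_iff {a b : ℕ} : τ.Same n a b ↔
    letterCount τ.sign .plus a = letterCount τ.sign .plus b := by
  rw [letterCount_eq_iff]
  have : ∀ w, ¬ n ≤ τ.pos w := fun w => not_le.2 (τ.pos_lt w)
  simp [Same, Wall, this, τ.pos_lt]

/-- The bridge between ports and walls, by induction on levels. Gaps touching the inserted vertex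
are classified by its sides, the others keep both their ports and their mutual separations. -/
theorem strand_eq_iff {k a b : ℕ} (hk : k ≤ n) :
    τ.strand k a = τ.strand k b ↔ τ.Same k a b := by
  induction k generalizing a b with
  | zero => rw [strand_zero, strand_zero, same_zero_iff, OutPort.leaf.injEq]
  | succ k ih =>
    obtain ⟨v, rfl⟩ := τ.exists_pos_eq hk
    -- A touching gap acquires a port born at this level, a non-touching gap keeps an older one.
    have key : ∀ {a b}, τ.Touch v a → ¬ τ.Touch v b →
        ¬ τ.strand (τ.pos v + 1) a = τ.strand (τ.pos v + 1) b := by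
      intro a b ha hb h
      rw [strand_succ_of_touch ha, strand_succ_of_not_touch hb] at h
      have h1 := born_strand_le (τ := τ) (k := τ.pos v) (by omega) b
      rw [← h, born_upperSide] at h1
      omega
    by_cases ha : τ.Touch v a <;> by_cases hb : τ.Touch v b
    · rw [strand_succ_of_touch ha, strand_succ_of_touch hb, upperSide_eq_iff]
      rcases (τ.sign v).eq_minus_or_plus with hv | hv
      · simp [hv, same_succ_of_touch_minus hv ha hb]
      · simp [hv, same_succ_of_touch_plus hv ha hb]
    · exact ⟨fun h => absurd h (key ha hb), fun h => absurd (ha.congr_of_same_succ h) hb⟩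
    · exact ⟨fun h => absurd h.symm (key hb ha), fun h => absurd (hb.congr_of_same_succ h.symm) ha⟩
    · rw [strand_succ_of_not_touch ha, strand_succ_of_not_touch hb, ih (by omega),
        same_succ_iff_of_not_touch ha hb]

/-- Strands that coincide at some level coincide as long as no vertex is attached. -/
theorem strand_coalesce {k l a b : ℕ} (hkl : k ≤ l) (hl : l ≤ n) (h : τ.Same k a b)
    (ha : τ.strand l a = τ.strand k a) : τ.strand l b = τ.strand l a := by
  induction l, hkl using Nat.le_induction with
  | base => exact ((strand_eq_iff hl).2 h).symm
  | succ l hkl ih =>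
    obtain ⟨v, rfl⟩ := τ.exists_pos_eq hl
    have hn : ¬ τ.Touch v a := by
      intro ht
      rw [strand_succ_of_touch ht] at ha
      have h1 := born_strand_le (τ := τ) (hkl.trans (by omega)) a
      rw [← ha, born_upperSide] at h1
      omega
    have hs := strand_succ_of_not_touch hn
    have ih := ih (by omega) (hs ▸ ha)
    have hn' : ¬ τ.Touch v b := fun h => hn (h.congr_of_same ((strand_eq_iff (by omega)).1 ih))
    rw [hs, strand_succ_of_not_touch hn', ih]

/-- The port was born just after the insertion of `x`. At that level the gap must touch `x`, as
otherwise its port would be older. -/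
theorem strand_node_vertex {k g : ℕ} {x : Fin n} (hk : k ≤ n)
    (h : (τ.strand k g).node = .vertex x) :
    τ.pos x < k ∧ τ.Touch x g ∧ τ.strand k g = upperSide (τ.sign x) x g := by
  have hb := born_of_node (τ := τ) h
  have h1 := born_strand_le (τ := τ) hk g
  have h2 : τ.strand k g = τ.strand (τ.pos x + 1) g :=
    strand_eq_of_born_le (by omega) hk hb.le
  by_cases ht : τ.Touch x g
  · exact ⟨by omega, ht, by rw [h2, strand_succ_of_touch ht]⟩
  · rw [h2, strand_succ_of_not_touch ht] at hb
    have := born_strand_le (τ := τ) (τ.pos_lt x).le g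
    omega

theorem strand_eq_leaf {k g i : ℕ} (hk : k ≤ n) (h : τ.strand k g = .leaf i) :
    i = letterCount τ.sign .minus g := by
  rw [strand_eq_of_born_le (Nat.zero_le k) hk (by rw [h]; rfl), strand_zero] at h
  cases h; rfl

/-! ### The tree of a signed permutation -/

variable (τ)

/-- The level of an in-port. -/
def lev : InPort n → ℕ
  | .leaf _ => n
  | .mid v | .left v | .right v => τ.pos v

/-- The gap `g` leads to an in-port. -/
def GapOf (g : ℕ) : InPort n → Prop
  | .leaf i => letterCount τ.sign .plus g = i
  | .mid v | .left v => g = v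
  | .right v => g = v + 1

/-- The tree obtained by inserting the letters of a signed permutation by increasing
positions. -/
noncomputable def tree : PreTree n where
  sign := τ.sign
  -- The existence of an in-port depends only on the signature, so dummy arcs suffice to state it.
  arc o t := (PreTree.mk τ.sign (fun _ _ => True)).IsInPort t ∧
    ∃ g, τ.GapOf g t ∧ o = τ.strand (τ.lev t) g

variable {τ}

theorem tree_isInPort {o : OutPort n} {t : InPort n} (h : τ.tree.arc o t) :
    τ.tree.IsInPort t := by
  have := h.1
  cases t <;> exact this

theorem lev_le (τ : SignedPerm n) (t : InPort n) : τ.lev t ≤ n := by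
  cases t <;> simp [lev, (τ.pos_lt _).le]

theorem lowerSide_isInPort (T : PreTree n) (v : Fin n) (g : ℕ) :
    T.IsInPort (lowerSide (T.sign v) v g) := by
  rcases (T.sign v).eq_minus_or_plus with h | h <;> rw [h]
  · simp only [lowerSide]
    split_ifs <;> exact h
  · exact h

/-- `GapOf` selects one gap on each side of a vertex; every gap touching the vertex on this side
lies in the same strand. -/
theorem arc_lowerSide {v : Fin n} {g : ℕ} (h : τ.Touch v g) :
    τ.tree.arc (τ.strand (τ.pos v) g) (lowerSide (τ.sign v) v g) := by
  refine ⟨lowerSide_isInPort _ v g, ?_⟩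
  have hn := (τ.pos_lt v).le
  rcases (τ.sign v).eq_minus_or_plus with hv | hv
  · rw [hv]
    simp only [lowerSide]
    split_ifs with hg
    · exact ⟨v, rfl, (strand_eq_iff hn).2
        ((same_of_touch_minus hv h (touch_self v)).2 (by omega))⟩
    · exact ⟨v + 1, rfl, (strand_eq_iff hn).2
        ((same_of_touch_minus hv h (touch_self_succ v)).2 (by omega))⟩
  · rw [hv]
    exact ⟨v, rfl, (strand_eq_iff hn).2 (same_of_touch_plus hv h (touch_self v))⟩

theorem arc_leaf (τ : SignedPerm n) (g : ℕ) :
    τ.tree.arc (τ.strand n g) (.leaf (letterCount τ.sign .plus g)) :=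
  ⟨letterCount_le_total g, g, rfl, rfl⟩

theorem arc_in_unique {o o' : OutPort n} {t : InPort n} (h : τ.tree.arc o t)
    (h' : τ.tree.arc o' t) : o = o' := by
  obtain ⟨-, g, hg, rfl⟩ := h
  obtain ⟨-, g', hg', rfl⟩ := h'
  cases t with
  | leaf i => exact (strand_eq_iff le_rfl).2 (same_top_iff.2 (hg.trans hg'.symm))
  | mid v | left v | right v => rw [show g = g' from hg.trans hg'.symm]

/-- An arc ending at a vertex comes from a strand touching that vertex. -/
theorem arc_cases {o : OutPort n} {t : InPort n} (h : τ.tree.arc o t) :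
    (∃ v g, τ.Touch v g ∧ o = τ.strand (τ.pos v) g ∧ t = lowerSide (τ.sign v) v g ∧
      τ.GapOf g t) ∨
    ∃ g, o = τ.strand n g ∧ t = .leaf (letterCount τ.sign .plus g) := by
  obtain ⟨ht, g, hg, rfl⟩ := h
  cases t with
  | leaf i => exact Or.inr ⟨g, rfl, by rw [show _ = i from hg]⟩
  | mid v =>
    cases hg
    exact Or.inl ⟨v, v, touch_self v, rfl, by rw [show τ.sign v = _ from ht]; rfl, rfl⟩
  | left v =>
    cases hg
    exact Or.inl ⟨v, v, touch_self v, rfl,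
      by rw [show τ.sign v = _ from ht]; simp [lowerSide], rfl⟩
  | right v =>
    cases hg
    exact Or.inl ⟨v, v + 1, touch_self_succ v, rfl,
      by rw [show τ.sign v = _ from ht]; simp [lowerSide], rfl⟩

/-- The arc starting at the strand of level `k` containing the gap `a`. -/
theorem arc_strand {k a : ℕ} (hk : k ≤ n) {t : InPort n} (h : τ.tree.arc (τ.strand k a) t) :
    k ≤ τ.lev t ∧ ∃ g, τ.GapOf g t ∧ τ.strand (τ.lev t) g = τ.strand k a ∧ τ.Same k a g := by
  obtain ⟨ht, g, hg, he⟩ := h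
  suffices hkl : k ≤ τ.lev t by
    refine ⟨hkl, g, hg, he.symm, (strand_eq_iff hk).1 ?_⟩
    rw [he]
    exact strand_eq_of_born_le hkl (τ.lev_le t) (he ▸ born_strand_le hk a)
  by_contra hc
  rw [not_le] at hc
  -- If `t` were at a vertex `v` below level `k`, the gap `a` would touch `v`, and its strand at
  -- level `k` would be born after the insertion of `v`, whereas the source of the arc was born
  -- before.
  rcases arc_cases ⟨ht, g, hg, rfl⟩ with ⟨v, g', hv, h1, h2, -⟩ | ⟨g', -, rfl⟩
  · have hlev : τ.lev t = τ.pos v := by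
      rw [h2]; unfold lowerSide; split <;> (try split_ifs) <;> rfl
    rw [hlev] at hc
    rw [h1] at he
    have h3 : τ.strand k a = τ.strand (τ.pos v) a := strand_eq_of_born_le hc.le hk
      (he ▸ born_strand_le (τ := τ) (τ.pos_lt v).le g')
    have h4 : τ.Touch v a := hv.congr_of_same ((strand_eq_iff (τ.pos_lt v).le).1 (he.symm.trans h3))
    have h5 := born_strand_mono (τ := τ) (show τ.pos v + 1 ≤ k from hc) hk a
    rw [strand_succ_of_touch h4, born_upperSide, he] at h5
    have h6 := born_strand_le (τ := τ) (τ.pos_lt v).le g'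
    omega
  · exact absurd hk (not_le.2 hc)

/-- Descending induction on the level: the strand either meets the next vertex or crosses to the
next level, and from the last level it reaches an up leaf. -/
theorem exists_arc_strand {k : ℕ} (hk : k ≤ n) (g : ℕ) : ∃ t, τ.tree.arc (τ.strand k g) t := by
  induction hk using Nat.decreasingInduction with
  | self => exact ⟨_, τ.arc_leaf g⟩
  | of_succ k hk ih =>
    obtain ⟨v, rfl⟩ := τ.exists_pos_eq hk
    by_cases h : τ.Touch v g
    · exact ⟨_, arc_lowerSide h⟩
    · rwa [strand_succ_of_not_touch h] at ih

theorem isOutPort_strand {k : ℕ} (hk : k ≤ n) (g : ℕ) : τ.tree.IsOutPort (τ.strand k g) := by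
  induction k with
  | zero => exact letterCount_le_total g
  | succ k ih =>
    obtain ⟨v, rfl⟩ := τ.exists_pos_eq hk
    by_cases h : τ.Touch v g
    · rw [strand_succ_of_touch h]
      rcases (τ.sign v).eq_minus_or_plus with hv | hv <;> rw [hv]
      · exact hv
      · simp only [upperSide]
        split_ifs <;> exact hv
    · rw [strand_succ_of_not_touch h]
      exact ih (by omega)

theorem exists_strand_eq {o : OutPort n} (h : τ.tree.IsOutPort o) :
    ∃ k ≤ n, ∃ g, τ.strand k g = o := by
  cases o with
  | leaf i =>
    obtain ⟨g, -, hg⟩ := exists_letterCount_eq (show i ≤ letterCount τ.sign .minus n from h)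
    exact ⟨0, Nat.zero_le _, g, by rw [strand_zero, hg]⟩
  | mid v =>
    exact ⟨τ.pos v + 1, τ.pos_lt v, v, by
      rw [strand_succ_of_touch (touch_self v), show τ.sign v = _ from h]; rfl⟩
  | left v =>
    exact ⟨τ.pos v + 1, τ.pos_lt v, v, by
      rw [strand_succ_of_touch (touch_self v), show τ.sign v = _ from h]; simp [upperSide]⟩
  | right v =>
    exact ⟨τ.pos v + 1, τ.pos_lt v, v + 1, by
      rw [strand_succ_of_touch (touch_self_succ v), show τ.sign v = _ from h]; simp [upperSide]⟩

/-- By `arc_strand` a strand cannot survive beyond a target, so two targets have the same level. At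
a common vertex they are on the same side, since a negative letter separates its two children. -/
theorem arc_out_unique {o : OutPort n} {t t' : InPort n} (h : τ.tree.arc o t)
    (h' : τ.tree.arc o t') : t = t' := by
  have key : ∀ {o : OutPort n} {t t' : InPort n}, τ.tree.arc o t → τ.tree.arc o t' →
      τ.lev t ≤ τ.lev t' := by
    rintro o t t' ⟨-, g, -, rfl⟩ h'
    exact (arc_strand (τ.lev_le t) h').1
  have hl := le_antisymm (key h h') (key h' h)
  have hl2 : ∀ (v : Fin n) (g), τ.lev (lowerSide (τ.sign v) v g) = τ.pos v := by
    intro v g; unfold lowerSide; split <;> (try split_ifs) <;> rfl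
  rcases arc_cases h with ⟨v, g, hv, rfl, rfl, -⟩ | ⟨g, rfl, rfl⟩ <;>
    rcases arc_cases h' with ⟨v', g', hv', he, rfl, -⟩ | ⟨g', he, rfl⟩
  · rw [hl2, hl2, pos_inj] at hl
    subst hl
    rw [strand_eq_iff (τ.pos_lt v).le] at he
    rcases (τ.sign v).eq_minus_or_plus with hs | hs
    · rw [same_of_touch_minus hs hv hv'] at he
      simp [hs, lowerSide, he]
    · simp [hs, lowerSide]
  · rw [hl2] at hl
    exact absurd hl (τ.pos_lt v).ne
  · rw [hl2] at hl
    exact absurd hl (τ.pos_lt v').ne'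
  · rw [strand_eq_iff le_rfl, same_top_iff] at he
    rw [he]

end SignedPerm


/-! ### The tree of a signed permutation is a Cambrian tree -/

namespace SignedPerm

variable {n : ℕ} {τ : SignedPerm n}

variable (τ) in
/-- The label `w` is to the left of a node; for leaves, this is only meaningful if `w` delimits
the intervals that number these leaves. -/
def Before (w : Fin n) : Node n → Prop
  | .vertex v => w < v
  | .downLeaf i => letterCount τ.sign .minus w < i
  | .upLeaf i => letterCount τ.sign .plus w < i

variable (τ) in
/-- The node is inserted before level `k`. -/
def Lower (k : ℕ) : Node n → Prop
  | .vertex v => τ.pos v < k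
  | .downLeaf _ => True
  | .upLeaf _ => False

theorem Lower.mono {k l : ℕ} (hkl : k ≤ l) {x : Node n} (h : τ.Lower k x) : τ.Lower l x := by
  cases x with
  | vertex v => exact lt_of_lt_of_le h hkl
  | downLeaf i => trivial
  | upLeaf i => exact h

/-- The node where a strand starts is on the same side of the negative walls as the strand. -/
theorem before_strand_node {k g : ℕ} (hk : k ≤ n) {w : Fin n} (hw : τ.sign w = .minus)
    (hp : k ≤ τ.pos w) : τ.Before w (τ.strand k g).node ↔ (w : ℕ) < g := by
  rcases h : (τ.strand k g).node with x | i | i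
  · obtain ⟨h1, h2, -⟩ := strand_node_vertex hk h
    refine (h2 w ?_ (Or.inl ⟨hw, by omega⟩)).symm
    rintro rfl; omega
  · rcases h' : τ.strand k g with j | j | j | j <;> rw [h'] at h <;> cases h
    rw [strand_eq_leaf hk h']
    exact (lt_iff_letterCount_lt hw g).symm
  · rcases h' : τ.strand k g with j | j | j | j <;> rw [h'] at h <;> cases h

theorem lower_strand_node {k g : ℕ} (hk : k ≤ n) : τ.Lower k (τ.strand k g).node := by
  rcases h : (τ.strand k g).node with x | i | i
  · exact (strand_node_vertex hk h).1
  · trivial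
  · rcases h' : τ.strand k g with j | j | j | j <;> rw [h'] at h <;> cases h

/-- The node where a strand ends is on the same side of the positive walls as the strand. -/
theorem before_target {g : ℕ} {t : InPort n} (ht : τ.GapOf g t) {w : Fin n}
    (hw : τ.sign w = .plus) (hp : τ.pos w < τ.lev t) :
    τ.Before w t.node ↔ (w : ℕ) < g := by
  cases t with
  | leaf i => cases ht; exact (lt_iff_letterCount_lt hw g).symm
  | mid v => cases ht; rfl
  | left v => cases ht; rfl
  | right v =>
    cases ht
    -- The gap of a right port is `v + 1`, which differs from `v` only in its comparison with `v`
    -- itself.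
    have : (w : ℕ) ≠ v := fun h => by
      rw [Fin.ext h] at hp; exact lt_irrefl _ hp
    change w < v ↔ _
    rw [Fin.lt_def]; omega

theorem not_lower_target {k : ℕ} {t : InPort n} (h : k ≤ τ.lev t) : ¬ τ.Lower k t.node := by
  cases t <;> simp_all [InPort.node, Lower, lev]

/-- A vertex where a strand starts is on the same side of the walls present before its insertion
as the strand. -/
theorem before_source {k l g : ℕ} (hl : l ≤ n) (hk : ¬ τ.Lower k (τ.strand l g).node)
    {w : Fin n} (hw : τ.sign w = .plus) (hp : τ.pos w < k) :
    τ.Before w (τ.strand l g).node ↔ (w : ℕ) < g := by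
  rcases h : (τ.strand l g).node with x | i | i
  · obtain ⟨h1, h2, -⟩ := strand_node_vertex hl h
    rw [h] at hk
    have hk : ¬ τ.pos x < k := hk
    refine (h2 w ?_ (Or.inr ⟨hw, by omega⟩)).symm
    rintro rfl; omega
  · rw [h] at hk; exact absurd trivial hk
  · rcases h' : τ.strand l g with j | j | j | j <;> rw [h'] at h <;> cases h

/-! ### The two sides of a cut strand -/

/-- `w` is the closest wall at level `k` to the left of the gap `a`. -/
def LeftWall (τ : SignedPerm n) (k a : ℕ) (w : Fin n) : Prop :=
  τ.Wall k w ∧ (w : ℕ) < a ∧ ∀ u, τ.Wall k u → (u : ℕ) < a → u ≤ w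

/-- `w` is the closest wall at level `k` to the right of the gap `a`. -/
def RightWall (τ : SignedPerm n) (k a : ℕ) (w : Fin n) : Prop :=
  τ.Wall k w ∧ a ≤ w ∧ ∀ u, τ.Wall k u → a ≤ u → w ≤ u

theorem exists_leftWall {k a : ℕ} {u : Fin n} (hu : τ.Wall k u) (ha : (u : ℕ) < a) :
    ∃ w, τ.LeftWall k a w ∧ u ≤ w := by
  obtain ⟨w, hw, hmax⟩ := (Finset.univ.filter fun w => τ.Wall k w ∧ (w : ℕ) < a).exists_max_image
    id ⟨u, by simp [hu, ha]⟩
  simp only [Finset.mem_filter, Finset.mem_univ, true_and, id] at hw hmax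
  exact ⟨w, ⟨hw.1, hw.2, fun x h1 h2 => hmax x ⟨h1, h2⟩⟩, hmax u ⟨hu, ha⟩⟩

theorem exists_rightWall {k a : ℕ} {u : Fin n} (hu : τ.Wall k u) (ha : a ≤ u) :
    ∃ w, τ.RightWall k a w ∧ w ≤ u := by
  obtain ⟨w, hw, hmin⟩ := (Finset.univ.filter fun w => τ.Wall k w ∧ a ≤ (w : ℕ)).exists_min_image
    id ⟨u, by simp [hu, ha]⟩
  simp only [Finset.mem_filter, Finset.mem_univ, true_and, id] at hw hmin
  exact ⟨w, ⟨hw.1, hw.2, fun x h1 h2 => hmin x ⟨h1, h2⟩⟩, hmin u ⟨hu, ha⟩⟩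

/-- The component below the strand of the gap `a` at level `k` when the tree is cut there. -/
def Component (τ : SignedPerm n) (k a : ℕ) (x : Node n) : Prop :=
  (τ.Lower k x ∧ (∀ w, τ.LeftWall k a w → τ.sign w = .minus → τ.Before w x) ∧
    ∀ w, τ.RightWall k a w → τ.sign w = .minus → ¬ τ.Before w x) ∨
  (¬ τ.Lower k x ∧ ((∃ w, τ.LeftWall k a w ∧ τ.sign w = .plus ∧ ¬ τ.Before w x) ∨
    ∃ w, τ.RightWall k a w ∧ τ.sign w = .plus ∧ τ.Before w x))

theorem Wall.le_pos {k : ℕ} {w : Fin n} (h : τ.Wall k w) (hs : τ.sign w = .minus) :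
    k ≤ τ.pos w := by
  rcases h with h | h
  · exact h.2
  · rw [hs] at h; cases h.1

theorem Wall.pos_lt {k : ℕ} {w : Fin n} (h : τ.Wall k w) (hs : τ.sign w = .plus) :
    τ.pos w < k := by
  rcases h with h | h
  · rw [hs] at h; cases h.1
  · exact h.2

/-- When a strand is cut at level `k`, its lower end stays joined, through the vertex of an adjacent
positive wall, to everything beyond this wall. What lies beyond an adjacent negative wall is instead
joined to the upper end, through the vertex still to be inserted. `Component` states this with
coordinates, and the source of the strand lies between the adjacent negative walls. -/
theorem component_source {k a : ℕ} (hk : k ≤ n) : τ.Component k a (τ.strand k a).node := by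
  refine Or.inl ⟨lower_strand_node hk, fun w hw hs => ?_, fun w hw hs => ?_⟩
  · exact (before_strand_node hk hs (hw.1.le_pos hs)).2 hw.2.1
  · rw [before_strand_node hk hs (hw.1.le_pos hs)]
    exact not_lt.2 hw.2.1

/-- The target lies above the cut, and the strand leading to it crosses no positive wall, so it is
not beyond an adjacent one. -/
theorem not_component_target {k a : ℕ} (hk : k ≤ n) {t : InPort n}
    (h : τ.tree.arc (τ.strand k a) t) : ¬ τ.Component k a t.node := by
  obtain ⟨hl, g, hg, -, hs⟩ := arc_strand hk h
  rintro (⟨h1, -⟩ | ⟨-, ⟨w, hw, hp, hb⟩ | ⟨w, hw, hp, hb⟩⟩)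
  · exact not_lower_target hl h1
  · rw [before_target hg hp ((hw.1.pos_lt hp).trans_le hl), ← hs w hw.1] at hb
    exact hb hw.2.1
  · rw [before_target hg hp ((hw.1.pos_lt hp).trans_le hl), ← hs w hw.1] at hb
    exact not_lt.2 hw.2.1 hb

/-- Membership only involves negative walls for nodes below the cut and positive walls for nodes
above it; nodes on the same side of these are not distinguished. -/
theorem component_congr {k a : ℕ} {x y : Node n} (h : τ.Lower k x ↔ τ.Lower k y)
    (h1 : τ.Lower k x → ∀ w, τ.sign w = .minus → k ≤ τ.pos w → (τ.Before w x ↔ τ.Before w y))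
    (h2 : ¬ τ.Lower k x → ∀ w, τ.sign w = .plus → τ.pos w < k →
      (τ.Before w x ↔ τ.Before w y)) : τ.Component k a x ↔ τ.Component k a y := by
  suffices ∀ {x y : Node n}, (τ.Lower k x ↔ τ.Lower k y) →
    (τ.Lower k x → ∀ w, τ.sign w = .minus → k ≤ τ.pos w → (τ.Before w x ↔ τ.Before w y)) →
    (¬ τ.Lower k x → ∀ w, τ.sign w = .plus → τ.pos w < k → (τ.Before w x ↔ τ.Before w y)) →
    τ.Component k a x → τ.Component k a y from
      ⟨this h h1 h2, this h.symm (fun h' w a b => (h1 (h.2 h') w a b).symm)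
        (fun h' w a b => (h2 (fun hx => h' (h.1 hx)) w a b).symm)⟩
  intro x y h h1 h2
  rintro (⟨hx, h3, h4⟩ | ⟨hx, ⟨w, hw, hs, hb⟩ | ⟨w, hw, hs, hb⟩⟩)
  · exact Or.inl ⟨h.1 hx, fun w hw hs => (h1 hx w hs (hw.1.le_pos hs)).1 (h3 w hw hs),
      fun w hw hs hb => h4 w hw hs ((h1 hx w hs (hw.1.le_pos hs)).2 hb)⟩
  · exact Or.inr ⟨fun hy => hx (h.2 hy), Or.inl ⟨w, hw, hs,
      fun hb' => hb ((h2 hx w hs (hw.1.pos_lt hs)).2 hb')⟩⟩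
  · exact Or.inr ⟨fun hy => hx (h.2 hy), Or.inr ⟨w, hw, hs,
      (h2 hx w hs (hw.1.pos_lt hs)).1 hb⟩⟩

/-- The arcs other than the cut one do not leave the component. -/
theorem component_arc {k a : ℕ} (hk : k ≤ n) {o : OutPort n} {t : InPort n}
    (h : τ.tree.arc o t) (ho : o ≠ τ.strand k a) :
    τ.Component k a o.node ↔ τ.Component k a t.node := by
  obtain ⟨ht, g, hg, rfl⟩ := h
  have hln := τ.lev_le t
  -- The arc may end below the level of the cut, cross this level, or start above it.
  rcases lt_or_ge (τ.lev t) k with hl | hl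
  · have h1 : τ.Lower k (τ.strand (τ.lev t) g).node := 
      (lower_strand_node hln).mono hl.le
    have h2 : τ.Lower k t.node := by
      cases t <;> simp_all [InPort.node, Lower, lev]
      omega
    refine component_congr (iff_of_true h1 h2) (fun _ w hw hp => ?_) (fun h => absurd h1 h)
    rw [before_strand_node hln hw (hl.le.trans hp)]
    cases t with
    | leaf i => exact absurd hk (not_le.2 hl)
    | mid v => cases hg; rfl
    | left v => cases hg; rfl
    | right v =>
      cases hg
      have : (w : ℕ) ≠ v := fun h => by
        rw [Fin.ext h] at hp; exact absurd hl (not_lt.2 hp)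
      change _ ↔ w < v
      rw [Fin.lt_def]; omega
  · have h2 := not_lower_target hl
    by_cases h1 : τ.Lower k (τ.strand (τ.lev t) g).node
    · have hborn : τ.born (τ.strand (τ.lev t) g) ≤ k := by
        rcases h : (τ.strand (τ.lev t) g).node with x | i | i
        · rw [h] at h1
          rw [born_of_node h]; exact h1
        · rcases h' : τ.strand (τ.lev t) g with j | j | j | j <;> rw [h'] at h <;> cases h
          exact Nat.zero_le k
        · rw [h] at h1; exact h1.elim
      have he := strand_eq_of_born_le hl hln hborn
      rw [he] at h1 ho ⊢
      -- The arc crosses level `k` in another strand, hence beyond a wall adjacent to the cut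
      -- strand. If this wall is negative both ends are outside the component, if it is positive
      -- both are inside.
      rw [Ne, strand_eq_iff hk, Same] at ho
      push Not at ho
      obtain ⟨u, hu, ho⟩ := ho
      have hlow : ∀ w, τ.Wall k w → τ.sign w = .minus →
          (τ.Before w (τ.strand k g).node ↔ (w : ℕ) < g) :=
        fun w hw hs => before_strand_node hk hs (hw.le_pos hs)
      have hup : ∀ w, τ.Wall k w → τ.sign w = .plus →
          (τ.Before w t.node ↔ (w : ℕ) < g) :=
        fun w hw hs => before_target hg hs ((hw.pos_lt hs).trans_le hl)
      by_cases hua : (u : ℕ) < a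
      · obtain ⟨w, hw, huw⟩ := exists_leftWall hu hua
        have hgw : g ≤ w := by rw [Fin.le_def] at huw; omega
        have hwa := hw.2.1
        rcases (τ.sign w).eq_minus_or_plus with hs | hs
        · refine iff_of_false ?_ ?_
          · rintro (⟨-, h, -⟩ | ⟨h, -⟩)
            · have := (hlow w hw.1 hs).1 (h w hw hs)
              omega
            · exact h h1
          · rintro (⟨h, -⟩ | ⟨-, ⟨w', hw', hs', hb⟩ | ⟨w', hw', hs', hb⟩⟩)
            · exact h2 h
            · rw [le_antisymm (hw.2.2 w' hw'.1 hw'.2.1) (hw'.2.2 w hw.1 hw.2.1), hs] at hs'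
              cases hs'
            · rw [hup w' hw'.1 hs'] at hb
              have := hw'.2.1
              omega
        · refine iff_of_true ?_ ?_
          · refine Or.inl ⟨h1, fun w' hw' hs' => ?_, fun w' hw' hs' => ?_⟩
            · rw [le_antisymm (hw.2.2 w' hw'.1 hw'.2.1) (hw'.2.2 w hw.1 hw.2.1), hs] at hs'
              cases hs'
            · rw [hlow w' hw'.1 hs']
              have := hw'.2.1
              omega
          · refine Or.inr ⟨h2, Or.inl ⟨w, hw, hs, ?_⟩⟩
            rw [hup w hw.1 hs]; omega
      · obtain ⟨w, hw, huw⟩ := exists_rightWall hu (not_lt.1 hua)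
        have hgw : (w : ℕ) < g := by rw [Fin.le_def] at huw; omega
        have hwa := hw.2.1
        rcases (τ.sign w).eq_minus_or_plus with hs | hs
        · refine iff_of_false ?_ ?_
          · rintro (⟨-, -, h⟩ | ⟨h, -⟩)
            · exact h w hw hs ((hlow w hw.1 hs).2 hgw)
            · exact h h1
          · rintro (⟨h, -⟩ | ⟨-, ⟨w', hw', hs', hb⟩ | ⟨w', hw', hs', hb⟩⟩)
            · exact h2 h
            · rw [hup w' hw'.1 hs'] at hb
              have := hw'.2.1
              omega
            · rw [le_antisymm (hw'.2.2 w hw.1 hw.2.1) (hw.2.2 w' hw'.1 hw'.2.1), hs] at hs'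
              cases hs'
        · refine iff_of_true ?_ ?_
          · refine Or.inl ⟨h1, fun w' hw' hs' => ?_, fun w' hw' hs' => ?_⟩
            · rw [hlow w' hw'.1 hs']
              have := hw'.2.1
              omega
            · rw [le_antisymm (hw'.2.2 w hw.1 hw.2.1) (hw.2.2 w' hw'.1 hw'.2.1), hs] at hs'
              cases hs'
          · refine Or.inr ⟨h2, Or.inr ⟨w, hw, hs, ?_⟩⟩
            rw [hup w hw.1 hs]; omega
    · refine component_congr (iff_of_false h1 h2) (fun h => absurd h h1) (fun _ w hs hp => ?_)
      rw [before_source hln h1 hs hp, before_target hg hs (hp.trans_le hl)]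

/-! ### Orientation, connectedness and order of labels -/

/-- The level of a node. -/
def nodeLev (τ : SignedPerm n) : Node n → ℕ
  | .vertex v => τ.pos v + 1
  | .downLeaf _ => 0
  | .upLeaf _ => n + 1

theorem nodeLev_lt {x y : Node n} (h : τ.tree.Arc x y) : τ.nodeLev x < τ.nodeLev y := by
  obtain ⟨o, t, ⟨-, g, -, rfl⟩, rfl, rfl⟩ := h
  have h1 := born_strand_le (τ := τ) (τ.lev_le t) g
  have h2 : ∀ o : OutPort n, τ.nodeLev o.node = τ.born o := by intro o; cases o <;> rfl
  have h3 : τ.nodeLev t.node = τ.lev t + 1 := by cases t <;> rfl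
  rw [h2, h3]; omega

theorem adj_iff {x y : Node n} : τ.tree.graph.Adj x y ↔ τ.tree.Arc x y ∨ τ.tree.Arc y x := by
  rw [PreTree.graph, SimpleGraph.fromRel_adj, and_iff_right_iff_imp]
  rintro (h | h) rfl <;> exact lt_irrefl _ (nodeLev_lt h)

theorem reachable_arc {o : OutPort n} {t : InPort n} (h : τ.tree.arc o t) :
    τ.tree.graph.Reachable o.node t.node :=
  (adj_iff.2 (Or.inl ⟨o, t, h, rfl, rfl⟩)).reachable

theorem reachable_strand (k g : ℕ) (hk : k ≤ n) :
    τ.tree.graph.Reachable (τ.strand 0 g).node (τ.strand k g).node := by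
  induction k with
  | zero => exact .refl _
  | succ k ih =>
    obtain ⟨v, rfl⟩ := τ.exists_pos_eq hk
    refine (ih (by omega)).trans ?_
    by_cases h : τ.Touch v g
    · rw [strand_succ_of_touch h, upperSide_node, ← lowerSide_node (τ.sign v) v g]
      exact reachable_arc (arc_lowerSide h)
    · rw [strand_succ_of_not_touch h]

/-- The gaps on both sides of a letter touch it, so their strands meet at its vertex. -/
theorem reachable_strand_zero (g : ℕ) :
    τ.tree.graph.Reachable (τ.strand 0 0).node (τ.strand 0 g).node := by
  induction g with
  | zero => exact .refl _
  | succ g ih =>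
    refine ih.trans ?_
    by_cases hg : g < n
    · have h1 := reachable_strand (τ := τ) _ g (τ.pos_lt ⟨g, hg⟩)
      have h2 := reachable_strand (τ := τ) _ (g + 1) (τ.pos_lt ⟨g, hg⟩)
      rw [Nat.succ_eq_add_one, strand_succ_of_touch (touch_self ⟨g, hg⟩), upperSide_node] at h1
      rw [Nat.succ_eq_add_one, strand_succ_of_touch (touch_self_succ ⟨g, hg⟩),
        upperSide_node] at h2
      exact h1.trans h2.symm
    · rw [(strand_eq_iff (Nat.zero_le n)).2 (fun w _ => by have := w.2; omega :
        τ.Same 0 g (g + 1))]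

/-- Only the cut arc leaves the component. If `v` is an end of this arc, a walk avoiding `v` cannot
use it. -/
theorem component_connectedAvoiding {k a : ℕ} (hk : k ≤ n) {v : Fin n} {x y : Node n}
    (hv : ∀ t, τ.tree.arc (τ.strand k a) t →
      (τ.strand k a).node = .vertex v ∨ t.node = .vertex v)
    (h : τ.tree.ConnectedAvoiding v x y) : τ.Component k a x ↔ τ.Component k a y := by
  obtain ⟨p, hp⟩ := h
  induction p with
  | nil => rfl
  | @cons x z y hxz p ih =>
    rw [SimpleGraph.Walk.support_cons, List.mem_cons, not_or] at hp
    refine Iff.trans ?_ (ih hp.2)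
    have hz : Node.vertex v ≠ z := fun e => hp.2 (e ▸ p.start_mem_support)
    have : ∀ {o t}, τ.tree.arc o t → o.node ≠ .vertex v → t.node ≠ .vertex v →
        o ≠ τ.strand k a := by
      rintro o t h h1 h2 rfl
      rcases hv t h with h | h
      · exact h1 h
      · exact h2 h
    rcases adj_iff.1 hxz with ⟨o, t, h, rfl, rfl⟩ | ⟨o, t, h, rfl, rfl⟩
    · exact component_arc hk h (this h (Ne.symm hp.1) hz.symm)
    · exact (component_arc hk h (this h hz.symm (Ne.symm hp.1))).symm

theorem connectedAvoiding_ne {T : PreTree n} {v : Fin n} {x y : Node n}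
    (h : T.ConnectedAvoiding v x y) : y ≠ .vertex v := by
  obtain ⟨p, hp⟩ := h
  rintro rfl
  exact hp p.end_mem_support

/-- Applied to the strand just left of `v`: the left subtree of `v` lies on the lower side of the
cut if `v` is negative, on the upper side if `v` is positive. Such a node is not beyond `v`, or is
even beyond the adjacent wall further left. -/
theorem isLeftOf_of_component {k a : ℕ} {v : Fin n} {x : Node n}
    (h : τ.RightWall k a v) (hx : x ≠ .vertex v)
    (hc : τ.sign v = .minus ∧ τ.Component k a x ∨ τ.sign v = .plus ∧ ¬ τ.Component k a x) :
    τ.tree.IsLeftOf v x := by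
  have hlt : ∀ w, τ.LeftWall k a w → (w : ℕ) < v := fun w hw => hw.2.1.trans_le h.2.1
  have hu : ∀ w, τ.RightWall k a w → w = v := fun w hw =>
    le_antisymm (hw.2.2 v h.1 h.2.1) (h.2.2 w hw.1 hw.2.1)
  have key : ¬ τ.Before v x ∨ ∃ w : Fin n, (w : ℕ) < v ∧ ¬ τ.Before w x := by
    rcases hc with ⟨hs, hc⟩ | ⟨hs, hc⟩
    · rcases hc with ⟨h1, h2, h3⟩ | ⟨h1, ⟨w, hw, hs', hb⟩ | ⟨w, hw, hs', hb⟩⟩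
      · exact Or.inl (h3 v h hs)
      · exact Or.inr ⟨w, hlt w hw, hb⟩
      · rw [hu w hw, hs] at hs'; cases hs'
    · by_cases h1 : τ.Lower k x
      · have : ¬ ((∀ w, τ.LeftWall k a w → τ.sign w = .minus → τ.Before w x) ∧
            ∀ w, τ.RightWall k a w → τ.sign w = .minus → ¬ τ.Before w x) :=
          fun h => hc (Or.inl ⟨h1, h⟩)
        rw [not_and_or] at this
        rcases this with h2 | h2
        · push Not at h2
          obtain ⟨w, hw, -, hb⟩ := h2
          exact Or.inr ⟨w, hlt w hw, hb⟩
        · push Not at h2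
          obtain ⟨w, hw, hs', -⟩ := h2
          rw [hu w hw, hs] at hs'; cases hs'
      · exact Or.inl fun hb => hc (Or.inr ⟨h1, Or.inr ⟨v, h, hs, hb⟩⟩)
  cases x with
  | vertex u =>
    have : u ≠ v := fun e => hx (e ▸ rfl)
    rcases key with hb | ⟨w, hw, hb⟩
    · exact lt_of_le_of_ne (not_lt.1 hb) this
    · exact lt_of_le_of_lt (not_lt.1 hb) hw
  | downLeaf i =>
    rcases key with hb | ⟨w, hw, hb⟩
    · exact not_lt.1 hb
    · exact (not_lt.1 hb).trans (letterCount_mono hw.le)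
  | upLeaf i =>
    rcases key with hb | ⟨w, hw, hb⟩
    · exact not_lt.1 hb
    · exact (not_lt.1 hb).trans (letterCount_mono hw.le)

theorem isRightOf_of_component {k a : ℕ} {v : Fin n} {x : Node n}
    (h : τ.LeftWall k a v) (hx : x ≠ .vertex v)
    (hc : τ.sign v = .minus ∧ τ.Component k a x ∨ τ.sign v = .plus ∧ ¬ τ.Component k a x) :
    τ.tree.IsRightOf v x := by
  have hlt : ∀ w, τ.RightWall k a w → (v : ℕ) < w := fun w hw => h.2.1.trans_le hw.2.1
  have hu : ∀ w, τ.LeftWall k a w → w = v := fun w hw =>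
    le_antisymm (h.2.2 w hw.1 hw.2.1) (hw.2.2 v h.1 h.2.1)
  have key : τ.Before v x ∨ ∃ w : Fin n, (v : ℕ) < w ∧ τ.Before w x := by
    rcases hc with ⟨hs, hc⟩ | ⟨hs, hc⟩
    · rcases hc with ⟨h1, h2, h3⟩ | ⟨h1, ⟨w, hw, hs', hb⟩ | ⟨w, hw, hs', hb⟩⟩
      · exact Or.inl (h2 v h hs)
      · rw [hu w hw, hs] at hs'; cases hs'
      · exact Or.inr ⟨w, hlt w hw, hb⟩
    · by_cases h1 : τ.Lower k x
      · have : ¬ ((∀ w, τ.LeftWall k a w → τ.sign w = .minus → τ.Before w x) ∧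
            ∀ w, τ.RightWall k a w → τ.sign w = .minus → ¬ τ.Before w x) :=
          fun h => hc (Or.inl ⟨h1, h⟩)
        rw [not_and_or] at this
        rcases this with h2 | h2
        · push Not at h2
          obtain ⟨w, hw, hs', -⟩ := h2
          rw [hu w hw, hs] at hs'; cases hs'
        · push Not at h2
          obtain ⟨w, hw, -, hb⟩ := h2
          exact Or.inr ⟨w, hlt w hw, hb⟩
      · refine Or.inl ?_
        by_contra hb
        exact hc (Or.inr ⟨h1, Or.inl ⟨v, h, hs, hb⟩⟩)
  -- `Before` is strict on leaf numbers, which gains the unit by which the count may grow when the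
  -- gap passes `v`.
  have hcount : ∀ {ε : Sgn} {w : Fin n} {i : ℕ}, (v : ℕ) ≤ w →
      letterCount τ.sign ε w < i → letterCount τ.sign ε (v + 1) ≤ i := by
    intro ε w i hvw hi
    rcases hvw.eq_or_lt with e | hvw
    · by_cases hs : τ.sign v = ε
      · rw [letterCount_succ_of_sign hs, e]; omega
      · rw [letterCount_succ_of_ne hs, e]; omega
    · exact (letterCount_mono hvw).trans hi.le
  cases x with
  | vertex u =>
    rcases key with hb | ⟨w, hw, hb⟩
    · exact hb
    · exact lt_trans hw hb
  | downLeaf i =>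
    rcases key with hb | ⟨w, hw, hb⟩
    · exact hcount le_rfl hb
    · exact hcount hw.le hb
  | upLeaf i =>
    rcases key with hb | ⟨w, hw, hb⟩
    · exact hcount le_rfl hb
    · exact hcount hw.le hb

/-- Levels increase along arcs, which gives the orientation. Every arc is a bridge because
`Component` contains its source but not its target and no other arc crosses the boundary; the same
sets, cut at an arc of `v`, bound the subtrees of `v`. -/
theorem tree_isCambrian (τ : SignedPerm n) : τ.tree.IsCambrian where
  isOutPort := by
    rintro o t ⟨-, g, -, rfl⟩
    exact isOutPort_strand (τ.lev_le t) g
  isInPort _ _ h := tree_isInPort h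
  out_unique o ho := by
    obtain ⟨k, hk, g, rfl⟩ := exists_strand_eq ho
    obtain ⟨t, ht⟩ := exists_arc_strand hk g
    exact ⟨t, ht, fun t' h' => arc_out_unique h' ht⟩
  in_unique t ht := by
    have h : ∃ g, τ.GapOf g t := by
      cases t with
      | leaf i =>
        obtain ⟨g, -, hg⟩ := exists_letterCount_eq (show i ≤ letterCount τ.sign .plus n from ht)
        exact ⟨g, hg⟩
      | mid v | left v | right v => exact ⟨_, rfl⟩
    obtain ⟨g, hg⟩ := h
    have h : τ.tree.arc (τ.strand (τ.lev t) g) t := ⟨by cases t <;> exact ht, g, hg, rfl⟩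
    exact ⟨_, h, fun o' h' => arc_in_unique h' h⟩
  oriented x y h h' := lt_asymm (nodeLev_lt h) (nodeLev_lt h')
  acyclic := by
    have key : ∀ {o t}, τ.tree.arc o t → ¬ (τ.tree.graph \
        SimpleGraph.fromEdgeSet {s(o.node, t.node)}).Reachable o.node t.node := by
      rintro o t ⟨ht, g, hg, rfl⟩
      have hl := τ.lev_le t
      have hn := not_component_target hl (⟨ht, g, hg, rfl⟩ : τ.tree.arc _ t)
      rintro ⟨p⟩
      refine hn ?_
      suffices ∀ {x y : Node n} (p : (τ.tree.graph \ SimpleGraph.fromEdgeSet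
          {s((τ.strand (τ.lev t) g).node, t.node)}).Walk x y),
          τ.Component (τ.lev t) g x → τ.Component (τ.lev t) g y from this p (component_source hl)
      intro x y p
      induction p with
      | nil => exact id
      | @cons x z y hxz p ih =>
        intro hx
        refine ih ?_
        rw [SimpleGraph.sdiff_adj, SimpleGraph.fromEdgeSet_adj] at hxz
        obtain ⟨hxz, hne⟩ := hxz
        have hxz' := hxz.ne
        have hne : s(x, z) ≠ s((τ.strand (τ.lev t) g).node, t.node) := fun h => hne ⟨h, hxz'⟩
        rcases adj_iff.1 hxz with ⟨o', t', h, rfl, rfl⟩ | ⟨o', t', h, rfl, rfl⟩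
        · refine (component_arc hl h ?_).1 hx
          rintro rfl
          rw [arc_out_unique h ⟨ht, g, hg, rfl⟩] at hne
          exact hne rfl
        · refine (component_arc hl h ?_).2 hx
          rintro rfl
          rw [arc_out_unique h ⟨ht, g, hg, rfl⟩] at hne
          exact hne Sym2.eq_swap
    rw [SimpleGraph.isAcyclic_iff_forall_adj_isBridge]
    intro x y hxy
    rw [SimpleGraph.isBridge_iff]
    rcases adj_iff.1 hxy with ⟨o, t, h, rfl, rfl⟩ | ⟨o, t, h, rfl, rfl⟩
    · exact key h
    · rw [Sym2.eq_swap]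
      exact fun h' => key h h'.symm
  connected := by
    have : ∀ {o t}, τ.tree.arc o t → τ.tree.graph.Reachable (τ.strand 0 0).node o.node := by
      rintro o t ⟨-, g, -, rfl⟩
      exact (reachable_strand_zero g).trans (reachable_strand _ g (τ.lev_le t))
    exact fun o t o' t' h h' => (this h).symm.trans (this h')
  left_lt := by
    rintro v x (⟨hv, o, h, hx⟩ | ⟨hv, t, h, hx⟩)
    · have hv : τ.sign v = .minus := hv
      obtain ⟨-, g, hg, rfl⟩ := h
      cases hg
      have hk := (τ.pos_lt v).le
      refine isLeftOf_of_component (k := τ.pos v) (a := v)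
        ⟨wall_self_iff.2 hv, le_rfl, fun u _ h => h⟩ (connectedAvoiding_ne hx)
        (Or.inl ⟨hv, (component_connectedAvoiding hk (fun t ht => Or.inr ?_) hx).1
          (component_source hk)⟩)
      rw [arc_out_unique ht ⟨hv, _, rfl, rfl⟩ (t' := .left v)]
      rfl
    · have hv : τ.sign v = .plus := hv
      have hs := strand_succ_of_touch (touch_self (τ := τ) v)
      simp only [hv, upperSide, le_refl, if_true] at hs
      have hk : τ.pos v + 1 ≤ n := τ.pos_lt v
      rw [← hs] at h
      refine isLeftOf_of_component (k := τ.pos v + 1) (a := v)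
        ⟨wall_succ_self_iff.2 hv, le_rfl, fun u _ h => h⟩ (connectedAvoiding_ne hx)
        (Or.inr ⟨hv, fun hc => not_component_target hk h
          ((component_connectedAvoiding hk (fun t ht => Or.inl ?_) hx).2 hc)⟩)
      rw [hs]; rfl
  right_gt := by
    rintro v x (⟨hv, o, h, hx⟩ | ⟨hv, t, h, hx⟩)
    · have hv : τ.sign v = .minus := hv
      obtain ⟨-, g, hg, rfl⟩ := h
      cases hg
      have hk := (τ.pos_lt v).le
      refine isRightOf_of_component (k := τ.pos v) (a := v + 1)
        ⟨wall_self_iff.2 hv, Nat.lt_succ_self _, fun u _ h => Nat.lt_succ_iff.1 h⟩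
        (connectedAvoiding_ne hx)
        (Or.inl ⟨hv, (component_connectedAvoiding hk (fun t ht => Or.inr ?_) hx).1
          (component_source hk)⟩)
      rw [arc_out_unique ht ⟨hv, _, rfl, rfl⟩ (t' := .right v)]
      rfl
    · have hv : τ.sign v = .plus := hv
      have hs := strand_succ_of_touch (touch_self_succ (τ := τ) v)
      simp only [hv, upperSide, Nat.not_succ_le_self, if_false] at hs
      have hk : τ.pos v + 1 ≤ n := τ.pos_lt v
      rw [← hs] at h
      refine isRightOf_of_component (k := τ.pos v + 1) (a := v + 1)
        ⟨wall_succ_self_iff.2 hv, Nat.lt_succ_self _, fun u _ h => Nat.lt_succ_iff.1 h⟩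
        (connectedAvoiding_ne hx)
        (Or.inr ⟨hv, fun hc => not_component_target hk h
          ((component_connectedAvoiding hk (fun t ht => Or.inl ?_) hx).2 hc)⟩)
      rw [hs]; rfl

end SignedPerm


/-! ### A Cambrian tree is determined by any of its linear extensions -/

namespace PreTree

variable {n : ℕ} {T : PreTree n}

theorem IsCambrian.adj_iff (hT : T.IsCambrian) {x y : Node n} :
    T.graph.Adj x y ↔ T.Arc x y ∨ T.Arc y x := by
  rw [PreTree.graph, SimpleGraph.fromRel_adj, and_iff_right_iff_imp]
  rintro (h | h) rfl <;> exact hT.oriented _ _ h h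

theorem IsCambrian.adj (hT : T.IsCambrian) {o : OutPort n} {t : InPort n} (h : T.arc o t) :
    T.graph.Adj o.node t.node := hT.adj_iff.2 (Or.inl ⟨o, t, h, rfl, rfl⟩)

theorem ConnectedAvoiding.refl {v : Fin n} {x : Node n} (h : x ≠ .vertex v) :
    T.ConnectedAvoiding v x x := ⟨.nil, by simpa using h.symm⟩

theorem ConnectedAvoiding.symm {v : Fin n} {x y : Node n} (h : T.ConnectedAvoiding v x y) :
    T.ConnectedAvoiding v y x := by
  obtain ⟨p, hp⟩ := h
  exact ⟨p.reverse, by simpa using hp⟩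

theorem ConnectedAvoiding.tail {v : Fin n} {x y z : Node n} (h : T.ConnectedAvoiding v x y)
    (hyz : T.graph.Adj y z) (hz : z ≠ .vertex v) : T.ConnectedAvoiding v x z := by
  obtain ⟨p, hp⟩ := h
  exact ⟨p.concat hyz, by simp [SimpleGraph.Walk.support_concat, hp, hz.symm]⟩

theorem InLeftSubtree.tail {v : Fin n} {y z : Node n} (h : T.InLeftSubtree v y)
    (hyz : T.graph.Adj y z) (hz : z ≠ .vertex v) : T.InLeftSubtree v z := by
  rcases h with ⟨hs, o, ho, h⟩ | ⟨hs, o, ho, h⟩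
  · exact Or.inl ⟨hs, o, ho, h.tail hyz hz⟩
  · exact Or.inr ⟨hs, o, ho, h.tail hyz hz⟩

theorem InRightSubtree.tail {v : Fin n} {y z : Node n} (h : T.InRightSubtree v y)
    (hyz : T.graph.Adj y z) (hz : z ≠ .vertex v) : T.InRightSubtree v z := by
  rcases h with ⟨hs, o, ho, h⟩ | ⟨hs, o, ho, h⟩
  · exact Or.inl ⟨hs, o, ho, h.tail hyz hz⟩
  · exact Or.inr ⟨hs, o, ho, h.tail hyz hz⟩

/-- A path to a down leaf that starts upwards has a negative vertex as its first peak. -/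
theorem IsCambrian.exists_peak (hT : T.IsCambrian) {w x y z : Node n} (q : T.graph.Walk y z)
    (hq : q.IsPath) (r : T.graph.Walk w x) (hxy : T.Arc x y)
    (hrq : ∀ u ∈ r.support, u ∉ q.support) {i : ℕ} (hz : z = .downLeaf i) :
    ∃ v, T.sign v = .minus ∧ ((T.InLeftSubtree v w ∧ T.InRightSubtree v z) ∨
      (T.InRightSubtree v w ∧ T.InLeftSubtree v z)) := by
  induction q generalizing x with
  | nil =>
    obtain ⟨o, t, -, -, ht⟩ := hxy
    rw [hz] at ht
    cases t <;> cases ht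
  | @cons y u z hyu q ih =>
    rw [SimpleGraph.Walk.cons_isPath_iff] at hq
    -- The walk `r` is what has already been climbed; it stays disjoint from the rest of the path,
    -- so that avoiding the future peak is known on both sides.
    have hx : x ∉ (SimpleGraph.Walk.cons hyu q).support := hrq x r.end_mem_support
    rcases hT.adj_iff.1 hyu with h | h
    · refine ih hq.1 (r.concat (hT.adj_iff.2 (Or.inl hxy))) h ?_ hz
      intro a ha
      rw [SimpleGraph.Walk.support_concat, List.mem_append,
        List.mem_singleton] at ha
      rcases ha with ha | rfl
      · have := hrq a ha
        rw [SimpleGraph.Walk.support_cons, List.mem_cons, not_or] at this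
        exact this.2
      · exact hq.2
    -- Here the path turns downwards. Its two arcs enter the same node by distinct in-ports, as a
    -- path does not go back; only a negative vertex has two in-ports.
    · obtain ⟨o, t, hot, rfl, rfl⟩ := hxy
      obtain ⟨o', t', hot', rfl, ht'⟩ := h
      have hne : t ≠ t' := by
        rintro rfl
        rw [(hT.in_unique t (hT.isInPort _ _ hot)).unique hot hot'] at hx
        exact hx (by simp)
      have hwx : ∀ v, t.node = .vertex v → T.ConnectedAvoiding v o.node w := by
        rintro v hv
        refine ⟨r.reverse, fun hm => hrq (.vertex v) (by simpa using hm) ?_⟩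
        rw [← hv]; exact SimpleGraph.Walk.start_mem_support _
      have huz : ∀ v, t.node = .vertex v → T.ConnectedAvoiding v o'.node z :=
        fun v hv => ⟨q, hv ▸ hq.2⟩
      have hp := hT.isInPort _ _ hot
      have hp' := hT.isInPort _ _ hot'
      rcases t with j | v | v | v <;> rcases t' with j' | v' | v' | v' <;> cases ht' <;>
        simp only [IsInPort] at hp hp'
      · exact absurd rfl hne
      · exact absurd rfl hne
      · rw [hp] at hp'; cases hp'
      · rw [hp] at hp'; cases hp'
      · rw [hp] at hp'; cases hp'
      · exact absurd rfl hne
      · exact ⟨v, hp, Or.inl ⟨Or.inl ⟨hp, o, hot, hwx v rfl⟩, Or.inl ⟨hp, o', hot', huz v rfl⟩⟩⟩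
      · rw [hp] at hp'; cases hp'
      · exact ⟨v, hp, Or.inr ⟨Or.inl ⟨hp, o, hot, hwx v rfl⟩, Or.inl ⟨hp, o', hot', huz v rfl⟩⟩⟩
      · exact absurd rfl hne

/-- The down leaves in the intervals adjacent to a negative vertex are below this vertex. -/
theorem IsCambrian.downLeaf_below (hT : T.IsCambrian) {w : Fin n} (hw : T.sign w = .minus)
    {i : ℕ} (h1 : letterCount T.sign .minus w ≤ i) (h2 : i ≤ letterCount T.sign .minus w + 1) :
    T.InLeftSubtree w (.downLeaf i) ∨ T.InRightSubtree w (.downLeaf i) := by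
  have hi : T.IsOutPort (.leaf i) := by
    refine h2.trans ?_
    rw [← letterCount_succ_of_sign hw]
    exact letterCount_le_total _
  obtain ⟨t, ht, -⟩ := hT.out_unique _ hi
  obtain ⟨t', ht', -⟩ := hT.out_unique (.mid w) hw
  obtain ⟨p, hp⟩ := (hT.connected _ _ _ _ ht' ht).exists_isPath
  cases p with
  | @cons _ z _ hwz q =>
    have hwz' : T.graph.Adj (.vertex w) z := hwz
    have hq := hp
    rw [SimpleGraph.Walk.cons_isPath_iff] at hq
    have hc : T.ConnectedAvoiding w z (.downLeaf i) := ⟨q, hq.2⟩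
    rcases hT.adj_iff.1 hwz' with h | h
    -- A path leaving `w` upwards has a negative peak separating `w` from the leaf, but no negative
    -- label lies between `w` and a leaf of an adjacent interval.
    · exfalso
      obtain ⟨v, hv, ⟨h3, h4⟩ | ⟨h3, h4⟩⟩ := hT.exists_peak q hq.1 (.nil : T.graph.Walk
        (.vertex w) (.vertex w)) h
          (fun u hu => by rw [SimpleGraph.Walk.support_nil, List.mem_singleton] at hu; exact hu ▸ hq.2)
          rfl
      · have h3 : w < v := hT.left_lt _ _ h3
        have h4 : letterCount T.sign .minus (v + 1) ≤ i := hT.right_gt _ _ h4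
        rw [letterCount_succ_of_sign hv] at h4
        have h5 : letterCount T.sign .minus (w + 1) ≤ letterCount T.sign .minus v :=
          letterCount_mono h3
        rw [letterCount_succ_of_sign hw] at h5
        omega
      · have h3 : v < w := hT.right_gt _ _ h3
        have h4 : i ≤ letterCount T.sign .minus v := hT.left_lt _ _ h4
        have h5 := letterCount_lt (b := w) hv le_rfl h3
        omega
    · obtain ⟨o, t, hot, rfl, htw⟩ := h
      have hp := hT.isInPort _ _ hot
      rcases t with j | v | v | v <;> cases htw
      · rw [show T.sign w = _ from hp] at hw; cases hw
      · exact Or.inl (Or.inl ⟨hw, o, hot, hc⟩)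
      · exact Or.inr (Or.inl ⟨hw, o, hot, hc⟩)

theorem IsCambrian.downLeaf_left (hT : T.IsCambrian) {w : Fin n} (hw : T.sign w = .minus) :
    T.InLeftSubtree w (.downLeaf (letterCount T.sign .minus w)) := by
  refine (hT.downLeaf_below hw le_rfl (Nat.le_succ _)).resolve_right fun h => ?_
  have h : letterCount T.sign .minus (w + 1) ≤ letterCount T.sign .minus w := hT.right_gt _ _ h
  rw [letterCount_succ_of_sign hw] at h
  omega

theorem IsCambrian.downLeaf_right (hT : T.IsCambrian) {w : Fin n} (hw : T.sign w = .minus) :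
    T.InRightSubtree w (.downLeaf (letterCount T.sign .minus (w + 1))) := by
  rw [letterCount_succ_of_sign hw]
  refine (hT.downLeaf_below hw (Nat.le_succ _) le_rfl).resolve_left fun h => ?_
  have h : letterCount T.sign .minus w + 1 ≤ letterCount T.sign .minus w := hT.left_lt _ _ h
  omega

end PreTree

/-! ### Comparison with a linear extension, level by level -/

namespace SignedPerm

variable {n : ℕ} {τ : SignedPerm n} {T : PreTree n}

/-- The arcs of the tree of `τ` ending before level `k` are arcs of `T`. -/
def AgreesBelow (τ : SignedPerm n) (T : PreTree n) (k : ℕ) : Prop :=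
  ∀ o t, τ.tree.arc o t → τ.lev t < k → T.arc o t

theorem lev_lowerSide (ε : Sgn) (v : Fin n) (g : ℕ) : τ.lev (lowerSide ε v g) = τ.pos v := by
  unfold lowerSide
  cases ε <;> simp only <;> (try split_ifs) <;> rfl

/-- Transport along the strand of `g` inside `T`: between the levels `l` and `k` the vertices met by
this gap are joined by arcs already known in `T`, and `w` is not among them. -/
theorem AgreesBelow.propagate {k l g : ℕ} (h : τ.AgreesBelow T k) (hlk : l ≤ k) (hk : k ≤ n)
    {w : Fin n} (hw : ∀ m, l ≤ m → m < k → τ.pos w ≠ m) {P : OutPort n → Prop}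
    (hP : ∀ o t o', P o → T.arc o t → t.node ≠ .vertex w → o'.node = t.node → P o')
    (h0 : P (τ.strand l g)) : P (τ.strand k g) := by
  induction k, hlk using Nat.le_induction with
  | base => exact h0
  | succ k hlk ih =>
    have ih := ih (fun o t ht hl => h o t ht (by omega)) (by omega)
      (fun m h1 h2 => hw m h1 (by omega))
    obtain ⟨v, rfl⟩ := τ.exists_pos_eq hk
    have hvw : v ≠ w := by
      rintro rfl
      exact hw _ hlk (Nat.lt_succ_self _) rfl
    by_cases ht : τ.Touch v g
    · refine hP _ _ _ ih (h _ _ (arc_lowerSide ht) ?_) ?_ ?_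
      · rw [lev_lowerSide]; exact Nat.lt_succ_self _
      · rw [lowerSide_node]; simpa using hvw
      · rw [strand_succ_of_touch ht, lowerSide_node, upperSide_node]
    · rwa [strand_succ_of_not_touch ht]

/-- The strand just left of the wall of `w` enters the left subtree of `w`, at the neighbouring down
leaf if `w` is negative and at its left upper side if `w` is positive. It then follows arcs of `T`
without meeting `w`, so it stays there. -/
theorem AgreesBelow.isLeftOf {k g : ℕ} (h : τ.AgreesBelow T k) (hk : k ≤ n)
    (hT : T.IsCambrian) (hs : τ.sign = T.sign) {t : InPort n} (ht : T.arc (τ.strand k g) t)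
    {w : Fin n} (hw : τ.Wall k w) (hwt : t.node ≠ .vertex w) (hg : τ.Same k g w) :
    T.IsLeftOf w t.node := by
  refine hT.left_lt _ _ ?_
  have htail : ∀ o t, T.arc o t → T.InLeftSubtree w o.node → t.node ≠ .vertex w →
      T.InLeftSubtree w t.node := fun o t h h1 h2 => h1.tail (hT.adj h) h2
  rw [(strand_eq_iff hk).2 hg] at ht
  suffices h : ∀ t, T.arc (τ.strand k w) t → t.node ≠ .vertex w → T.InLeftSubtree w t.node from
    h t ht hwt
  rcases (τ.sign w).eq_minus_or_plus with hsw | hsw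
  · refine h.propagate (Nat.zero_le k) hk (w := w) (fun m _ hm e => ?_)
      (P := fun o => ∀ t, T.arc o t → t.node ≠ .vertex w → T.InLeftSubtree w t.node) ?_ ?_
    · have := hw.le_pos hsw
      omega
    · intro o t o' h1 h2 h3 h4 t' ht'
      exact htail _ _ ht' (h4 ▸ h1 t h2 h3)
    · intro t ht
      refine htail _ _ ht ?_
      have := hT.downLeaf_left (w := w) (hs ▸ hsw)
      rwa [← hs] at this
  · have hp := hw.pos_lt hsw
    refine h.propagate (l := τ.pos w + 1) hp hk (w := w) (fun m h1 _ e => by omega)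
      (P := fun o => ∀ t, T.arc o t → t.node ≠ .vertex w → T.InLeftSubtree w t.node) ?_ ?_
    · intro o t o' h1 h2 h3 h4 t' ht'
      exact htail _ _ ht' (h4 ▸ h1 t h2 h3)
    · intro t ht htw
      rw [strand_succ_of_touch (touch_self w), hsw] at ht
      simp only [upperSide, le_refl, if_true] at ht
      exact Or.inr ⟨hs ▸ hsw, t, ht, .refl htw⟩

theorem AgreesBelow.isRightOf {k g : ℕ} (h : τ.AgreesBelow T k) (hk : k ≤ n)
    (hT : T.IsCambrian) (hs : τ.sign = T.sign) {t : InPort n} (ht : T.arc (τ.strand k g) t)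
    {w : Fin n} (hw : τ.Wall k w) (hwt : t.node ≠ .vertex w) (hg : τ.Same k g (w + 1)) :
    T.IsRightOf w t.node := by
  refine hT.right_gt _ _ ?_
  have htail : ∀ o t, T.arc o t → T.InRightSubtree w o.node → t.node ≠ .vertex w →
      T.InRightSubtree w t.node := fun o t h h1 h2 => h1.tail (hT.adj h) h2
  rw [(strand_eq_iff hk).2 hg] at ht
  suffices h : ∀ t, T.arc (τ.strand k (w + 1)) t → t.node ≠ .vertex w →
    T.InRightSubtree w t.node from h t ht hwt
  rcases (τ.sign w).eq_minus_or_plus with hsw | hsw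
  · refine h.propagate (Nat.zero_le k) hk (w := w) (fun m _ hm e => ?_)
      (P := fun o => ∀ t, T.arc o t → t.node ≠ .vertex w → T.InRightSubtree w t.node) ?_ ?_
    · have := hw.le_pos hsw
      omega
    · intro o t o' h1 h2 h3 h4 t' ht'
      exact htail _ _ ht' (h4 ▸ h1 t h2 h3)
    · intro t ht
      refine htail _ _ ht ?_
      have := hT.downLeaf_right (w := w) (hs ▸ hsw)
      rwa [← hs] at this
  · have hp := hw.pos_lt hsw
    refine h.propagate (l := τ.pos w + 1) hp hk (w := w) (fun m h1 _ e => by omega)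
      (P := fun o => ∀ t, T.arc o t → t.node ≠ .vertex w → T.InRightSubtree w t.node) ?_ ?_
    · intro o t o' h1 h2 h3 h4 t' ht'
      exact htail _ _ ht' (h4 ▸ h1 t h2 h3)
    · intro t ht htw
      rw [strand_succ_of_touch (touch_self_succ w), hsw] at ht
      simp only [upperSide, Nat.not_succ_le_self, if_false] at ht
      exact Or.inr ⟨hs ▸ hsw, t, ht, .refl htw⟩

/-- Below the level of `v`, the strand of the gap `g` is connected to its down leaf. -/
theorem AgreesBelow.connectedAvoiding {v : Fin n} (h : τ.AgreesBelow T (τ.pos v))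
    (hT : T.IsCambrian) (g : ℕ) : T.ConnectedAvoiding v (τ.strand (τ.pos v) g).node
      (.downLeaf (letterCount τ.sign .minus g)) := by
  refine (h.propagate (Nat.zero_le _) (τ.pos_lt v).le (w := v) (fun m _ hm e => by omega)
    (P := fun o => T.ConnectedAvoiding v (.downLeaf (letterCount τ.sign .minus g)) o.node)
    ?_ (.refl (by simp))).symm
  intro o t o' h1 h2 h3 h4
  rw [h4]
  exact h1.tail (hT.adj h2) h3

theorem same_of_leftWall {k a : ℕ} {w : Fin n} (h : τ.LeftWall k a w) :
    τ.Same k a (w + 1) := fun u hu => by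
  have h1 := h.2.2 u hu
  have h2 := h.2.1
  rw [Fin.le_def] at h1
  omega

theorem same_of_rightWall {k a : ℕ} {w : Fin n} (h : τ.RightWall k a w) :
    τ.Same k a w := fun u hu => by
  have h1 := h.2.2 u hu
  have h2 := h.2.1
  rw [Fin.le_def] at h1
  omega

/-- The arc of `T` into a port of `v` starts on some strand present at the level of `v`. Were it not
the strand prescribed by the sweep, a wall would separate the two, and the order of labels in `T`
would fail at the letter of this wall. -/
theorem AgreesBelow.succ {v : Fin n} (h : τ.AgreesBelow T (τ.pos v)) (hT : T.IsCambrian)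
    (hτ : T.IsLinearExtension τ) : τ.AgreesBelow T (τ.pos v + 1) := by
  intro o₀ t h₀ hlt
  have hs := hτ.1
  rcases Nat.lt_succ_iff_lt_or_eq.1 hlt with hlt | hlev
  · exact h _ _ h₀ hlt
  have hk := (τ.pos_lt v).le
  have htT : T.IsInPort t := by
    have := tree_isInPort h₀
    have h1 := hT.isInPort
    cases T with | mk s a => cases hs; cases t <;> exact this
  obtain ⟨o, ho, -⟩ := hT.in_unique t htT
  obtain ⟨-, g, hg, rfl⟩ := h₀
  rw [hlev]
  have htv : t.node = .vertex v ∧ (g = v ∨ g = v + 1) := by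
    cases t with
    | leaf i => exact absurd hlev (τ.pos_lt v).ne'
    | mid u | left u => rw [← pos_inj.1 hlev]; exact ⟨rfl, Or.inl hg⟩
    | right u => rw [← pos_inj.1 hlev]; exact ⟨rfl, Or.inr hg⟩
  obtain ⟨htv, hgv⟩ := htv
  have hoP : τ.tree.IsOutPort o := by
    have := hT.isOutPort _ _ ho
    cases T with | mk s a => cases hs; cases o <;> exact this
  obtain ⟨t₁, ht₁, -⟩ := τ.tree_isCambrian.out_unique o hoP
  -- An arc of `τ.tree` from `o` ending earlier would be an arc of `T`, in conflict with the arc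
  -- from `o` to `t`.
  have hl₁ : τ.pos v ≤ τ.lev t₁ := by
    by_contra hc
    have := h _ _ ht₁ (not_le.1 hc)
    rw [(hT.out_unique o (hT.isOutPort _ _ ho)).unique this ho, hlev] at hc
    exact hc le_rfl
  -- The source precedes `v` in the linear extension, so its port exists when `v` is inserted.
  have hborn : τ.born o ≤ τ.pos v := by
    rcases hx : o.node with x | i | i
    · rw [born_of_node hx]
      exact hτ.2 x v ⟨o, t, ho, hx, htv⟩
    · rcases o with j | j | j | j <;> cases hx
      exact Nat.zero_le _
    · cases o <;> cases hx
  obtain ⟨-, g₁, -, rfl⟩ := ht₁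
  have he := strand_eq_of_born_le hl₁ (τ.lev_le t₁) hborn
  rw [he] at ho
  suffices hsame : τ.Same (τ.pos v) g₁ g by
    rwa [(strand_eq_iff hk).2 hsame] at ho
  by_contra hc
  unfold Same at hc
  push Not at hc
  obtain ⟨w, hw, hc⟩ := hc
  have htvw : ∀ {u : Fin n}, u ≠ v → t.node ≠ .vertex u := by
    intro u hu e
    rw [htv] at e
    cases e
    exact hu rfl
  -- The wall nearest to `g₁` in the direction of `g` forces the target `v` onto the side of `g₁`,
  -- while `v` is next to `g`.
  by_cases hwg : (w : ℕ) < g₁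
  · obtain ⟨u, hu, hwu⟩ := exists_leftWall hw hwg
    rw [Fin.le_def] at hwu
    by_cases huv : u = v
    · subst huv
      have hsv := wall_self_iff.1 hu.1
      -- Here the nearest wall belongs to `v` itself, which is negative. The wrong strand comes from
      -- the down leaf just right of `v`, which would then be in the left subtree of `v`.
      have hgt : t = .left u := by
        have hh : τ.sign u = T.sign u := by rw [hs]
        rcases t with i | x | x | x <;> cases htv
        · rw [hh, show T.sign u = _ from htT] at hsv; cases hsv
        · rfl
        · have : g = u + 1 := hg
          omega
      have hcon := h.connectedAvoiding hT (u + 1)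
      rw [← (strand_eq_iff hk).2 (same_of_leftWall hu)] at hcon
      rw [hgt] at ho
      have := hT.left_lt _ _ (Or.inl ⟨hs ▸ hsv, _, ho, hcon⟩)
      have this : letterCount τ.sign .minus (u + 1) ≤ letterCount T.sign .minus u := this
      rw [hs, letterCount_succ_of_sign (hs ▸ hsv)] at this
      omega
    · have := h.isRightOf hk hT hs ho hu.1 (htvw huv) (same_of_leftWall hu)
      rw [htv] at this
      have : u < v := this
      rw [Fin.lt_def] at this
      omega
  · obtain ⟨u, hu, hwu⟩ := exists_rightWall hw (not_lt.1 hwg)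
    rw [Fin.le_def] at hwu
    by_cases huv : u = v
    · subst huv
      have hsv := wall_self_iff.1 hu.1
      have hgt : t = .right u := by
        have hh : τ.sign u = T.sign u := by rw [hs]
        rcases t with i | x | x | x <;> cases htv
        · rw [hh, show T.sign u = _ from htT] at hsv; cases hsv
        · have : g = u := hg
          omega
        · rfl
      have hcon := h.connectedAvoiding hT u
      rw [← (strand_eq_iff hk).2 (same_of_rightWall hu)] at hcon
      rw [hgt] at ho
      have := hT.right_gt _ _ (Or.inl ⟨hs ▸ hsv, _, ho, hcon⟩)
      have this : letterCount T.sign .minus (u + 1) ≤ letterCount τ.sign .minus u := this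
      rw [hs, letterCount_succ_of_sign (hs ▸ hsv)] at this
      omega
    · have := h.isLeftOf hk hT hs ho hu.1 (htvw huv) (same_of_rightWall hu)
      rw [htv] at this
      have : v < u := this
      rw [Fin.lt_def] at this
      omega

theorem agreesBelow (hT : T.IsCambrian) (hτ : T.IsLinearExtension τ) {k : ℕ} (hk : k ≤ n) :
    τ.AgreesBelow T k := by
  induction k with
  | zero => exact fun o t _ h => absurd h (Nat.not_lt_zero _)
  | succ k ih =>
    obtain ⟨v, rfl⟩ := τ.exists_pos_eq hk
    exact (ih (by omega)).succ hT hτ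

/-- All ports of vertices are already occupied by the agreed arcs, so a strand at the last level
must reach an up leaf. The positive walls around it, through the order of labels, leave only one
possible number. -/
theorem arc_leaf_of_isLinearExtension (hT : T.IsCambrian) (hτ : T.IsLinearExtension τ) (g : ℕ) :
    T.arc (τ.strand n g) (.leaf (letterCount τ.sign .plus g)) := by
  have hs := hτ.1
  have hA := agreesBelow hT hτ le_rfl
  have hoT : T.IsOutPort (τ.strand n g) := by
    have := isOutPort_strand (τ := τ) le_rfl g
    cases T with | mk s a => cases hs; cases h : τ.strand n g <;> rw [h] at this <;> exact this
  obtain ⟨t, ht, -⟩ := hT.out_unique _ hoT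
  have htP := hT.isInPort _ _ ht
  have htP' : τ.tree.IsInPort t := by
    cases T with | mk s a => cases hs; cases t <;> exact htP
  obtain ⟨o', ho', -⟩ := τ.tree_isCambrian.in_unique t htP'
  by_cases hlev : τ.lev t < n
  · have h1 := hA _ _ ho' hlev
    rw [(hT.in_unique t htP).unique h1 ht] at ho'
    rw [arc_out_unique ho' (τ.arc_leaf g)] at hlev
    exact absurd hlev (lt_irrefl _)
  rcases t with j | v | v | v
  swap; · exact absurd (τ.pos_lt v) hlev
  swap; · exact absurd (τ.pos_lt v) hlev
  swap; · exact absurd (τ.pos_lt v) hlev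
  suffices j = letterCount τ.sign .plus g by rwa [← this]
  obtain ⟨g', -, rfl⟩ := exists_letterCount_eq (show j ≤ letterCount τ.sign .plus n from htP')
  refine letterCount_congr fun w hw => ?_
  have hwall : τ.Wall n w := Or.inr ⟨hw, τ.pos_lt w⟩
  have hplus : ∀ {u}, τ.Wall n u → τ.sign u = .plus := fun {u} hu =>
    (τ.sign u).eq_minus_or_plus.resolve_left fun h => not_le.2 (τ.pos_lt u) (hu.le_pos h)
  by_contra hc
  by_cases hwg : (w : ℕ) < g
  · obtain ⟨u, hu, hwu⟩ := exists_leftWall hwall hwg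
    have h1 := hA.isRightOf le_rfl hT hs ht hu.1 (by simp [InPort.node]) (same_of_leftWall hu)
    have h1 : letterCount T.sign .plus (u + 1) ≤ letterCount τ.sign .plus g' := h1
    rw [← hs, letterCount_succ_of_sign (hplus hu.1)] at h1
    have h2 : letterCount τ.sign .plus g' ≤ letterCount τ.sign .plus u :=
      letterCount_mono (le_trans (by omega) (Fin.le_def.1 hwu))
    omega
  · obtain ⟨u, hu, hwu⟩ := exists_rightWall hwall (not_lt.1 hwg)
    have h1 := hA.isLeftOf le_rfl hT hs ht hu.1 (by simp [InPort.node]) (same_of_rightWall hu)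
    have h1 : letterCount τ.sign .plus g' ≤ letterCount T.sign .plus u := h1
    rw [← hs] at h1
    have h2 : letterCount τ.sign .plus u < letterCount τ.sign .plus g' :=
      letterCount_lt (hplus hu.1) le_rfl (by rw [Fin.le_def] at hwu; omega)
    omega

/-- One inclusion of arcs is enough: both trees have the same ports, and each out-port of `T`
carries a unique arc. -/
theorem eq_tree (hT : T.IsCambrian) (hτ : T.IsLinearExtension τ) : T = τ.tree := by
  have h1 : ∀ o t, τ.tree.arc o t → T.arc o t := by
    intro o t h
    by_cases hlev : τ.lev t < n
    · exact agreesBelow hT hτ le_rfl _ _ h hlev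
    · obtain ⟨-, g, hg, rfl⟩ := h
      rcases t with j | v | v | v
      · rw [← show _ = j from hg]; exact arc_leaf_of_isLinearExtension hT hτ g
      · exact absurd (τ.pos_lt v) hlev
      · exact absurd (τ.pos_lt v) hlev
      · exact absurd (τ.pos_lt v) hlev
  have h2 : T.arc = τ.tree.arc := by
    funext o t
    refine propext ⟨fun h => ?_, h1 o t⟩
    have hoP : τ.tree.IsOutPort o := by
      have := hT.isOutPort _ _ h
      have hs := hτ.1
      cases T with | mk s a => cases hs; cases o <;> exact this
    obtain ⟨t', ht', -⟩ := τ.tree_isCambrian.out_unique o hoP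
    rwa [(hT.out_unique o (hT.isOutPort _ _ h)).unique h (h1 _ _ ht')]
  have hs : T.sign = τ.tree.sign := hτ.1.symm
  cases T with | mk s a => cases hs; cases h2; rfl

end SignedPerm


/-! ### Linear extensions of a Cambrian tree are congruent -/

namespace SignedPerm

variable {n : ℕ} {τ : SignedPerm n}

/-- Consecutive letters not joined by an arc are separated by a wall. -/
theorem exists_wall_between {a c : Fin n} (hac : τ.pos c = τ.pos a + 1)
    (h : ¬ τ.tree.Arc (.vertex a) (.vertex c)) :
    ∃ b, b ≠ a ∧ τ.Wall (τ.pos c) b ∧ (a < b ∧ b < c ∨ c < b ∧ b < a) := by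
  by_contra hb
  push Not at hb
  -- A gap touching both letters would carry an arc from `a` to `c`.
  have key : ∀ g : ℕ, τ.Touch c g → τ.Touch a g → False := by
    intro g hc ha
    refine h ⟨_, _, arc_lowerSide hc, ?_, lowerSide_node _ _ _⟩
    rw [hac, strand_succ_of_touch ha, upperSide_node]
  have hne : ∀ {w u : Fin n}, w ≠ u → (w : ℕ) ≠ u := fun h e => h (Fin.ext e)
  have hac' : a ≠ c := by rintro rfl; omega
  have hw' : ∀ w, w ≠ a → τ.Wall (τ.pos a) w →
      ¬ (a < w ∧ w < c) ∧ ¬ (c < w ∧ w < a) := by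
    intro w hw hw'
    rw [← wall_succ hw, ← hac] at hw'
    have := hb w hw hw'
    constructor
    · rintro ⟨h1, h2⟩; exact absurd h2 (not_lt.2 (this.1 h1))
    · rintro ⟨h1, h2⟩; exact absurd h2 (not_lt.2 (this.2 h1))
  -- The gap next to `c` on the side of `a` touches `a` when no wall lies between them.
  rcases lt_or_ge a c with hlt | hge
  · refine key c (touch_self c) fun w hw hw₁ => ?_
    have h1 := hne hw
    have h2 := hw' w hw hw₁
    simp only [Fin.lt_def] at h2 hlt ⊢
    omega
  · refine key (c + 1) (touch_self_succ c) fun w hw hw₁ => ?_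
    have h1 := hne hw
    have h2 := hw' w hw hw₁
    have h3 := hne hac'
    simp only [Fin.lt_def, Fin.le_def] at h2 hge ⊢
    omega

/-- Exchange of the letters at the positions `i` and `i'`. -/
def exchange (τ : SignedPerm n) (i i' : Fin n) : SignedPerm n where
  perm := (Equiv.swap i i').trans τ.perm
  sign := τ.sign

/-- The wall between the two letters comes from a negative letter further right or a positive letter
further left, which is exactly the side condition of a rewriting step. The order of the two values
decides the direction of the step. -/
theorem congruent_exchange {i i' : Fin n} (hi : (i' : ℕ) = i + 1)
    (h : ¬ τ.tree.Arc (.vertex (τ.perm i)) (.vertex (τ.perm i'))) :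
    CambrianCongruent τ (τ.exchange i i') := by
  obtain ⟨b, hb, hw, h⟩ := exists_wall_between (by rw [pos_perm, pos_perm, hi]) h
  rw [pos_perm] at hw
  obtain ⟨j, rfl⟩ := τ.perm.surjective b
  have hji : j ≠ i := fun e => hb (e ▸ rfl)
  have hji' : j ≠ i' := by
    rintro rfl
    rcases h with ⟨h1, h2⟩ | ⟨h1, h2⟩
    · exact lt_irrefl _ h2
    · exact lt_irrefl _ h1
  have h1 : (j : ℕ) ≠ i := fun e => hji (Fin.ext e)
  have h2 : (j : ℕ) ≠ i' := fun e => hji' (Fin.ext e)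
  have hpos : (i' < j ∧ τ.sign (τ.perm j) = Sgn.minus) ∨
      (j < i ∧ τ.sign (τ.perm j) = Sgn.plus) := by
    rcases hw with ⟨hs, hw⟩ | ⟨hs, hw⟩ <;> rw [pos_perm] at hw
    · exact Or.inl ⟨by rw [Fin.lt_def]; omega, hs⟩
    · exact Or.inr ⟨by rw [Fin.lt_def]; omega, hs⟩
  have hx1 : (τ.exchange i i').perm i = τ.perm i' := by simp [exchange]
  have hx2 : (τ.exchange i i').perm i' = τ.perm i := by simp [exchange]
  have hx3 : (τ.exchange i i').perm j = τ.perm j := by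
    simp [exchange, Equiv.swap_apply_of_ne_of_ne hji hji']
  rcases h with h | h
  · exact .rel _ _ ⟨rfl, i, i', j, hi, h.1, h.2, hpos, rfl⟩
  · refine .symm _ _ (.rel _ _ ⟨rfl, i, i', j, hi, ?_, ?_, ?_, ?_⟩)
    · rw [hx1, hx3]; exact h.1
    · rw [hx2, hx3]; exact h.2
    · rw [hx3]; exact hpos
    · ext x; simp [exchange]

theorem isLinearExtension_exchange {T : PreTree n} (hτ : T.IsLinearExtension τ) {i i' : Fin n}
    (hi : (i' : ℕ) = i + 1) (h : ¬ T.Arc (.vertex (τ.perm i)) (.vertex (τ.perm i'))) :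
    T.IsLinearExtension (τ.exchange i i') := by
  refine ⟨hτ.1, fun v w hvw => ?_⟩
  have hlt := hτ.2 v w hvw
  obtain ⟨x, rfl⟩ := τ.perm.surjective v
  obtain ⟨y, rfl⟩ := τ.perm.surjective w
  have hxy : ¬ (x = i ∧ y = i') := by rintro ⟨rfl, rfl⟩; exact h hvw
  rw [Equiv.symm_apply_apply, Equiv.symm_apply_apply, Fin.lt_def] at hlt
  simp only [exchange, Equiv.symm_trans_apply, Equiv.symm_apply_apply, Equiv.symm_swap,
    Equiv.swap_apply_def, Fin.lt_def]
  split_ifs <;> simp_all [Fin.ext_iff] <;> omega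

/-! ### Sorting one linear extension into another -/

theorem exists_descent {m : ℕ} {π : Equiv.Perm (Fin m)} (h : π ≠ 1) :
    ∃ i i' : Fin m, (i' : ℕ) = i + 1 ∧ π i' < π i := by
  by_contra hc
  push Not at hc
  cases m with
  | zero => exact h (Subsingleton.elim _ _)
  | succ m =>
    have hmono : StrictMono π := Fin.strictMono_iff_lt_succ.2 fun i =>
      lt_of_le_of_ne (hc i.castSucc i.succ (by simp))
        fun e => (Fin.castSucc_lt_succ (i := i)).ne (π.injective e)
    refine h (Equiv.ext fun x => ?_)
    have := (hmono.range_inj strictMono_id).1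
      (by rw [π.surjective.range_eq, Function.surjective_id.range_eq])
    exact congrFun this x

/-- A potential for bubble sort: exchanging a descent increases the sum by `q i - q i'`. -/
theorem sum_mul_lt_of_descent {m : ℕ} (q : Fin m → ℕ) {i i' : Fin m} (hi : (i' : ℕ) = i + 1)
    (hq : q i' < q i) :
    ∑ x : Fin m, (x : ℕ) * q x < ∑ x : Fin m, (x : ℕ) * q (Equiv.swap i i' x) := by
  have hne : i ≠ i' := by rintro rfl; omega
  have h1 : ∑ x : Fin m, (x : ℕ) * q (Equiv.swap i i' x) =
      ∑ x : Fin m, (Equiv.swap i i' x : ℕ) * q x := by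
    rw [← Equiv.sum_comp (Equiv.swap i i')]
    simp
  rw [h1]
  have h2 : ∑ x : Fin m, (((Equiv.swap i i' x : ℕ) : ℤ) - (x : ℕ)) * q x = q i - q i' := by
    rw [Fintype.sum_eq_add i i' hne]
    · rw [Equiv.swap_apply_left, Equiv.swap_apply_right, hi]
      push_cast
      ring
    · rintro x ⟨hx, hx'⟩
      rw [Equiv.swap_apply_of_ne_of_ne hx hx']
      simp
  simp only [sub_mul, Finset.sum_sub_distrib] at h2
  zify
  zify at hq
  linarith

end SignedPerm

open SignedPerm

theorem PreTree.IsCambrian.congruent {n : ℕ} {T : PreTree n} (hT : T.IsCambrian)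
    {τ τ₁ : SignedPerm n} (hτ : T.IsLinearExtension τ) (hτ₁ : T.IsLinearExtension τ₁) :
    CambrianCongruent τ τ₁ := by
  -- The number `d` bounds the remaining exchanges: each term of the potential is at most `n * n`,
  -- and each exchange increases the potential.
  suffices ∀ (d : ℕ) (τ : SignedPerm n), T.IsLinearExtension τ →
      ∑ _x : Fin n, n * n < (∑ x : Fin n, (x : ℕ) * τ₁.pos (τ.perm x)) + d →
      CambrianCongruent τ τ₁ from this (∑ _x : Fin n, n * n + 1) τ hτ (by omega)
  intro d
  induction d with
  | zero =>
    intro τ _ h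
    rw [add_zero] at h
    refine absurd h (not_lt.2 (Finset.sum_le_sum fun x _ => ?_))
    exact Nat.mul_le_mul x.2.le (τ₁.pos_lt _).le
  | succ d ih =>
    intro τ hτ h
    by_cases he : τ.perm.trans τ₁.perm.symm = 1
    · have : τ = τ₁ := by
        refine SignedPerm.ext ?_ (hτ.1.trans hτ₁.1.symm)
        ext x : 1
        have := congrArg (fun e => τ₁.perm (e x)) he
        simpa using this
      exact this ▸ .refl _
    · obtain ⟨i, i', hi, hlt⟩ := exists_descent he
      -- The two letters appear in the opposite order in the linear extension `τ₁`, so no arc goes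
      -- from the first to the second.
      have harc : ¬ T.Arc (.vertex (τ.perm i)) (.vertex (τ.perm i')) :=
        fun h => lt_asymm hlt (hτ₁.2 _ _ h)
      refine .trans _ _ _ (congruent_exchange hi (eq_tree hT hτ ▸ harc))
        (ih _ (isLinearExtension_exchange hτ hi harc) ?_)
      have := sum_mul_lt_of_descent (fun x => τ₁.pos (τ.perm x)) hi hlt
      exact lt_of_lt_of_le h (by
        change _ ≤ ∑ x : Fin n, (x : ℕ) * τ₁.pos (τ.perm (Equiv.swap i i' x)) + d
        omega)

theorem proj_eq_of_isLinearExtension (R : Type*) [CommRing R] {n : ℕ} {T : PreTree n}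
    (hT : T.IsCambrian) {τ τ₁ : SignedPerm n} (hτ : T.IsLinearExtension τ)
    (hτ₁ : T.IsLinearExtension τ₁) : proj R (G R τ) = proj R (G R τ₁) := by
  rw [← sub_eq_zero, ← map_sub]
  exact proj_eq_zero R (Submodule.subset_span ⟨n, τ, τ₁, hT.congruent hτ hτ₁, rfl⟩)

theorem SignedPerm.isLinearExtension_tree {n : ℕ} (τ : SignedPerm n) :
    τ.tree.IsLinearExtension τ :=
  ⟨rfl, fun v w h => by
    have := nodeLev_lt h
    simp only [nodeLev] at this
    rw [Fin.lt_def]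
    exact Nat.lt_of_succ_lt_succ this⟩


namespace SignedPerm

variable {n : ℕ} {τ : SignedPerm n}

/-! ### Vertical paths -/

theorem reflTransGen_next {k l : ℕ} (hkl : k ≤ l) (hl : l ≤ n) (g : ℕ) :
    Relation.ReflTransGen τ.tree.Next (τ.strand k g) (τ.strand l g) := by
  induction l, hkl using Nat.le_induction with
  | base => exact .refl
  | succ l hkl ih =>
    obtain ⟨v, rfl⟩ := τ.exists_pos_eq hl
    have ih := ih (by omega)
    by_cases h : τ.Touch v g
    · rw [strand_succ_of_touch h]
      exact ih.tail ⟨_, v, arc_lowerSide h, lowerSide_node _ _ _, upperSide_node _ _ _⟩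
    · rwa [strand_succ_of_not_touch h]

theorem gapOf_vertex {g : ℕ} {t : InPort n} {v : Fin n} (hg : τ.GapOf g t)
    (ht : t.node = .vertex v) : τ.lev t = τ.pos v ∧ (g = v ∨ g = v + 1) := by
  cases t with
  | leaf i => cases ht
  | mid u | left u => cases ht; exact ⟨rfl, Or.inl hg⟩
  | right u => cases ht; exact ⟨rfl, Or.inr hg⟩

theorem lt_iff_of_gapOf_vertex {g : ℕ} {v w : Fin n} (hg : g = v ∨ g = v + 1) (hw : w ≠ v) :
    (w : ℕ) < g ↔ w < v := by
  have : (w : ℕ) ≠ v := fun h => hw (Fin.ext h)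
  rw [Fin.lt_def]
  omega

/-- Walking upwards from a down leaf does not cross the remaining negative walls. -/
theorem exists_strand_of_reflTransGen {g : ℕ} {o : OutPort n}
    (h : Relation.ReflTransGen τ.tree.Next (.leaf (letterCount τ.sign .minus g)) o)
    (ho : τ.tree.IsOutPort o) : ∃ k ≤ n, ∃ a, o = τ.strand k a ∧
      ∀ w, τ.sign w = .minus → k ≤ τ.pos w → ((w : ℕ) < g ↔ (w : ℕ) < a) := by
  induction h with
  | refl => exact ⟨0, Nat.zero_le n, g, rfl, fun _ _ _ => Iff.rfl⟩
  | @tail o₁ o₂ _ h ih =>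
    obtain ⟨t, v, hot, htv, ho₂⟩ := h
    obtain ⟨k, hk, a, rfl, ha⟩ := ih (τ.tree_isCambrian.isOutPort _ _ hot)
    obtain ⟨hkl, b, hb, -, hab⟩ := arc_strand hk hot
    obtain ⟨hlev, hb⟩ := gapOf_vertex hb htv
    obtain ⟨m, hm, c, rfl⟩ := exists_strand_eq ho
    obtain ⟨-, hc, he⟩ := strand_node_vertex hm ho₂
    refine ⟨τ.pos v + 1, τ.pos_lt v, c, by rw [he, strand_succ_of_touch hc], fun w hw hp => ?_⟩
    have hwv : w ≠ v := by rintro rfl; omega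
    rw [ha w hw (by omega), hab w (Or.inl ⟨hw, by omega⟩), lt_iff_of_gapOf_vertex hb hwv,
      hc w hwv (Or.inl ⟨hw, by omega⟩)]

/-- Walking downwards from an up leaf does not cross the positive walls already present. -/
theorem exists_strand_of_reflTransGen_leaf {g : ℕ} {o o' : OutPort n}
    (h : Relation.ReflTransGen τ.tree.Next o o')
    (ho' : τ.tree.arc o' (.leaf (letterCount τ.sign .plus g))) :
    ∃ t a, τ.tree.arc o t ∧ o = τ.strand (τ.lev t) a ∧
      ∀ w, τ.sign w = .plus → τ.pos w < τ.lev t → ((w : ℕ) < g ↔ (w : ℕ) < a) := by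
  induction h using Relation.ReflTransGen.head_induction_on with
  | refl =>
    obtain ⟨-, a, ha, rfl⟩ := id ho'
    exact ⟨_, a, ho', rfl, fun w hw _ => (letterCount_eq_iff.1 ha w hw).symm⟩
  | @head o₁ o₂ h _ ih =>
    obtain ⟨t, v, hot, htv, ho₂⟩ := h
    obtain ⟨t₂, a, -, rfl, ha⟩ := ih
    obtain ⟨hp, hta, -⟩ := strand_node_vertex (τ.lev_le t₂) ho₂
    obtain ⟨-, b, hb, rfl⟩ := id hot
    obtain ⟨hlev, hb⟩ := gapOf_vertex hb htv
    refine ⟨t, b, hot, rfl, fun w hw hpw => ?_⟩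
    rw [hlev] at hpw
    have hwv : w ≠ v := by rintro rfl; omega
    rw [ha w hw (by omega), hta w hwv (Or.inr ⟨hw, hpw⟩), lt_iff_of_gapOf_vertex hb hwv]

/-- Climbing from the down leaf respects the negative walls still standing, and descending from the
up leaf respects the positive ones. Together they pin down the strand of `g` at the level where the
arc is found. -/
theorem onPath_iff {g : ℕ} {o : OutPort n} :
    τ.tree.OnPath g o ↔ ∃ k ≤ n, τ.strand k g = o := by
  constructor
  · rintro ⟨h1, o', h2, h3⟩
    obtain ⟨t, b, hot, he, hb⟩ := exists_strand_of_reflTransGen_leaf h2 h3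
    obtain ⟨k, hk, a, rfl, ha⟩ :=
      exists_strand_of_reflTransGen h1 (τ.tree_isCambrian.isOutPort _ _ hot)
    have hkl := (arc_strand hk hot).1
    have he' := strand_eq_of_born_le hkl (τ.lev_le t) (he ▸ born_strand_le hk a)
    refine ⟨k, hk, (strand_eq_iff hk).2 fun w hw => ?_⟩
    have hab := (strand_eq_iff hk).1 (he.trans he') w hw
    rcases hw with ⟨hs, hp⟩ | ⟨hs, hp⟩
    · exact ha w hs hp
    · exact (hb w hs (hp.trans_le hkl)).trans hab.symm
  · rintro ⟨k, hk, rfl⟩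
    exact ⟨reflTransGen_next (Nat.zero_le k) hk g, _, reflTransGen_next hk le_rfl g, τ.arc_leaf g⟩

theorem onPath_strand_iff {k a g : ℕ} (hk : k ≤ n) :
    τ.tree.OnPath g (τ.strand k a) ↔ τ.Same k a g := by
  rw [onPath_iff]
  constructor
  · rintro ⟨l, hl, h⟩
    rcases le_total l k with hlk | hkl
    -- No vertex was attached to the strand of `a` between `l` and `k`, so a gap sharing it at level
    -- `l` still shares it at level `k`.
    · have h1 := strand_eq_of_born_le hlk hk (h ▸ born_strand_le hl g)
      have h2 : τ.Same l a g := (strand_eq_iff hl).1 (h1.symm.trans h.symm)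
      exact (strand_eq_iff hk).1 (strand_coalesce hlk hk h2 h1).symm
    · rw [strand_eq_of_born_le hkl hl (h ▸ born_strand_le hk a), eq_comm, strand_eq_iff hk] at h
      exact h
  · intro h
    exact ⟨k, hk, ((strand_eq_iff hk).2 h).symm⟩

/-! ### Multiplicities -/

variable {ι : Type} {E : Finset ι} {d : ι → ℕ}

theorem multOut_strand {k : ℕ} (hk : k ≤ n) (a : ℕ) :
    τ.tree.multOut (E.val.map d) (τ.strand k a) = (E.filter fun j => τ.Same k a (d j)).card := by
  rw [PreTree.multOut, Multiset.countP_map]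
  simp only [onPath_strand_iff hk]
  rfl

theorem multIn_eq_multOut {o : OutPort n} {t : InPort n} (h : τ.tree.arc o t) (Γ : Multiset ℕ) :
    τ.tree.multIn Γ t = τ.tree.multOut Γ o := by
  unfold PreTree.multIn PreTree.multOut
  congr 1
  funext g
  refine propext ⟨?_, fun hg => ⟨o, h, hg⟩⟩
  rintro ⟨o', h', hg⟩
  rwa [arc_in_unique h h']

theorem multOut_leaf (i : ℕ) : τ.tree.multOut (E.val.map d) (.leaf i) =
    (E.filter fun j => letterCount τ.sign .minus (d j) = i).card := by
  rw [PreTree.multOut, Multiset.countP_map]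
  have : ∀ g, τ.tree.OnPath g (.leaf i) ↔ letterCount τ.sign .minus g = i := by
    intro g
    rw [onPath_iff]
    constructor
    · rintro ⟨k, hk, h⟩; exact (strand_eq_leaf hk h).symm
    · rintro rfl; exact ⟨0, Nat.zero_le n, rfl⟩
  simp only [this]
  rfl

theorem multIn_leaf (i : ℕ) : τ.tree.multIn (E.val.map d) (.leaf i) =
    (E.filter fun j => letterCount τ.sign .plus (d j) = i).card := by
  rw [PreTree.multIn, Multiset.countP_map]
  have : ∀ g, (∃ o, τ.tree.arc o (.leaf i) ∧ τ.tree.OnPath g o) ↔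
      letterCount τ.sign .plus g = i := by
    intro g
    constructor
    · rintro ⟨_, ⟨-, a, ha, rfl⟩, h⟩
      have h : τ.Same n a g := (onPath_strand_iff le_rfl).1 h
      rw [← same_top_iff.1 h]
      exact ha
    · rintro rfl
      exact ⟨_, τ.arc_leaf g, (onPath_strand_iff le_rfl).2 (.refl τ n g)⟩
  simp only [this]
  rfl

/-- The numbering of the leaves of the cut forest: each earlier interval contributes one leaf, plus
one for each cut in it. -/
theorem sum_card_fiber_add_one (f : ι → ℕ) (i : ℕ) :
    ∑ i' ∈ Finset.range i, ((E.filter fun j => f j = i').card + 1) =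
      (E.filter fun j => f j < i).card + i := by
  induction i with
  | zero => simp
  | succ i ih =>
    rw [Finset.sum_range_succ, ih]
    have : (E.filter fun j => f j < i + 1) =
        (E.filter fun j => f j < i) ∪ E.filter fun j => f j = i := by
      rw [← Finset.filter_or]
      exact Finset.filter_congr fun j _ => by omega
    rw [this, Finset.card_union_of_disjoint]
    · omega
    · exact Finset.disjoint_filter.2 fun j _ h h' => by omega

/-! ### The strands of a cut tree -/

variable {c : ℕ} {B : ι → Prop}

/-- The gap `c`, to the right of the cuts in `B` and to the left of the other ones, is attached
to `v` after the cuts. -/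
def Attached (τ : SignedPerm n) (E : Finset ι) (d : ι → ℕ) (c : ℕ) (B : ι → Prop) (v : Fin n) :
    Prop := τ.Touch v c ∧ ∀ j ∈ E, (B j ↔ d j ≤ v)

/-- The port of the cut forest where the strand containing a gap starts. -/
noncomputable def cutStrand (τ : SignedPerm n) (E : Finset ι) (d : ι → ℕ) (c : ℕ)
    (B : ι → Prop) (k : ℕ) : OutPort n :=
  τ.sweep (τ.Attached E d c B) (.leaf (letterCount τ.sign .minus c + (E.filter B).card)) c k

/-- The number of the strand containing a gap among the parallel strands. -/
noncomputable def strandIndex (τ : SignedPerm n) (E : Finset ι) (d : ι → ℕ) (c : ℕ)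
    (B : ι → Prop) (k : ℕ) : ℕ := (E.filter fun j => B j ∧ τ.Same k c (d j)).card

theorem same_iff_of_touch {v : Fin n} {a : ℕ} (hc : τ.Touch v c) :
    (τ.sign v = .minus → (τ.Same (τ.pos v) c a ↔ τ.Touch v a ∧ (c ≤ v ↔ a ≤ v)) ∧
      (τ.Same (τ.pos v + 1) c a ↔ τ.Touch v a)) ∧
    (τ.sign v = .plus → (τ.Same (τ.pos v) c a ↔ τ.Touch v a) ∧
      (τ.Same (τ.pos v + 1) c a ↔ τ.Touch v a ∧ (c ≤ v ↔ a ≤ v))) := by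
  refine ⟨fun hs => ⟨⟨fun h => ?_, fun h => ?_⟩, ⟨fun h => ?_, fun h => ?_⟩⟩,
    fun hs => ⟨⟨fun h => ?_, fun h => ?_⟩, ⟨fun h => ?_, fun h => ?_⟩⟩⟩
  · have ha := hc.congr_of_same h
    exact ⟨ha, (same_of_touch_minus hs hc ha).1 h⟩
  · exact (same_of_touch_minus hs hc h.1).2 h.2
  · exact hc.congr_of_same_succ h
  · exact same_succ_of_touch_minus hs hc h
  · exact hc.congr_of_same h
  · exact same_of_touch_plus hs hc h
  · have ha := hc.congr_of_same_succ h
    exact ⟨ha, (same_succ_of_touch_plus hs hc ha).1 h⟩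
  · exact (same_succ_of_touch_plus hs hc h.1).2 h.2

/-- The cuts in `E` touching `v` on its left. -/
noncomputable def leftCuts (τ : SignedPerm n) (E : Finset ι) (d : ι → ℕ) (v : Fin n) : Finset ι :=
  E.filter fun j => τ.Touch v (d j) ∧ d j ≤ v

/-- The cuts in `E` touching `v` on its right. -/
noncomputable def rightCuts (τ : SignedPerm n) (E : Finset ι) (d : ι → ℕ) (v : Fin n) :
    Finset ι := E.filter fun j => τ.Touch v (d j) ∧ ¬ d j ≤ v

theorem multIn_left {v : Fin n} (hs : τ.sign v = .minus) :
    τ.tree.multIn (E.val.map d) (.left v) = (τ.leftCuts E d v).card := by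
  have h : τ.tree.arc (τ.strand (τ.pos v) v) (.left v) := ⟨hs, v, rfl, rfl⟩
  rw [multIn_eq_multOut h, multOut_strand (τ.pos_lt v).le, leftCuts]
  congr 1
  refine Finset.filter_congr fun j _ => ?_
  rw [((same_iff_of_touch (touch_self v)).1 hs).1]
  simp

theorem multIn_right {v : Fin n} (hs : τ.sign v = .minus) :
    τ.tree.multIn (E.val.map d) (.right v) = (τ.rightCuts E d v).card := by
  have h : τ.tree.arc (τ.strand (τ.pos v) (v + 1)) (.right v) := ⟨hs, v + 1, rfl, rfl⟩
  rw [multIn_eq_multOut h, multOut_strand (τ.pos_lt v).le, rightCuts]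
  congr 1
  refine Finset.filter_congr fun j _ => ?_
  rw [((same_iff_of_touch (touch_self_succ v)).1 hs).1]
  simp

theorem multOut_left {v : Fin n} (hs : τ.sign v = .plus) :
    τ.tree.multOut (E.val.map d) (.left v) = (τ.leftCuts E d v).card := by
  have : τ.strand (τ.pos v + 1) v = .left v := by
    rw [strand_succ_of_touch (touch_self v), hs]; simp [upperSide]
  rw [← this, multOut_strand (τ.pos_lt v), leftCuts]
  congr 1
  refine Finset.filter_congr fun j _ => ?_
  rw [((same_iff_of_touch (touch_self v)).2 hs).2]
  simp

theorem multOut_right {v : Fin n} (hs : τ.sign v = .plus) :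
    τ.tree.multOut (E.val.map d) (.right v) = (τ.rightCuts E d v).card := by
  have : τ.strand (τ.pos v + 1) (v + 1) = .right v := by
    rw [strand_succ_of_touch (touch_self_succ v), hs]; simp [upperSide]
  rw [← this, multOut_strand (τ.pos_lt v), rightCuts]
  congr 1
  refine Finset.filter_congr fun j _ => ?_
  rw [((same_iff_of_touch (touch_self_succ v)).2 hs).2]
  simp

/-! ### Cuts touching an inserted vertex -/

section counting

variable {v : Fin n}

theorem card_rightCuts_filter_le :
    ((τ.rightCuts E d v).filter B).card ≤ (τ.rightCuts E d v).card := Finset.card_filter_le _ _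

theorem card_touching_filter :
    (E.filter fun j => B j ∧ τ.Touch v (d j)).card =
      ((τ.leftCuts E d v).filter B).card + ((τ.rightCuts E d v).filter B).card := by
  rw [leftCuts, rightCuts, Finset.filter_filter, Finset.filter_filter,
    ← Finset.card_union_of_disjoint, ← Finset.filter_or]
  · congr 1
    exact Finset.filter_congr fun j _ => by tauto
  · exact Finset.disjoint_filter.2 fun j _ h h' => by tauto

theorem card_touching_side_filter :
    (E.filter fun j => B j ∧ τ.Touch v (d j) ∧ (c ≤ v ↔ d j ≤ v)).card =
      if c ≤ v then ((τ.leftCuts E d v).filter B).card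
      else ((τ.rightCuts E d v).filter B).card := by
  rw [leftCuts, rightCuts, Finset.filter_filter, Finset.filter_filter]
  split_ifs with h
  · congr 1
    exact Finset.filter_congr fun j _ => by tauto
  · congr 1
    exact Finset.filter_congr fun j _ => by tauto

/-- Below a negative vertex only the cuts on the side of the gap count; above it the groups coming
from the two children are side by side. This is the shift of indices in `Pass`, and the next lemma
is its mirror image. -/
theorem strandIndex_minus (hc : τ.Touch v c) (hs : τ.sign v = .minus) :
    τ.strandIndex E d c B (τ.pos v) = (if c ≤ v then ((τ.leftCuts E d v).filter B).card
      else ((τ.rightCuts E d v).filter B).card) ∧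
    τ.strandIndex E d c B (τ.pos v + 1) =
      ((τ.leftCuts E d v).filter B).card + ((τ.rightCuts E d v).filter B).card := by
  rw [← card_touching_side_filter, ← card_touching_filter]
  simp only [strandIndex, ((same_iff_of_touch hc).1 hs).1, ((same_iff_of_touch hc).1 hs).2, and_self]

theorem strandIndex_plus (hc : τ.Touch v c) (hs : τ.sign v = .plus) :
    τ.strandIndex E d c B (τ.pos v) =
      ((τ.leftCuts E d v).filter B).card + ((τ.rightCuts E d v).filter B).card ∧
    τ.strandIndex E d c B (τ.pos v + 1) = (if c ≤ v then ((τ.leftCuts E d v).filter B).card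
      else ((τ.rightCuts E d v).filter B).card) := by
  rw [← card_touching_side_filter, ← card_touching_filter]
  simp only [strandIndex, ((same_iff_of_touch hc).2 hs).1, ((same_iff_of_touch hc).2 hs).2, and_self]

theorem strandIndex_of_not_touch (hc : ¬ τ.Touch v c) :
    τ.strandIndex E d c B (τ.pos v + 1) = τ.strandIndex E d c B (τ.pos v) := by
  unfold strandIndex
  congr 1
  refine Finset.filter_congr fun j _ => and_congr_right fun _ => ?_
  by_cases hj : τ.Touch v (d j)
  · exact iff_of_false (fun h => hc (hj.congr_of_same_succ h.symm))
      (fun h => hc (hj.congr_of_same h.symm))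
  · exact same_succ_iff_of_not_touch hc hj



end counting

/-- An attached gap has all left cuts of `v` on its left and all right cuts on its right: its strand
is precisely the one that the cut leaves attached to `v`. -/
theorem card_cuts_of_attached {v : Fin n} (h : τ.Attached E d c B v) :
    ((τ.leftCuts E d v).filter B).card = (τ.leftCuts E d v).card ∧
      ((τ.rightCuts E d v).filter B).card = 0 := by
  rw [leftCuts, rightCuts, Finset.card_eq_zero, Finset.filter_filter, Finset.filter_filter]
  constructor
  · congr 1
    refine Finset.filter_congr fun j hj => ?_
    have := h.2 j hj
    tauto
  · refine Finset.filter_eq_empty_iff.2 fun j hj => ?_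
    have := h.2 j hj
    tauto

/-- The cuts in `B` are to the left of the gap `c` and the other ones are to its right. -/
def IsCutAt (E : Finset ι) (d : ι → ℕ) (c : ℕ) (B : ι → Prop) : Prop :=
  ∀ j ∈ E, (B j → d j ≤ c) ∧ (¬ B j → c ≤ d j)

theorem card_rightCuts_of_le (hB : IsCutAt E d c B) {v : Fin n} (hcv : c ≤ v) :
    ((τ.rightCuts E d v).filter B).card = 0 := by
  rw [rightCuts, Finset.card_eq_zero, Finset.filter_filter]
  refine Finset.filter_eq_empty_iff.2 fun j hj h => ?_
  have := (hB j hj).1 h.2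
  omega

theorem card_leftCuts_of_lt (hB : IsCutAt E d c B) {v : Fin n} (hcv : ¬ c ≤ v) :
    ((τ.leftCuts E d v).filter B).card = (τ.leftCuts E d v).card := by
  rw [Finset.filter_true_of_mem]
  intro j hj
  rw [leftCuts, Finset.mem_filter] at hj
  by_contra h
  have := (hB j hj.1).2 h
  omega

/-- A gap that touches `v` without being attached has a cut between itself and `v`. This cut also
touches `v`, and provides the strict inequalities required by `Pass`. -/
theorem card_cuts_of_not_attached (hB : IsCutAt E d c B) {v : Fin n} (hc : τ.Touch v c)
    (h : ¬ τ.Attached E d c B v) :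
    (c ≤ v → ((τ.leftCuts E d v).filter B).card < (τ.leftCuts E d v).card) ∧
      (¬ c ≤ v → 0 < ((τ.rightCuts E d v).filter B).card) := by
  unfold Attached at h
  push Not at h
  obtain ⟨j, hj, hjv⟩ := h hc
  rw [← not_le] at hjv
  have hBj := hB j hj
  have htouch : τ.Touch v (d j) := by
    intro w hw hw'
    have h1 := hc w hw hw'
    have h2 : (w : ℕ) ≠ v := fun e => hw (Fin.ext e)
    rw [Fin.lt_def] at h1 ⊢
    by_cases hb : B j
    · have := hBj.1 hb
      have : ¬ d j ≤ v := by tauto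
      omega
    · have := hBj.2 hb
      have : d j ≤ v := by tauto
      omega
  constructor
  · intro hcv
    have hb : ¬ B j := fun hb => by
      have := hBj.1 hb
      have : ¬ d j ≤ v := by tauto
      omega
    have hd : d j ≤ v := by tauto
    refine Finset.card_lt_card ⟨Finset.filter_subset _ _, fun hsub => ?_⟩
    exact hb (Finset.mem_filter.1 (hsub (Finset.mem_filter.2 ⟨hj, htouch, hd⟩))).2
  · intro hcv
    have hb : B j := by
      by_contra hb
      have := hBj.2 hb
      have : d j ≤ v := by tauto
      omega
    have hd : ¬ d j ≤ v := by tauto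
    exact Finset.card_pos.2 ⟨j, Finset.mem_filter.2 ⟨Finset.mem_filter.2 ⟨hj, htouch, hd⟩, hb⟩⟩

theorem cutStrand_succ (v : Fin n) : τ.cutStrand E d c B (τ.pos v + 1) =
    if τ.Attached E d c B v then upperSide (τ.sign v) v c else τ.cutStrand E d c B (τ.pos v) :=
  τ.sweep_pos_succ _ _ _ v

/-- The cuts left of `c` are those in earlier intervals together with those of `B` in the interval
of `c`. This gives the number of the leaf of the forest. -/
theorem card_filter_lt_add (hB : IsCutAt E d c B) (ε : Sgn) :
    (E.filter fun j => letterCount τ.sign ε (d j) < letterCount τ.sign ε c).card +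
      (E.filter fun j => B j ∧ letterCount τ.sign ε c = letterCount τ.sign ε (d j)).card =
        (E.filter B).card := by
  rw [← Finset.card_union_of_disjoint, ← Finset.filter_or]
  · congr 1
    refine Finset.filter_congr fun j hj => ?_
    constructor
    · rintro (h | h)
      · by_contra hb
        exact absurd (letterCount_mono ((hB j hj).2 hb)) (not_le.2 h)
      · exact h.1
    · intro hb
      rcases (letterCount_mono (sign := τ.sign) (ε := ε) ((hB j hj).1 hb)).lt_or_eq with h | h
      · exact Or.inl h
      · exact Or.inr ⟨hb, h.symm⟩
  · exact Finset.disjoint_filter.2 fun j _ h h' => by omega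

theorem arc_of_touch_le {v : Fin n} (hc : τ.Touch v c) (hs : τ.sign v = .minus) (hcv : c ≤ v) :
    τ.tree.arc (τ.strand (τ.pos v) c) (.left v) := by
  have := arc_lowerSide hc
  rwa [hs, lowerSide, if_pos hcv] at this

theorem arc_of_touch_lt {v : Fin n} (hc : τ.Touch v c) (hs : τ.sign v = .minus) (hcv : ¬ c ≤ v) :
    τ.tree.arc (τ.strand (τ.pos v) c) (.right v) := by
  have := arc_lowerSide hc
  rwa [hs, lowerSide, if_neg hcv] at this

theorem arc_of_touch_plus {v : Fin n} (hc : τ.Touch v c) (hs : τ.sign v = .plus) :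
    τ.tree.arc (τ.strand (τ.pos v) c) (.mid v) := by
  have := arc_lowerSide hc
  rwa [hs] at this

/-- Invariant of the sweep of the cut tree: from the port `cutStrand`, one arrives by passing along
vertices at the parallel strand containing the gap. At each level the strand is attached and
restarts at the vertex, touches the vertex and passes along it, or misses it altogether. -/
theorem exists_starts (hB : IsCutAt E d c B) {k : ℕ} (hk : k ≤ n) :
    ∃ a, τ.tree.Starts (E.val.map d) (τ.cutStrand E d c B k) a ∧
      Relation.ReflTransGen (τ.tree.Pass (E.val.map d)) a
        (τ.strand k c, τ.strandIndex E d c B k) := by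
  induction k with
  | zero =>
    refine ⟨_, ?_, .refl⟩
    have h0 : τ.strandIndex E d c B 0 = (E.filter fun j => B j ∧
        letterCount τ.sign .minus c = letterCount τ.sign .minus (d j)).card := by
      simp only [strandIndex, same_zero_iff]
    have hle : τ.strandIndex E d c B 0 ≤
        τ.tree.multOut (E.val.map d) (.leaf (letterCount τ.sign .minus c)) := by
      rw [h0, multOut_leaf]
      exact Finset.card_le_card (Finset.monotone_filter_right _ fun j _ h => h.2.symm)
    have hst := PreTree.Starts.leaf (T := τ.tree) (Γ := E.val.map d) hle
    simp only [multOut_leaf] at hst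
    rw [sum_card_fiber_add_one, add_right_comm, h0, card_filter_lt_add hB, add_comm, ← h0] at hst
    exact hst
  | succ k ih =>
    obtain ⟨v, rfl⟩ := τ.exists_pos_eq hk
    rw [cutStrand_succ]
    by_cases hc : τ.Touch v c
    · by_cases ha : τ.Attached E d c B v
      · rw [if_pos ha, strand_succ_of_touch hc]
        refine ⟨_, ?_, .refl⟩
        obtain ⟨hl, hr⟩ := card_cuts_of_attached ha
        rcases (τ.sign v).eq_minus_or_plus with hs | hs
        · rw [(strandIndex_minus hc hs).2, hl, hr, add_zero, ← multIn_left hs, hs]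
          exact .mid
        · rw [(strandIndex_plus hc hs).2, hl, hr, ← multOut_left hs, hs]
          simp only [upperSide]
          split_ifs
          · exact .left
          · exact .right
      · rw [if_neg ha]
        obtain ⟨a, ha1, ha2⟩ := ih (by omega)
        refine ⟨a, ha1, ha2.tail ?_⟩
        rw [strand_succ_of_touch hc]
        obtain ⟨hl, hr⟩ := card_cuts_of_not_attached hB hc ha
        rcases (τ.sign v).eq_minus_or_plus with hs | hs
        · rw [(strandIndex_minus hc hs).1, (strandIndex_minus hc hs).2, hs]
          by_cases hcv : c ≤ v
          · rw [if_pos hcv, card_rightCuts_of_le hB hcv, add_zero]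
            exact .fromLeft (arc_of_touch_le hc hs hcv) (by rw [multIn_left hs]; exact hl hcv)
          · rw [if_neg hcv, card_leftCuts_of_lt hB hcv, ← multIn_left hs]
            exact .fromRight (arc_of_touch_lt hc hs hcv) (hr hcv)
              (by rw [multIn_right hs]; exact card_rightCuts_filter_le)
        · rw [(strandIndex_plus hc hs).1, (strandIndex_plus hc hs).2, hs, upperSide]
          by_cases hcv : c ≤ v
          · rw [if_pos hcv, if_pos hcv, card_rightCuts_of_le hB hcv, add_zero]
            exact .toLeft (arc_of_touch_plus hc hs) (by rw [multOut_left hs]; exact hl hcv)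
          · rw [if_neg hcv, if_neg hcv, card_leftCuts_of_lt hB hcv, ← multOut_left hs]
            exact .toRight (arc_of_touch_plus hc hs) (hr hcv)
              (by rw [multOut_right hs]; exact card_rightCuts_filter_le)
    · rw [if_neg (fun h => hc h.1), strand_succ_of_not_touch hc, strandIndex_of_not_touch hc]
      exact ih (by omega)

theorem cut_arc_lowerSide (hB : IsCutAt E d c B) {v : Fin n} (hv : τ.Attached E d c B v) :
    (τ.tree.cut (E.val.map d)).arc (τ.cutStrand E d c B (τ.pos v))
      (lowerSide (τ.sign v) v c) := by
  obtain ⟨a, h1, h2⟩ := exists_starts (τ := τ) hB (τ.pos_lt v).le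
  refine ⟨a, _, h1, h2, ?_⟩
  have hc := hv.1
  obtain ⟨hl, hr⟩ := card_cuts_of_attached hv
  rcases (τ.sign v).eq_minus_or_plus with hs | hs
  · rw [(strandIndex_minus hc hs).1, hl, hr, hs, lowerSide]
    by_cases hcv : c ≤ v
    · rw [if_pos hcv, if_pos hcv, ← multIn_left hs]
      exact .left (arc_of_touch_le hc hs hcv)
    · rw [if_neg hcv, if_neg hcv]
      exact .right (arc_of_touch_lt hc hs hcv)
  · rw [(strandIndex_plus hc hs).1, hl, hr, add_zero, ← multOut_left hs, hs]
    exact .mid (arc_of_touch_plus hc hs)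

theorem cut_arc_leaf (hB : IsCutAt E d c B) :
    (τ.tree.cut (E.val.map d)).arc (τ.cutStrand E d c B n)
      (.leaf (letterCount τ.sign .plus c + (E.filter B).card)) := by
  obtain ⟨a, h1, h2⟩ := exists_starts (τ := τ) hB le_rfl
  refine ⟨a, _, h1, h2, ?_⟩
  have h0 : τ.strandIndex E d c B n = (E.filter fun j => B j ∧
      letterCount τ.sign .plus c = letterCount τ.sign .plus (d j)).card := by
    simp only [strandIndex, same_top_iff]
  have hle : τ.strandIndex E d c B n ≤
      τ.tree.multIn (E.val.map d) (.leaf (letterCount τ.sign .plus c)) := by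
    rw [h0, multIn_leaf]
    exact Finset.card_le_card (Finset.monotone_filter_right _ fun j _ h => h.2.symm)
  have hst := PreTree.Ends.leaf (T := τ.tree) (Γ := E.val.map d) (τ.arc_leaf c) hle
  simp only [multIn_leaf] at hst
  rw [sum_card_fiber_add_one, add_right_comm, h0, card_filter_lt_add hB, add_comm, ← h0] at hst
  exact hst

/-! ### The arcs of the cut forest are determined by their sources -/

/-- The leaf `i` of the tree becomes a block of `f i + 1` consecutive leaves, and these blocks are
disjoint. -/
theorem index_unique {f : ℕ → ℕ} {i i' k k' : ℕ} (hk : k ≤ f i) (hk' : k' ≤ f i')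
    (h : (∑ x ∈ Finset.range i, (f x + 1)) + k = (∑ x ∈ Finset.range i', (f x + 1)) + k') :
    i = i' ∧ k = k' := by
  have key : ∀ {i i' k k' : ℕ}, k ≤ f i →
      (∑ x ∈ Finset.range i, (f x + 1)) + k = (∑ x ∈ Finset.range i', (f x + 1)) + k' →
      ¬ i < i' := by
    intro i i' k k' hk h hlt
    have h1 : ∑ x ∈ Finset.range (i + 1), (f x + 1) ≤ ∑ x ∈ Finset.range i', (f x + 1) :=
      Finset.sum_le_sum_of_subset (Finset.range_subset_range.2 hlt)
    rw [Finset.sum_range_succ] at h1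
    omega
  have hii : i = i' := le_antisymm (not_lt.1 (key hk' h.symm)) (not_lt.1 (key hk h))
  subst hii
  exact ⟨rfl, by omega⟩

theorem starts_unique {T : PreTree n} {Γ : Multiset ℕ} {o : OutPort n} {a a' : OutPort n × ℕ}
    (h : T.Starts Γ o a) (h' : T.Starts Γ o a') : a = a' := by
  cases h with
  | leaf hk =>
    generalize hx : OutPort.leaf (n := n) _ = x at h'
    cases h' with
    | leaf hk' =>
      rw [OutPort.leaf.injEq] at hx
      obtain ⟨rfl, rfl⟩ := index_unique (f := fun i => T.multOut Γ (.leaf i)) hk hk' hx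
      rfl
    | mid => cases hx
    | left => cases hx
    | right => cases hx
  | mid => cases h'; rfl
  | left => cases h'; rfl
  | right => cases h'; rfl

/-- The arc from `o` has a single target, and at this target the ranges of indices passing on the
left and on the right are disjoint. The index left between them is that of the attached strand,
which is why `Ends` and `Pass` exclude each other below. -/
theorem pass_unique {Γ : Multiset ℕ} {a b b' : OutPort n × ℕ}
    (h : τ.tree.Pass Γ a b) (h' : τ.tree.Pass Γ a b') : b = b' := by
  obtain ⟨o, k⟩ := a
  generalize ha : (o, k) = a at h h'
  rcases h with ⟨h1, h2⟩ | ⟨h1, h2, h3⟩ | ⟨h1, h2⟩ | ⟨h1, h2, h3⟩ <;>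
    generalize ha' : (_, _) = a' at h' <;>
    rcases h' with ⟨h1', h2'⟩ | ⟨h1', h2', h3'⟩ | ⟨h1', h2'⟩ | ⟨h1', h2', h3'⟩ <;>
    rw [Prod.mk.injEq] at ha' <;> obtain ⟨rfl, ha'⟩ := ha' <;>
    cases arc_out_unique h1 h1' <;> first | (exfalso; omega) | skip
  · rw [ha']
  · rw [ha']
  · rw [ha']
  · rw [Nat.add_left_cancel ha']

theorem not_pass_of_ends {Γ : Multiset ℕ} {a b : OutPort n × ℕ} {t : InPort n}
    (h : τ.tree.Ends Γ a t) : ¬ τ.tree.Pass Γ a b := by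
  intro h'
  rcases h with ⟨h1, h2⟩ | h1 | h1 | h1 <;>
    generalize ha' : (_, _) = a' at h' <;>
    rcases h' with ⟨h1', h2'⟩ | ⟨h1', h2', h3'⟩ | ⟨h1', h2'⟩ | ⟨h1', h2', h3'⟩ <;>
    rw [Prod.mk.injEq] at ha' <;> obtain ⟨rfl, ha'⟩ := ha' <;>
    cases arc_out_unique h1 h1' <;> omega

theorem ends_unique {Γ : Multiset ℕ} {a : OutPort n × ℕ} {t t' : InPort n}
    (h : τ.tree.Ends Γ a t) (h' : τ.tree.Ends Γ a t') : t = t' := by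
  rcases h with ⟨h1, h2⟩ | h1 | h1 | h1 <;>
    generalize ha' : (_, _) = a' at h' <;>
    rcases h' with ⟨h1', h2'⟩ | h1' | h1' | h1' <;>
    rw [Prod.mk.injEq] at ha' <;> obtain ⟨rfl, ha'⟩ := ha' <;>
    cases arc_out_unique h1 h1' <;> first | rfl | rw [ha']

theorem cut_arc_unique {Γ : Multiset ℕ} {o : OutPort n} {t t' : InPort n}
    (h : (τ.tree.cut Γ).arc o t) (h' : (τ.tree.cut Γ).arc o t') : t = t' := by
  obtain ⟨a, b, h1, h2, h3⟩ := h
  obtain ⟨a', b', h1', h2', h3'⟩ := h'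
  cases starts_unique h1 h1'
  have hu : Relator.RightUnique (τ.tree.Pass Γ) := fun _ _ _ h h' => pass_unique h h'
  rcases Relation.ReflTransGen.total_of_right_unique hu h2 h2' with h | h
  · rcases h.cases_head with rfl | ⟨x, hx, -⟩
    · exact ends_unique h3 h3'
    · exact absurd hx (not_pass_of_ends h3)
  · rcases h.cases_head with rfl | ⟨x, hx, -⟩
    · exact ends_unique h3 h3'
    · exact absurd hx (not_pass_of_ends h3')

theorem exists_arc_of_cut_arc {Γ : Multiset ℕ} {o : OutPort n} {t : InPort n}
    (h : (τ.tree.cut Γ).arc o t) : ∃ a, τ.tree.Starts Γ o a ∧ τ.tree.IsOutPort a.1 := by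
  obtain ⟨a, b, h1, h2, h3⟩ := h
  refine ⟨a, h1, ?_⟩
  suffices ∃ t, τ.tree.arc a.1 t from this.elim fun t h => τ.tree_isCambrian.isOutPort _ _ h
  rcases h2.cases_head with rfl | ⟨x, hx, -⟩
  · cases h3 <;> exact ⟨_, ‹_›⟩
  · cases hx <;> exact ⟨_, ‹_›⟩

/-- Each cut adds one down leaf. The bound ensures that a leaf starting an arc of the glued tree
exists for the shuffled signature. -/
theorem le_of_cut_arc_leaf {i : ℕ} {t : InPort n}
    (h : (τ.tree.cut (E.val.map d)).arc (.leaf i) t) :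
    i ≤ letterCount τ.sign .minus n + E.card := by
  obtain ⟨a, h1, h2⟩ := exists_arc_of_cut_arc h
  cases h1 with
  | @leaf j k hk =>
    have h2 : j ≤ letterCount τ.sign .minus n := h2
    have h3 : (∑ x ∈ Finset.range j, (τ.tree.multOut (E.val.map d) (.leaf x) + 1)) + k + 1 ≤
        ∑ x ∈ Finset.range (j + 1), (τ.tree.multOut (E.val.map d) (.leaf x) + 1) := by
      rw [Finset.sum_range_succ]
      omega
    simp only [multOut_leaf] at h3 ⊢
    rw [sum_card_fiber_add_one (i := j + 1)] at h3
    have h4 := Finset.card_filter_le E fun x => letterCount τ.sign .minus (d x) < j + 1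
    omega

theorem isOutPort_of_cut_arc {Γ : Multiset ℕ} {o : OutPort n} {t : InPort n}
    (h : (τ.tree.cut Γ).arc o t) (ho : ∀ i, o ≠ .leaf i) : τ.tree.IsOutPort o := by
  obtain ⟨a, h1, h2⟩ := exists_arc_of_cut_arc h
  cases h1 with
  | leaf => exact absurd rfl (ho _)
  | mid | left | right => exact h2

end SignedPerm


/-! ### Gluing the trees of two signed permutations -/

/-- For a strictly increasing `f`, the values below `g` come from an initial segment. Its length is
the gap of the subword that corresponds to `g`. -/
theorem lt_card_filter_lt_iff {m : ℕ} {f : Fin m → ℕ} (hf : StrictMono f) (v : Fin m) (g : ℕ) :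
    (v : ℕ) < (Finset.univ.filter fun i => f i < g).card ↔ f v < g := by
  constructor
  · intro h
    by_contra hc
    have : (Finset.univ.filter fun i => f i < g) ⊆ Finset.Iio v := fun i hi => by
      simp only [Finset.mem_filter, Finset.mem_univ, true_and] at hi
      exact Finset.mem_Iio.2 (hf.lt_iff_lt.1 (hi.trans_le (not_lt.1 hc)))
    have := Finset.card_le_card this
    rw [Fin.card_Iio] at this
    omega
  · intro h
    have : Finset.Iic v ⊆ (Finset.univ.filter fun i => f i < g) := fun i hi => by
      simp only [Finset.mem_filter, Finset.mem_univ, true_and]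
      exact (hf.monotone (Finset.mem_Iic.1 hi)).trans_lt h
    have := Finset.card_le_card this
    rw [Fin.card_Iic] at this
    omega

/-! ### Gaps and letters of a shuffle -/

namespace Shuffle

variable {n n' : ℕ} (s : Shuffle n n')

theorem fst_strictMono : StrictMono fun i => (s.fst i : ℕ) := s.2.1

theorem snd_strictMono : StrictMono fun i => (s.snd i : ℕ) := s.2.2

theorem fst_ne_snd (i : Fin n) (j : Fin n') : s.fst i ≠ s.snd j := by
  intro h
  have := congrArg Fin.val (s.1.injective h)
  rw [Fin.val_castAdd, Fin.val_natAdd] at this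
  omega

theorem exists_eq (w : Fin (n + n')) : (∃ i, w = s.fst i) ∨ ∃ j, w = s.snd j := by
  obtain ⟨x, rfl⟩ := s.1.surjective w
  induction x using Fin.addCases with
  | left i => exact Or.inl ⟨i, rfl⟩
  | right j => exact Or.inr ⟨j, rfl⟩

/-- The gap of the first word that corresponds to a gap of the shuffle. -/
noncomputable def fstGap (g : ℕ) : ℕ := (Finset.univ.filter fun i => (s.fst i : ℕ) < g).card

/-- The gap of the second word that corresponds to a gap of the shuffle. -/
noncomputable def sndGap (g : ℕ) : ℕ := (Finset.univ.filter fun j => (s.snd j : ℕ) < g).card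

theorem lt_fstGap_iff (v : Fin n) (g : ℕ) : (v : ℕ) < s.fstGap g ↔ (s.fst v : ℕ) < g :=
  lt_card_filter_lt_iff s.fst_strictMono v g

theorem lt_sndGap_iff (v : Fin n') (g : ℕ) : (v : ℕ) < s.sndGap g ↔ (s.snd v : ℕ) < g :=
  lt_card_filter_lt_iff s.snd_strictMono v g

theorem fstGap_le_iff (v : Fin n) (g : ℕ) : s.fstGap g ≤ v ↔ g ≤ s.fst v := by
  rw [← not_lt, lt_fstGap_iff, not_lt]

theorem sndGap_le_iff (v : Fin n') (g : ℕ) : s.sndGap g ≤ v ↔ g ≤ s.snd v := by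
  rw [← not_lt, lt_sndGap_iff, not_lt]

theorem fstGap_mono {a b : ℕ} (h : a ≤ b) : s.fstGap a ≤ s.fstGap b :=
  Finset.card_le_card (Finset.monotone_filter_right _ fun _ _ h' => lt_of_lt_of_le h' h)

theorem sndGap_mono {a b : ℕ} (h : a ≤ b) : s.sndGap a ≤ s.sndGap b :=
  Finset.card_le_card (Finset.monotone_filter_right _ fun _ _ h' => lt_of_lt_of_le h' h)

theorem fstGap_total : s.fstGap (n + n') = n := by
  rw [fstGap, Finset.filter_true_of_mem fun i _ => (s.fst i).2, Finset.card_univ,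
    Fintype.card_fin]

theorem sndGap_total : s.sndGap (n + n') = n' := by
  rw [sndGap, Finset.filter_true_of_mem fun i _ => (s.snd i).2, Finset.card_univ,
    Fintype.card_fin]

/-- The letter `i` of the first word is to the left of the gap `g` of the shuffle. -/
def FstBefore (g : ℕ) (i : Fin n) : Prop := (s.fst i : ℕ) < g

/-- The letter `j` of the second word is to the left of the gap `g` of the shuffle. -/
def SndBefore (g : ℕ) (j : Fin n') : Prop := (s.snd j : ℕ) < g

variable (ε : Fin n → Sgn) (ε' : Fin n' → Sgn)

theorem word_fst (i : Fin n) : s.word ε ε' (s.fst i) = ε i := by simp [word, fst]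

theorem word_snd (j : Fin n') : s.word ε ε' (s.snd j) = ε' j := by simp [word, snd]

theorem letterCount_word (x : Sgn) (g : ℕ) : letterCount (s.word ε ε') x g =
    letterCount ε x (s.fstGap g) + letterCount ε' x (s.sndGap g) := by
  simp only [letterCount, lt_fstGap_iff, lt_sndGap_iff, Finset.card_filter]
  rw [← Equiv.sum_comp s.1, Fin.sum_univ_add]
  congr 1
  · refine Finset.sum_congr rfl fun i _ => ?_
    rw [← s.word_fst ε ε' i]; rfl
  · refine Finset.sum_congr rfl fun i _ => ?_
    rw [← s.word_snd ε ε' i]; rfl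

/-- The cuts of the first tree. -/
noncomputable def lowerCuts (ε' : Fin n' → Sgn) : Finset (Fin n') :=
  Finset.univ.filter fun j => ε' j = .minus

/-- The cuts of the second tree. -/
noncomputable def upperCuts (ε : Fin n → Sgn) : Finset (Fin n) :=
  Finset.univ.filter fun i => ε i = .plus

theorem lowerGaps_eq : lowerGaps s ε' = (lowerCuts ε').val.map fun j => s.fstGap (s.snd j) := rfl

theorem upperGaps_eq : upperGaps s ε = (upperCuts ε).val.map fun i => s.sndGap (s.fst i) := rfl

theorem isCutAt_lower (g : ℕ) : SignedPerm.IsCutAt (lowerCuts ε') (fun j => s.fstGap (s.snd j))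
    (s.fstGap g) (s.SndBefore g) :=
  fun _ _ => ⟨fun h => s.fstGap_mono (le_of_lt h), fun h => s.fstGap_mono (not_lt.1 h)⟩

theorem isCutAt_upper (g : ℕ) : SignedPerm.IsCutAt (upperCuts ε) (fun i => s.sndGap (s.fst i))
    (s.sndGap g) (s.FstBefore g) :=
  fun _ _ => ⟨fun h => s.sndGap_mono (le_of_lt h), fun h => s.sndGap_mono (not_lt.1 h)⟩

theorem card_lowerCuts_filter (g : ℕ) :
    ((lowerCuts ε').filter (s.SndBefore g)).card =
      letterCount ε' .minus (s.sndGap g) := by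
  rw [lowerCuts, Finset.filter_filter, letterCount]
  congr 1
  exact Finset.filter_congr fun j _ => by rw [lt_sndGap_iff, and_comm, SndBefore]

theorem card_upperCuts_filter (g : ℕ) :
    ((upperCuts ε).filter (s.FstBefore g)).card =
      letterCount ε .plus (s.fstGap g) := by
  rw [upperCuts, Finset.filter_filter, letterCount]
  congr 1
  exact Finset.filter_congr fun j _ => by rw [lt_fstGap_iff, and_comm, FstBefore]

theorem card_lowerCuts (ε' : Fin n' → Sgn) : (lowerCuts ε').card = letterCount ε' .minus n' := by
  rw [lowerCuts, letterCount]
  congr 1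
  exact Finset.filter_congr fun j _ => by simp

end Shuffle

theorem OutPort.map_injective {n m : ℕ} {f : Fin n → Fin m} (hf : Function.Injective f) :
    Function.Injective (OutPort.map f) := by
  intro o o' h
  cases o <;> cases o' <;> simp_all [OutPort.map, hf.eq_iff]

theorem upperSide_map {n m : ℕ} {f : Fin n → Fin m} {ε : Sgn} {v : Fin n} {a b : ℕ}
    (h : a ≤ v ↔ b ≤ f v) : (upperSide ε v a).map f = upperSide ε (f v) b := by
  unfold upperSide
  cases ε
  · rfl
  · simp only [h]
    split_ifs <;> rfl

theorem lowerSide_map {n m : ℕ} {f : Fin n → Fin m} {ε : Sgn} {v : Fin n} {a b : ℕ}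
    (h : a ≤ v ↔ b ≤ f v) : (lowerSide ε v a).map f = lowerSide ε (f v) b := by
  unfold lowerSide
  cases ε
  · simp only [h]
    split_ifs <;> rfl
  · rfl

theorem lowerSide_ne_leaf {n : ℕ} (ε : Sgn) (v : Fin n) (g j : ℕ) :
    lowerSide ε v g ≠ .leaf j := by
  intro h
  have := lowerSide_node ε v g
  rw [h] at this
  cases this

/-! ### The sweep of a convolution -/

section conv

open Shuffle SignedPerm

variable {n n' : ℕ} (s : Shuffle n n') (τ : SignedPerm n) (τ' : SignedPerm n')

theorem conv_sign_fst (i : Fin n) : (conv s τ τ').sign (s.fst i) = τ.sign i := s.word_fst _ _ i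

theorem conv_sign_snd (j : Fin n') : (conv s τ τ').sign (s.snd j) = τ'.sign j := s.word_snd _ _ j

theorem conv_pos_fst (v : Fin n) : (conv s τ τ').pos (s.fst v) = τ.pos v := by
  obtain ⟨x, rfl⟩ := τ.perm.surjective v
  rw [← conv_perm_castAdd s τ τ', pos_perm, pos_perm, Fin.val_castAdd]

theorem conv_pos_snd (v : Fin n') : (conv s τ τ').pos (s.snd v) = n + τ'.pos v := by
  obtain ⟨x, rfl⟩ := τ'.perm.surjective v
  rw [← conv_perm_natAdd s τ τ', pos_perm, pos_perm, Fin.val_natAdd]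

/-- The strand of the gap `g` after the cut of the first tree. -/
noncomputable def lowerStrand (g k : ℕ) : OutPort n :=
  τ.cutStrand (lowerCuts τ'.sign) (fun j => s.fstGap (s.snd j)) (s.fstGap g)
    (s.SndBefore g) k

/-- The strand of the gap `g` after the cut of the second tree. -/
noncomputable def upperStrand (g k : ℕ) : OutPort n' :=
  τ'.cutStrand (upperCuts τ.sign) (fun i => s.sndGap (s.fst i)) (s.sndGap g)
    (s.FstBefore g) k

/-- During the first `n` insertions no letter of `τ'` is present yet, so exactly its negative
letters are walls. They stand at the cuts of the first tree and turn touching into being attached.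
-/
theorem touch_fst_iff (v : Fin n) (g : ℕ) : (conv s τ τ').Touch (s.fst v) g ↔
    τ.Attached (lowerCuts τ'.sign) (fun j => s.fstGap (s.snd j)) (s.fstGap g)
      (s.SndBefore g) v := by
  have hfst : ∀ u, (conv s τ τ').Wall ((conv s τ τ').pos (s.fst v)) (s.fst u) ↔
      τ.Wall (τ.pos v) u := fun u => by
    rw [Wall, Wall, conv_pos_fst, conv_pos_fst, conv_sign_fst]
  have hsnd : ∀ j, (conv s τ τ').Wall ((conv s τ τ').pos (s.fst v)) (s.snd j) ↔
      j ∈ lowerCuts τ'.sign := fun j => by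
    rw [Wall, conv_pos_fst, conv_pos_snd, conv_sign_snd, lowerCuts, Finset.mem_filter]
    have := τ.pos_lt v
    constructor
    · rintro (h | h)
      · exact ⟨Finset.mem_univ _, h.1⟩
      · omega
    · exact fun h => Or.inl ⟨h.2, by omega⟩
  have hlt : ∀ u : Fin n, s.fst u < s.fst v ↔ u < v := fun u => s.fst_strictMono.lt_iff_lt
  have hle : ∀ j, s.snd j < s.fst v ↔ s.fstGap (s.snd j) ≤ v := fun j => by
    rw [← not_lt, lt_fstGap_iff, ← Fin.lt_def, not_lt]
    exact ⟨le_of_lt, fun h => lt_of_le_of_ne h (s.fst_ne_snd v j).symm⟩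
  constructor
  · intro h
    refine ⟨fun u hu hw => ?_, fun j hj => ?_⟩
    · have := h (s.fst u) (fun e => hu (s.fst_strictMono.injective (congrArg Fin.val e)))
        ((hfst u).2 hw)
      rwa [← lt_fstGap_iff, hlt] at this
    · have := h (s.snd j) (s.fst_ne_snd v j).symm ((hsnd j).2 hj)
      rwa [hle] at this
  · rintro ⟨h1, h2⟩ w hw hwall
    rcases s.exists_eq w with ⟨u, rfl⟩ | ⟨j, rfl⟩
    · rw [← lt_fstGap_iff, hlt]
      exact h1 u (fun e => hw (e ▸ rfl)) ((hfst u).1 hwall)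
    · rw [hle]
      exact h2 j ((hsnd j).1 hwall)

/-- During the last `n'` insertions all letters of `τ` are present, so exactly its positive letters
are walls. They stand at the cuts of the second tree. -/
theorem touch_snd_iff (v : Fin n') (g : ℕ) : (conv s τ τ').Touch (s.snd v) g ↔
    τ'.Attached (upperCuts τ.sign) (fun i => s.sndGap (s.fst i)) (s.sndGap g)
      (s.FstBefore g) v := by
  have hsnd : ∀ u, (conv s τ τ').Wall ((conv s τ τ').pos (s.snd v)) (s.snd u) ↔
      τ'.Wall (τ'.pos v) u := fun u => by
    rw [Wall, Wall, conv_pos_snd, conv_pos_snd, conv_sign_snd, add_le_add_iff_left,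
      add_lt_add_iff_left]
  have hfst : ∀ i, (conv s τ τ').Wall ((conv s τ τ').pos (s.snd v)) (s.fst i) ↔
      i ∈ upperCuts τ.sign := fun i => by
    rw [Wall, conv_pos_fst, conv_pos_snd, conv_sign_fst, upperCuts, Finset.mem_filter]
    have := τ.pos_lt i
    constructor
    · rintro (h | h)
      · omega
      · exact ⟨Finset.mem_univ _, h.1⟩
    · exact fun h => Or.inr ⟨h.2, by omega⟩
  have hlt : ∀ u : Fin n', s.snd u < s.snd v ↔ u < v := fun u => s.snd_strictMono.lt_iff_lt
  have hle : ∀ i, s.fst i < s.snd v ↔ s.sndGap (s.fst i) ≤ v := fun i => by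
    rw [← not_lt, lt_sndGap_iff, ← Fin.lt_def, not_lt]
    exact ⟨le_of_lt, fun h => lt_of_le_of_ne h (s.fst_ne_snd i v)⟩
  constructor
  · intro h
    refine ⟨fun u hu hw => ?_, fun i hi => ?_⟩
    · have := h (s.snd u) (fun e => hu (s.snd_strictMono.injective (congrArg Fin.val e)))
        ((hsnd u).2 hw)
      rwa [← lt_sndGap_iff, hlt] at this
    · have := h (s.fst i) (s.fst_ne_snd i v) ((hfst i).2 hi)
      rwa [hle] at this
  · rintro ⟨h1, h2⟩ w hw hwall
    rcases s.exists_eq w with ⟨i, rfl⟩ | ⟨u, rfl⟩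
    · rw [hle]
      exact h2 i ((hfst i).1 hwall)
    · rw [← lt_sndGap_iff, hlt]
      exact h1 u (fun e => hw (e ▸ rfl)) ((hsnd u).1 hwall)

theorem strand_conv_lower (g : ℕ) {k : ℕ} (hk : k ≤ n) :
    (conv s τ τ').strand k g = (lowerStrand s τ τ' g k).map s.fst := by
  induction k with
  | zero =>
    rw [strand_zero, conv, letterCount_word, ← card_lowerCuts_filter]
    rfl
  | succ k ih =>
    obtain ⟨v, rfl⟩ := τ.exists_pos_eq hk
    rw [lowerStrand, cutStrand_succ]
    split_ifs with h <;> rw [← touch_fst_iff] at h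
    · rw [upperSide_map (s.fstGap_le_iff v g), ← conv_pos_fst s τ τ', strand_succ_of_touch h,
        conv_sign_fst]
    · rw [← conv_pos_fst s τ τ', strand_succ_of_not_touch h, conv_pos_fst, ih (by omega)]
      rfl

/-- Above level `n` a strand either has met no vertex of the second tree, in which case it continues
the lower strand through the leaf with the displayed number, or already starts at such a vertex.
That number counts the positive letters of `τ` and the negative letters of `τ'` left of the gap; it
is also that of the up leaf reached in the lower forest. -/
theorem strand_conv_upper (g : ℕ) {k : ℕ} (hk : k ≤ n') :
    (upperStrand s τ τ' g k = .leaf (letterCount τ.sign .plus (s.fstGap g) +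
        letterCount τ'.sign .minus (s.sndGap g)) ∧
      (conv s τ τ').strand (n + k) g = (conv s τ τ').strand n g) ∨
    ((∀ i, upperStrand s τ τ' g k ≠ .leaf i) ∧
      (conv s τ τ').strand (n + k) g = (upperStrand s τ τ' g k).map s.snd) := by
  induction k with
  | zero =>
    refine Or.inl ⟨?_, rfl⟩
    rw [← card_upperCuts_filter, add_comm]
    rfl
  | succ k ih =>
    obtain ⟨v, rfl⟩ := τ'.exists_pos_eq hk
    have hp : n + (τ'.pos v + 1) = (conv s τ τ').pos (s.snd v) + 1 := by
      rw [conv_pos_snd, add_assoc]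
    rw [upperStrand, cutStrand_succ, hp]
    split_ifs with h <;> rw [← touch_snd_iff] at h
    · refine Or.inr ⟨fun i hi => ?_, ?_⟩
      · have := upperSide_node (τ'.sign v) v (s.sndGap g)
        rw [hi] at this
        cases this
      · rw [upperSide_map (s.sndGap_le_iff v g), strand_succ_of_touch h, conv_sign_snd]
    · rw [strand_succ_of_not_touch h, conv_pos_snd]
      exact ih (by omega)

theorem glue_arc_of_arc {o : OutPort (n + n')} {t : InPort (n + n')}
    (h : (conv s τ τ').tree.arc o t) : (glue s τ.tree τ'.tree).arc o t := by
  change ConnectArc s (τ.tree.cut (lowerGaps s τ'.sign)) (τ'.tree.cut (upperGaps s τ.sign)) o t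
  rw [lowerGaps_eq, upperGaps_eq]
  have hleaf : ∀ g, (τ.tree.cut ((lowerCuts τ'.sign).val.map fun j => s.fstGap (s.snd j))).arc
      (lowerStrand s τ τ' g n) (.leaf (letterCount τ.sign .plus (s.fstGap g) +
        letterCount τ'.sign .minus (s.sndGap g))) := fun g => by
    have := cut_arc_leaf (τ := τ) (s.isCutAt_lower τ'.sign g)
    rwa [card_lowerCuts_filter] at this
  have hconn : ∀ (g k : ℕ) (hk : k ≤ n') (t : InPort n'),
      (τ'.tree.cut ((upperCuts τ.sign).val.map fun i => s.sndGap (s.fst i))).arc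
        (upperStrand s τ τ' g k) t →
      ConnectArc s (τ.tree.cut ((lowerCuts τ'.sign).val.map fun j => s.fstGap (s.snd j)))
        (τ'.tree.cut ((upperCuts τ.sign).val.map fun i => s.sndGap (s.fst i)))
        ((conv s τ τ').strand (n + k) g) (t.map s.snd) := by
    intro g k hk t ht
    rcases strand_conv_upper s τ τ' g hk with ⟨h1, h2⟩ | ⟨h1, h2⟩
    · rw [h2, strand_conv_lower s τ τ' g le_rfl]
      exact .across (hleaf g) (h1 ▸ ht)
    · rw [h2]
      exact .upper ht h1
  rcases arc_cases h with ⟨w, g, hw, rfl, rfl, -⟩ | ⟨g, rfl, rfl⟩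
  · rcases s.exists_eq w with ⟨v, rfl⟩ | ⟨v, rfl⟩
    · rw [conv_pos_fst, strand_conv_lower s τ τ' g (τ.pos_lt v).le, conv_sign_fst,
        ← lowerSide_map (s.fstGap_le_iff v g)]
      exact .lower (cut_arc_lowerSide (s.isCutAt_lower τ'.sign g) ((touch_fst_iff s τ τ' v g).1 hw))
        (lowerSide_ne_leaf _ _ _)
    · rw [conv_pos_snd, conv_sign_snd, ← lowerSide_map (s.sndGap_le_iff v g)]
      exact hconn g _ (τ'.pos_lt v).le _
        (cut_arc_lowerSide (s.isCutAt_upper τ.sign g) ((touch_snd_iff s τ τ' v g).1 hw))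
  · have := cut_arc_leaf (τ := τ') (s.isCutAt_upper τ.sign g)
    rw [card_upperCuts_filter] at this
    have := hconn g n' le_rfl _ this
    rwa [InPort.map, add_comm (letterCount _ _ _), ← letterCount_word] at this

theorem glue_arc_unique {o : OutPort (n + n')} {t t' : InPort (n + n')}
    (h : (glue s τ.tree τ'.tree).arc o t) (h' : (glue s τ.tree τ'.tree).arc o t') : t = t' := by
  have hi : Function.Injective s.fst := fun a b e =>
    s.fst_strictMono.injective (congrArg Fin.val e)
  have hi' : Function.Injective s.snd := fun a b e =>
    s.snd_strictMono.injective (congrArg Fin.val e)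
  -- Relabelling forgets to which tree a leaf belongs, so the leaves of the upper tree have to be
  -- excluded.
  have hne : ∀ {a : OutPort n} {b : OutPort n'}, (∀ j, b ≠ .leaf j) →
      a.map s.fst ≠ b.map s.snd := by
    intro a b hb e
    cases a <;> cases b <;> simp_all [OutPort.map, s.fst_ne_snd]
  change ConnectArc _ _ _ _ _ at h h'
  generalize ho : o = o₁ at h'
  rcases h with ⟨h1, h2⟩ | ⟨h1, h2⟩ | ⟨h1, h2⟩ <;>
    rcases h' with ⟨h1', h2'⟩ | ⟨h1', h2'⟩ | ⟨h1', h2'⟩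
  · cases OutPort.map_injective hi ho
    rw [cut_arc_unique h1 h1']
  · cases OutPort.map_injective hi ho
    exact absurd (cut_arc_unique h1 h1') (h2 _)
  · exact absurd ho (hne h2')
  · cases OutPort.map_injective hi ho
    exact absurd (cut_arc_unique h1' h1) (h2' _)
  · cases OutPort.map_injective hi ho
    cases cut_arc_unique h1 h1'
    rw [cut_arc_unique h2 h2']
  · exact absurd ho (hne h2')
  · exact absurd ho.symm (hne h2)
  · exact absurd ho.symm (hne h2)
  · cases OutPort.map_injective hi' ho
    rw [cut_arc_unique h1 h1']

theorem isOutPort_of_glue_arc {o : OutPort (n + n')} {t : InPort (n + n')}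
    (h : (glue s τ.tree τ'.tree).arc o t) : (conv s τ τ').tree.IsOutPort o := by
  have hlow : ∀ {o : OutPort n} {t : InPort n},
      (τ.tree.cut (lowerGaps s τ'.sign)).arc o t →
      (conv s τ τ').tree.IsOutPort (o.map s.fst) := by
    intro o t h
    rcases o with i | v | v | v
    · rw [lowerGaps_eq] at h
      have := le_of_cut_arc_leaf h
      change i ≤ letterCount (s.word τ.sign τ'.sign) .minus (n + n')
      rwa [letterCount_word, fstGap_total, sndGap_total, ← card_lowerCuts τ'.sign]
    all_goals
      have := isOutPort_of_cut_arc h (by simp)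
      exact (conv_sign_fst s τ τ' v).trans this
  change ConnectArc _ _ _ _ _ at h
  rcases h with ⟨h1, -⟩ | ⟨h1, -⟩ | ⟨h1, h2⟩
  · exact hlow h1
  · exact hlow h1
  · have := isOutPort_of_cut_arc h1 h2
    rename_i o _
    rcases o with i | v | v | v
    · exact absurd rfl (h2 i)
    all_goals exact (conv_sign_snd s τ τ' v).trans this

/-- One inclusion of arcs suffices, as in `eq_tree`: an arc of the glued tree starts at a port where
the tree of the convolution also has an arc, and the glued tree has at most one arc there. -/
theorem glue_tree : glue s τ.tree τ'.tree = (conv s τ τ').tree := by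
  have harc : (glue s τ.tree τ'.tree).arc = (conv s τ τ').tree.arc := by
    funext o t
    refine propext ⟨fun h => ?_, glue_arc_of_arc s τ τ'⟩
    obtain ⟨t', ht', -⟩ :=
      (conv s τ τ').tree_isCambrian.out_unique o (isOutPort_of_glue_arc s τ τ' h)
    rwa [glue_arc_unique s τ τ' h (glue_arc_of_arc s τ τ' ht')]
  have hsign : (glue s τ.tree τ'.tree).sign = (conv s τ τ').tree.sign := rfl
  generalize glue s τ.tree τ'.tree = A at *
  generalize (conv s τ τ').tree = A' at *
  cases A; cases A'
  cases harc; cases hsign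
  rfl

end conv

end Cambrian

/-! ### The product formula -/

theorem mainTheorem4 (R : Type*) [CommRing R] {n n' : ℕ}
    (T : CambrianTree n) (T' : CambrianTree n') :
    (∀ τ : SignedPerm n, T.IsLinearExtension τ → proj R (G R τ) = Q R T) ∧
    ∃ h : ∀ s : Shuffle n n', (glue s T.toPreTree T'.toPreTree).IsCambrian,
      Q R T * Q R T' = ∑ s : Shuffle n n', Q R ⟨glue s T.toPreTree T'.toPreTree, h s⟩ := by
  have hQ : ∀ {m : ℕ} (T : CambrianTree m) (τ : SignedPerm m), T.IsLinearExtension τ →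
      proj R (G R τ) = Q R T := fun T τ hτ =>
    proj_eq_of_isLinearExtension R T.isCambrian hτ T.exists_isLinearExtension.choose_spec
  obtain ⟨τ, hτ⟩ := T.exists_isLinearExtension
  obtain ⟨τ', hτ'⟩ := T'.exists_isLinearExtension
  -- Both factors are the trees of their chosen linear extensions, so gluing becomes convolution and
  -- `conv s τ τ'` is a linear extension of the glued tree.
  have hglue : ∀ s : Shuffle n n', glue s T.toPreTree T'.toPreTree = (conv s τ τ').tree := by
    intro s
    rw [SignedPerm.eq_tree T.isCambrian hτ, SignedPerm.eq_tree T'.isCambrian hτ', glue_tree]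
  refine ⟨hQ T, fun s => (hglue s).symm ▸ (conv s τ τ').tree_isCambrian, ?_⟩
  rw [← hQ T τ hτ, ← hQ T' τ' hτ', ← proj_mul, G_mul_G, map_sum]
  refine Finset.sum_congr rfl fun s _ => hQ _ _ ?_
  change (glue s T.toPreTree T'.toPreTree).IsLinearExtension _
  rw [hglue s]
  exact (conv s τ τ').isLinearExtension_tree
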